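/- Let $N\ge 2$ be an integer, $\alpha\in(0,2)$ and $\mathfrak C_1,\mathfrak C_2\ge 1$. Then there are constants $\varepsilon,\eta\in(0,1)$, depending only on $\mathfrak C_1,\mathfrak C_2,N,\alpha$, with the following property. Let $E\subset\mathbb R^N$ be a bounded domain and let $(\mu(x,\cdot))_{x\in\mathbb R^N}$ be a family of Borel measures on $\mathbb R^N$. For open $D\subseteq\mathbb R^N$ put $$\mathcal E_D^\mu(u,\varphi)=\int_D\int_D(u(y)-u(x))(\varphi(y)-\varphi(x))\,\mu(x,dy)\,dx,\qquad \mathcal E^\mu=\mathcal E^\mu_{\mathbb R^N}.$$ Write $u\in H^\mu_{\rm loc}(E)$ if $u:\mathbb R^N\to\mathbb R$ is Lebesgue measurable and $\mathcal E_D^\mu(u,u)<\infty$ for every open $D$ with $\overline D\subseteq E$, and $\varphi\in H^\mu(\mathbb R^N)$ if $\varphi\in L^2(\mathbb R^N)$ and $\mathcal E^\mu(\varphi,\varphi)<\infty$. Assume: (S) for every Borel set $\Omega$ the function $x\mapsto\mu(x,\Omega)$ is Lebesgue measurable, and $\int_{\Omega_1}\mu(x,\Omega_2)\,dx=\int_{\Omega_2}\mu(x,\Omega_1)\,dx$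 for all disjoint Borel sets $\Omega_1,\Omega_2$; (H$_1$) for every ball $B=B_\rho(x_0)\subset E$ and every $v\in H^\mu_{\rm loc}(E)$ that is integrable on $B$, with mean value $[v]_B=\frac1{|B|}\int_B v\,dx$, $$\int_{B}(v-[v]_{B})^2\,dx\le \mathfrak C_1\rho^\alpha\,\mathcal E^\mu_{B}(v,v);$$ (H$_2$) $\mu(x_0,\mathbb R^N\setminus B_r(x_0))\le \mathfrak C_2r^{-\alpha}$ for every $x_0\in\mathbb R^N$ and $r>0$. Let $u$ be a local weak super-solution in $E$ of $\mathrm{p.v.}\int_{\mathbb R^N}(u(x)-u(y))\,\mu(x,dy)=0$, that is, $u\in H^\mu_{\rm loc}(E)$, $$\sup_{x\in B_{7\rho/8}(z)}\int_{\mathbb R^N\setminus B_\rho(z)}|u(y)|\,\mu(x,dy)<\infty\quad\text{for every ball } B_\rho(z)\subset E,$$ and $\mathcal E^\mu(u,\varphi)\ge 0$ for every non-negative $\varphi\in H^\mu(\mathbb R^N)$ with $\operatorname{supp}\varphi\subseteq E$. Let $B_R(x_0)\subset E$ and suppose that $u\ge 0$ a.e. in $B_R(x_0)$. Then for every $0<r<R/32$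 the function $u^\varepsilon$ is integrable on $B_r(x_0)$ and $$\operatorname*{ess\,inf}_{B_{2r}(x_0)}u\ \ge\ \eta\left(\frac1{|B_r(x_0)|}\int_{B_r(x_0)}u^{\varepsilon}\,dx\right)^{1/\varepsilon}-\left(\frac rR\right)^{\alpha}\mathrm{Tail}\left(u_-;x_0,\tfrac78R,R\right),$$ where $u_-=\max\{-u,0\}$ and, for $v\ge0$, $$\mathrm{Tail}(v;x_0,r_1,r_2)=r_2^\alpha\sup_{x\in B_{r_1}(x_0)}\int_{\mathbb R^N\setminus B_{r_2}(x_0)}v(y)\,\mu(x,dy).$$ -/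

import Mathlib

open MeasureTheory Set

open scoped ENNReal

namespace NonlocalHarnack

/-- `N`-dimensional Euclidean space. -/
abbrev Eucl (N : ℕ) : Type := EuclideanSpace ℝ (Fin N)

/-- Symmetry of a family of Borel measures `(μ(x, ·))`: for every Borel set `Ω` the function
`x ↦ μ(x, Ω)` is Lebesgue measurable, and `∫_{Ω₁} μ(x, Ω₂) dx = ∫_{Ω₂} μ(x, Ω₁) dx` for all
disjoint Borel sets `Ω₁`, `Ω₂`. -/
def SymmetricFamily {N : ℕ} (μ : Eucl N → Measure (Eucl N)) : Prop :=
  (∀ Ω : Set (Eucl N), MeasurableSet Ω → AEMeasurable (fun x => μ x Ω) volume) ∧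
    ∀ Ω₁ Ω₂ : Set (Eucl N), MeasurableSet Ω₁ → MeasurableSet Ω₂ → Disjoint Ω₁ Ω₂ →
      (∫⁻ x in Ω₁, μ x Ω₂) = ∫⁻ x in Ω₂, μ x Ω₁

/-- The quadratic form evaluated on the diagonal, `∫_D ∫_D (u(y) - u(x))² μ(x, dy) dx`,
with values in `[0, ∞]`. -/
noncomputable def energy {N : ℕ} (μ : Eucl N → Measure (Eucl N)) (D : Set (Eucl N))
    (u : Eucl N → ℝ) : ℝ≥0∞ :=
  ∫⁻ x in D, ∫⁻ y in D, ENNReal.ofReal ((u y - u x) ^ 2) ∂(μ x)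

/-- The bilinear form on the whole space,
`∫ ∫ (u(y) - u(x)) (φ(y) - φ(x)) μ(x, dy) dx`. -/
noncomputable def form {N : ℕ} (μ : Eucl N → Measure (Eucl N)) (u φ : Eucl N → ℝ) : ℝ :=
  ∫ x, ∫ y, (u y - u x) * (φ y - φ x) ∂(μ x)

/-- The local space: Lebesgue measurable functions on the whole space whose energy on `D` is
finite for every open `D` with closure in `E`. -/
def MemHLoc {N : ℕ} (μ : Eucl N → Measure (Eucl N)) (E : Set (Eucl N)) (u : Eucl N → ℝ) : Prop :=
  AEMeasurable u volume ∧ ∀ D : Set (Eucl N), IsOpen D → closure D ⊆ E → energy μ D u < ∞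

/-- The global space: square integrable functions with finite energy on the whole space. -/
def MemH {N : ℕ} (μ : Eucl N → Measure (Eucl N)) (φ : Eucl N → ℝ) : Prop :=
  MemLp φ 2 volume ∧ energy μ univ φ < ∞

/-- Poincaré-type inequality with constant `C₁` on every ball contained in `E`, for every
function of the local space (whose mean value over the ball makes sense). -/
def PoincareInequality {N : ℕ} (μ : Eucl N → Measure (Eucl N)) (E : Set (Eucl N)) (α C₁ : ℝ) :
    Prop :=
  ∀ (x₀ : Eucl N) (ρ : ℝ), 0 < ρ → Metric.ball x₀ ρ ⊆ E →
    ∀ v : Eucl N → ℝ, MemHLoc μ E v → IntegrableOn v (Metric.ball x₀ ρ) volume →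
      ∫⁻ x in Metric.ball x₀ ρ, ENNReal.ofReal ((v x - ⨍ z in Metric.ball x₀ ρ, v z) ^ 2)
        ≤ ENNReal.ofReal (C₁ * ρ ^ α) * energy μ (Metric.ball x₀ ρ) v

/-- Decay of the measures: `μ(x₀, ℝᴺ \ B_r(x₀)) ≤ C₂ / r^α` for all `x₀` and all `r > 0`. -/
def DecayBound {N : ℕ} (μ : Eucl N → Measure (Eucl N)) (α C₂ : ℝ) : Prop :=
  ∀ (x₀ : Eucl N) (r : ℝ), 0 < r → μ x₀ (Metric.ball x₀ r)ᶜ ≤ ENNReal.ofReal (C₂ / r ^ α)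

/-- Local weak super-solutions in `E` of the equation
`p.v. ∫ (u(x) - u(y)) μ(x, dy) = 0`. -/
structure IsLocalWeakSupersolution {N : ℕ} (μ : Eucl N → Measure (Eucl N)) (E : Set (Eucl N))
    (u : Eucl N → ℝ) : Prop where
  memHLoc : MemHLoc μ E u
  tail_lt_top : ∀ (x₀ : Eucl N) (R : ℝ), 0 < R → Metric.ball x₀ R ⊆ E →
    (⨆ x ∈ Metric.ball x₀ (7 / 8 * R),
      ∫⁻ y in (Metric.ball x₀ R)ᶜ, ENNReal.ofReal |u y| ∂(μ x)) < ∞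
  form_nonneg : ∀ φ : Eucl N → ℝ, MemH μ φ → (∀ x, 0 ≤ φ x) → tsupport φ ⊆ E → 0 ≤ form μ u φ

/-- The nonlocal tail of a non-negative function `v`,
`r₂^α * sup_{x ∈ B_{r₁}(x₀)} ∫_{ℝᴺ \ B_{r₂}(x₀)} v(y) μ(x, dy)`, with values in `[0, ∞]`. -/
noncomputable def nonlocalTail {N : ℕ} (μ : Eucl N → Measure (Eucl N)) (α : ℝ)
    (v : Eucl N → ℝ≥0∞) (x₀ : Eucl N) (r₁ r₂ : ℝ) : ℝ≥0∞ :=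
  ENNReal.ofReal (r₂ ^ α) *
    ⨆ x ∈ Metric.ball x₀ r₁, ∫⁻ y in (Metric.ball x₀ r₂)ᶜ, v y ∂(μ x)

/-- The negative part `u₋ = max(-u, 0)`, as a function with values in `[0, ∞]`. -/
noncomputable def negPart {N : ℕ} (u : Eucl N → ℝ) : Eucl N → ℝ≥0∞ :=
  fun y => ENNReal.ofReal (max (-u y) 0)

end NonlocalHarnack

/-! ### A transition kernel behind the family `μ`. -/

namespace NonlocalHarnack

open ProbabilityTheory Metric

/-! Write `τ` for the scaled tail of `u₋` in the conclusion and `w = u + d` with `d > τ`. The shift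
by `d` makes the contribution of the negative values of `u` outside `B_R` comparable to the local
terms. The equation is tested with two functions, where `ψ` is a cutoff.

The test function `ψ² / w` gives a bound of order `s^(-α)` times the volume for the energy of `log
w` on balls of radius `s` (`log_pointwise`, `energy_log_le`). With the Poincaré inequality on all
balls, `log w` has bounded mean oscillation with a constant independent of `u` and `d`. The
John-Nirenberg inequality (`HasBMO.lintegral_exp_le`) then gives an exponent `ε` such that, with `a`
the mean of `log w` over `B_{4r}`, the mean of `w^ε` is at most a constant times `e^(εa)`, and the
set where `w < e^(a - t)` is a small part of `B_{4r}` once `t` is large. Since `log w` need not be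
known to be integrable, all this is done for `min (log w) n`, uniformly in `n`.

The test function `ψ² (k - w)₊` gives a Caccioppoli inequality (`energy_trunc_le`), and De Giorgi's
iteration turns smallness of `{w < k}` in `B_{4r}` into `w ≥ k / 2` a.e. in `B_{2r}`
(`exists_critical_density`). There is no Sobolev inequality to drive the iteration. Instead, if `{w
< k}` has volume at most a quarter of that of a ball of radius `σ`, the Poincaré inequality on every
ball of radius `σ`, averaged over the centres, bounds the `L²` norm of the truncation by `σ^α` times
its energy (`lintegral_sq_le_energy`). The small factor `σ^α` plays the role of the superlinear
gain.

Taking `k = e^(a - t)` links the two halves: `w ≥ k / 2` a.e. in `B_{2r}`, and `k` is comparable to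
the `ε`-mean of `w`. Letting `n → ∞` and then `d → τ` finishes the proof.

The measure-theoretic preparation is needed because `x ↦ μ x Ω` is only a.e. measurable for each
fixed `Ω`, and `μ x` may have any mass near `x`. Integrands of the form and the energy vanish on the
diagonal, so its mass can be dropped. What is left is an s-finite kernel `κ` up to a null set of `x`
(`exists_kernel`), the symmetry becomes invariance of `volume ⊗ₘ κ` under exchange
(`map_swap_compProd`), and Fubini applies to all double integrals. -/

theorem exists_null_measurable_ite {N : ℕ} (ν : Eucl N → Measure (Eucl N)) (B : Set (Eucl N))
    (hB : MeasurableSet B) (hfin : ∀ x ∈ B, ν x univ < ∞)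
    (hν : ∀ Ω : Set (Eucl N), MeasurableSet Ω → AEMeasurable (fun x => ν x Ω) volume) :
    ∃ Z : Set (Eucl N), MeasurableSet Z ∧ volume Z = 0 ∧
      Measurable ((B \ Z).indicator ν) := by
  classical
  set b := TopologicalSpace.countableBasis (Eucl N)
  -- The null set on which measurability in `x` fails depends on the set being measured. A countable
  -- π-system generating the Borel sets leaves only countably many null sets to discard; the
  -- remaining Borel sets follow by Dynkin's argument, which uses finiteness of the measures.
  set S : Set (Set (Eucl N)) := sInter '' {F : Set (Set (Eucl N)) | F.Finite ∧ F ⊆ b} with hS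
  have hb : b.Countable := TopologicalSpace.countable_countableBasis _
  have hcount : S.Countable := (countable_ofPred_finite_subset hb).image _
  have hmeas : ∀ s ∈ S, MeasurableSet s := by
    rintro _ ⟨F, ⟨hF, hFb⟩, rfl⟩
    exact MeasurableSet.sInter hF.countable fun t ht =>
      (TopologicalSpace.isOpen_of_mem_countableBasis (hFb ht)).measurableSet
  have huniv : univ ∈ S := ⟨∅, ⟨finite_empty, empty_subset _⟩, sInter_empty⟩
  have hgen : (inferInstance : MeasurableSpace (Eucl N)) = MeasurableSpace.generateFrom S := by
    apply le_antisymm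
    · rw [(TopologicalSpace.isBasis_countableBasis (Eucl N)).borel_eq_generateFrom.symm.trans
        (BorelSpace.measurable_eq (α := Eucl N)).symm |>.symm]
      refine MeasurableSpace.generateFrom_mono fun t ht => ?_
      exact ⟨{t}, ⟨finite_singleton t, singleton_subset_iff.2 ht⟩, sInter_singleton t⟩
    · exact MeasurableSpace.generateFrom_le hmeas
  have hpi : IsPiSystem S := by
    rintro _ ⟨F, ⟨hF, hFb⟩, rfl⟩ _ ⟨F', ⟨hF', hFb'⟩, rfl⟩ -
    exact ⟨F ∪ F', ⟨hF.union hF', union_subset hFb hFb'⟩, sInter_union _ _⟩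
  choose! Z hZ using fun (s : Set (Eucl N)) (hs : s ∈ S) =>
    exists_measurable_superset_of_null (ae_iff.1 (hν s (hmeas s hs)).ae_eq_mk)
  refine ⟨⋃ s ∈ S, Z s, MeasurableSet.biUnion hcount fun s hs => (hZ s hs).2.1,
    (measure_biUnion_null_iff hcount).2 fun s hs => (hZ s hs).2.2, ?_⟩
  set W := ⋃ s ∈ S, Z s
  have hW : MeasurableSet W := MeasurableSet.biUnion hcount fun s hs => (hZ s hs).2.1
  have key : ∀ s ∈ S, Measurable fun x => ((B \ W).indicator ν x) s := by
    intro s hs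
    have : (fun x => ((B \ W).indicator ν x) s)
        = (B \ W).indicator ((hν s (hmeas s hs)).mk _) := by
      ext x
      by_cases hx : x ∈ B \ W
      · simp only [indicator_of_mem hx]
        have h2 : x ∉ Z s := fun h => hx.2 (mem_biUnion hs h)
        have h3 := fun h => h2 ((hZ s hs).1 h)
        simpa using h3
      · simp [indicator_of_notMem hx]
    rw [this]
    exact (AEMeasurable.measurable_mk _).indicator (hB.diff hW)
  have : ∀ x, IsFiniteMeasure ((B \ W).indicator ν x) := by
    intro x
    by_cases hx : x ∈ B \ W
    · rw [indicator_of_mem hx]; exact ⟨hfin x hx.1⟩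
    · rw [indicator_of_notMem hx]; infer_instance
  exact Measurable.measure_of_isPiSystem hgen hpi key (key univ huniv)

/-- Countably many rectangles with sides at positive distance exhaust the complement of the
diagonal. On each of them the decay bound makes the mass finite, which gives access to uniqueness
and measurability results for finite measures. -/
theorem exists_separating_balls (N : ℕ) :
    ∃ (c : ℕ → Eucl N) (q : ℕ → ℝ), (∀ n, 0 < q n) ∧ ∀ x y, x ≠ y →
      ∃ n, x ∈ Metric.ball (c n) (q n) ∧ y ∈ (Metric.ball (c n) (2 * q n))ᶜ := by
  refine ⟨fun n => TopologicalSpace.denseSeq (Eucl N) n.unpair.1,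
    fun n => 1 / ((n.unpair.2 : ℝ) + 1), fun n => by positivity, fun x y hxy => ?_⟩
  have hd : 0 < dist x y := dist_pos.2 hxy
  obtain ⟨j, hj⟩ := exists_nat_one_div_lt (show 0 < dist x y / 3 by positivity)
  obtain ⟨i, hi⟩ := Metric.denseRange_iff.1 (TopologicalSpace.denseRange_denseSeq (Eucl N)) x
    (1 / ((j : ℝ) + 1)) (by positivity)
  refine ⟨Nat.pair i j, ?_, ?_⟩
  · simpa [Metric.mem_ball] using hi
  · simp only [mem_compl_iff, Metric.mem_ball, Nat.unpair_pair, not_lt]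
    have := dist_triangle x (TopologicalSpace.denseSeq (Eucl N) i) y
    rw [dist_comm y]
    linarith

/-- The family `μ`, with its mass at the diagonal removed, agrees almost everywhere with an
s-finite transition kernel. -/
theorem exists_kernel {N : ℕ} (μ : Eucl N → Measure (Eucl N))
    (hν : ∀ Ω : Set (Eucl N), MeasurableSet Ω → AEMeasurable (fun x => μ x Ω) volume)
    (hfin : ∀ r : ℝ, 0 < r → ∃ K : ℝ≥0∞, K < ∞ ∧ ∀ x, μ x (Metric.ball x r)ᶜ ≤ K) :
    ∃ κ : Kernel (Eucl N) (Eucl N), IsSFiniteKernel κ ∧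
      ∀ᵐ x, κ x = (μ x).restrict {x}ᶜ := by
  classical
  obtain ⟨c, q, hq, hcover⟩ := exists_separating_balls N
  let B : ℕ → Set (Eucl N) := fun n => Metric.ball (c n) (q n)
  let G : ℕ → Set (Eucl N) := fun n => (Metric.ball (c n) (2 * q n))ᶜ
  have hB : ∀ n, MeasurableSet (B n) := fun n => measurableSet_ball
  have hG : ∀ n, MeasurableSet (G n) := fun n => measurableSet_ball.compl
  have hGsub : ∀ n, ∀ x ∈ B n, G n ⊆ (Metric.ball x (q n))ᶜ := by
    intro n x hx y hy hxy
    apply hy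
    simp only [B, Metric.mem_ball] at hx hxy ⊢
    linarith [dist_triangle y x (c n)]
  have hloc : ∀ n, ∃ Z : Set (Eucl N), MeasurableSet Z ∧ volume Z = 0 ∧
      Measurable ((B n \ Z).indicator fun x => (μ x).restrict (G n)) := by
    intro n
    apply exists_null_measurable_ite _ _ (hB n)
    · intro x hx
      rw [Measure.restrict_apply_univ]
      obtain ⟨K, hK, hKx⟩ := hfin _ (hq n)
      exact ((measure_mono (hGsub n x hx)).trans (hKx x)).trans_lt hK
    · intro Ω hΩ
      simp only [Measure.restrict_apply hΩ]
      exact hν _ (hΩ.inter (hG n))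
  choose Z hZm hZ0 hZ using hloc
  let κ' : ℕ → Kernel (Eucl N) (Eucl N) := fun n => ⟨_, hZ n⟩
  have hκ' : ∀ n x, κ' n x = (B n \ Z n).indicator (fun x => (μ x).restrict (G n)) x :=
    fun n x => rfl
  have hfin' : ∀ n, IsFiniteKernel (κ' n) := by
    intro n
    obtain ⟨K, hK, hKx⟩ := hfin _ (hq n)
    refine ⟨⟨K, hK, fun x => ?_⟩⟩
    rw [hκ']
    by_cases hx : x ∈ B n \ Z n
    · rw [indicator_of_mem hx, Measure.restrict_apply_univ]
      exact (measure_mono (hGsub n x hx.1)).trans (hKx x)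
    · rw [indicator_of_notMem hx]; simp
  -- The rectangles overlap, so they are made disjoint before the local kernels are summed. The
  -- pieces are no longer rectangles, hence each kernel is cut down by an indicator density on
  -- pairs.
  let T : ℕ → Set (Eucl N × Eucl N) := disjointed fun n => B n ×ˢ G n
  have hT : ∀ n, MeasurableSet (T n) :=
    MeasurableSet.disjointed fun n => (hB n).prod (hG n)
  have hsf : ∀ n, IsSFiniteKernel
      ((κ' n).withDensity fun x y => (T n).indicator 1 (x, y)) := fun n =>
    Kernel.IsSFiniteKernel.withDensity (κ' n) fun x y => by
      by_cases h : (x, y) ∈ T n <;> simp [h]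
  refine ⟨Kernel.sum fun n => (κ' n).withDensity fun x y => (T n).indicator 1 (x, y),
    Kernel.isSFiniteKernel_sum (hκs := hsf), ?_⟩
  have hZae : ∀ᵐ x : Eucl N, ∀ n, x ∉ Z n := by
    rw [ae_all_iff]
    exact fun n => measure_eq_zero_iff_ae_notMem.1 (hZ0 n)
  filter_upwards [hZae] with x hx
  have hsec : ∀ n, MeasurableSet (Prod.mk x ⁻¹' T n) := fun n => measurable_prodMk_left (hT n)
  have h1 : ∀ n, ((κ' n).withDensity fun x y => (T n).indicator 1 (x, y)) x
      = (μ x).restrict (Prod.mk x ⁻¹' T n) := by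
    intro n
    rw [Kernel.withDensity_apply]
    · have : (fun y => (T n).indicator (1 : Eucl N × Eucl N → ℝ≥0∞) (x, y))
          = (Prod.mk x ⁻¹' T n).indicator 1 := by
        ext y; simp [indicator]
      rw [this, withDensity_indicator_one (hsec n), hκ']
      have hsub : T n ⊆ B n ×ˢ G n := disjointed_subset _ n
      by_cases hxB : x ∈ B n
      · rw [indicator_of_mem (show x ∈ B n \ Z n from ⟨hxB, hx n⟩), Measure.restrict_restrict (hsec n),
          inter_eq_left.2 (show Prod.mk x ⁻¹' T n ⊆ G n from fun y hy => (hsub hy).2)]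
      · have : Prod.mk x ⁻¹' T n = ∅ := by
          ext y; simp only [mem_preimage, mem_empty_iff_false, iff_false]
          exact fun h => hxB (hsub h).1
        rw [this]; simp
    · exact measurable_one.indicator (hT n)
  rw [Kernel.sum_apply]
  simp_rw [h1]
  rw [← Measure.restrict_iUnion]
  · congr 1
    rw [← preimage_iUnion, iUnion_disjointed]
    ext y
    simp only [mem_preimage, mem_iUnion, mem_prod, mem_compl_iff, mem_singleton_iff]
    refine ⟨?_, fun h => hcover x y (Ne.symm h)⟩
    rintro ⟨n, h1, h2⟩ rfl
    apply h2
    exact Metric.ball_subset_ball (by linarith [hq n]) h1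
  · exact fun i j hij => ((disjoint_disjointed _) hij).preimage _
  · exact hsec

theorem compProd_null_off_diagonal {N : ℕ} {μ : Eucl N → Measure (Eucl N)}
    {κ : Kernel (Eucl N) (Eucl N)} [IsSFiniteKernel κ]
    (hκ : ∀ᵐ x, κ x = (μ x).restrict {x}ᶜ) :
    (volume ⊗ₘ κ) {p | p.1 = p.2} = 0 := by
  have hm : MeasurableSet {p : Eucl N × Eucl N | p.1 = p.2} :=
    measurableSet_eq_fun measurable_fst measurable_snd
  rw [Measure.compProd_apply hm, lintegral_eq_zero_iff (Kernel.measurable_kernel_prodMk_left hm)]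
  filter_upwards [hκ] with x hx
  have : Prod.mk x ⁻¹' {p : Eucl N × Eucl N | p.1 = p.2} = {x} := by
    ext y; simp [eq_comm]
  rw [this, hx]
  simp

/-- For a symmetric family the induced measure on pairs is invariant under exchange. -/
theorem map_swap_compProd {N : ℕ} {μ : Eucl N → Measure (Eucl N)} (hμ : SymmetricFamily μ)
    (hfin : ∀ r : ℝ, 0 < r → ∃ K : ℝ≥0∞, K < ∞ ∧ ∀ x, μ x (Metric.ball x r)ᶜ ≤ K)
    {κ : Kernel (Eucl N) (Eucl N)} [IsSFiniteKernel κ]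
    (hκ : ∀ᵐ x, κ x = (μ x).restrict {x}ᶜ) :
    (volume ⊗ₘ κ).map Prod.swap = volume ⊗ₘ κ := by
  set m := volume ⊗ₘ κ with hm
  have hdiag : m {p | p.1 = p.2} = 0 := compProd_null_off_diagonal hκ
  have hrect : ∀ A B : Set (Eucl N), MeasurableSet A → MeasurableSet B → Disjoint A B →
      m (A ×ˢ B) = ∫⁻ x in A, μ x B := by
    intro A B hA hB hAB
    rw [hm, Measure.compProd_apply_prod hA hB]
    apply setLIntegral_congr_fun_ae hA
    filter_upwards [hκ] with x hx hxA
    rw [hx, Measure.restrict_apply hB, inter_eq_left.2]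
    rintro y hy rfl
    exact hAB.ne_of_mem hxA hy rfl
  have hswap : ∀ A B : Set (Eucl N), MeasurableSet A → MeasurableSet B → Disjoint A B →
      m.map Prod.swap (A ×ˢ B) = m (A ×ˢ B) := by
    intro A B hA hB hAB
    rw [Measure.map_apply measurable_swap (hA.prod hB), preimage_swap_prod,
      hrect _ _ hB hA hAB.symm, hrect _ _ hA hB hAB]
    exact hμ.2 _ _ hB hA hAB.symm
  obtain ⟨c, q, hq, hcover⟩ := exists_separating_balls N
  let B : ℕ → Set (Eucl N) := fun n => Metric.ball (c n) (q n)
  let G : ℕ → Set (Eucl N) := fun n => (Metric.ball (c n) (2 * q n))ᶜ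
  have hB : ∀ n, MeasurableSet (B n) := fun n => measurableSet_ball
  have hG : ∀ n, MeasurableSet (G n) := fun n => measurableSet_ball.compl
  have hdisj : ∀ n, Disjoint (B n) (G n) := fun n =>
    disjoint_compl_right.mono_left (Metric.ball_subset_ball (by linarith [hq n]))
  have hcov : (⋃ n, B n ×ˢ G n) = {p : Eucl N × Eucl N | p.1 = p.2}ᶜ := by
    ext ⟨x, y⟩
    simp only [mem_iUnion, mem_prod, mem_compl_iff, mem_ofPred_eq]
    exact ⟨fun ⟨n, h1, h2⟩ => (hdisj n).ne_of_mem h1 h2, hcover x y⟩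
  have hfinB : ∀ n, m (B n ×ˢ G n) < ∞ := by
    intro n
    obtain ⟨K, hK, hKx⟩ := hfin _ (hq n)
    rw [hrect _ _ (hB n) (hG n) (hdisj n)]
    calc ∫⁻ x in B n, μ x (G n) ≤ ∫⁻ x in B n, K := by
          refine setLIntegral_mono' (hB n) fun x hx => (measure_mono ?_).trans (hKx x)
          intro y hy hxy
          apply hy
          simp only [B, Metric.mem_ball] at hx hxy ⊢
          linarith [dist_triangle y x (c n)]
      _ < ∞ := by
          rw [setLIntegral_const]
          exact ENNReal.mul_lt_top hK measure_ball_lt_top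
  have hloc : ∀ n, (m.map Prod.swap).restrict (B n ×ˢ G n) = m.restrict (B n ×ˢ G n) := by
    intro n
    have : IsFiniteMeasure ((m.map Prod.swap).restrict (B n ×ˢ G n)) := by
      refine ⟨?_⟩
      rw [Measure.restrict_apply_univ, hswap _ _ (hB n) (hG n) (hdisj n)]
      exact hfinB n
    -- Every rectangle inside `B n ×ˢ G n` has disjoint sides, the only case covered by the symmetry
    -- hypothesis, and a finite measure is determined by its values on rectangles.
    refine Measure.ext_prod fun {s t} hs ht => ?_
    rw [Measure.restrict_apply (hs.prod ht), Measure.restrict_apply (hs.prod ht), prod_inter_prod]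
    exact hswap _ _ (hs.inter (hB n)) (ht.inter (hG n))
      ((hdisj n).mono inter_subset_right inter_subset_right)
  have h1 := Measure.restrict_iUnion_congr.2 hloc
  have hmd : MeasurableSet {p : Eucl N × Eucl N | p.1 = p.2} :=
    measurableSet_eq_fun measurable_fst measurable_snd
  have hswapdiag : Prod.swap ⁻¹' {p : Eucl N × Eucl N | p.1 = p.2} = {p | p.1 = p.2} := by
    ext ⟨x, y⟩; simp [eq_comm]
  have hres : ∀ m' : Measure (Eucl N × Eucl N), m' {p | p.1 = p.2} = 0 →
      m'.restrict {p | p.1 = p.2}ᶜ = m' := by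
    intro m' h
    refine Measure.restrict_eq_self_of_ae_mem ?_
    exact measure_eq_zero_iff_ae_notMem.1 h
  rw [hcov, hres _ hdiag, hres] at h1
  · exact h1
  · rw [Measure.map_apply measurable_swap hmd, hswapdiag, hdiag]

/-! ### The reduced setting and Lipschitz cutoffs. -/

/-- The measure on pairs of points induced by a transition kernel. -/
noncomputable abbrev pairMeasure {N : ℕ} (κ : Kernel (Eucl N) (Eucl N)) :
    Measure (Eucl N × Eucl N) := volume ⊗ₘ κ

/-- The data of the weak Harnack estimate, after replacing the family of measures by a kernel, the
super-solution by a Borel function which is non-negative on the ball, and fixing a positive upper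
bound `d` for the scaled tail. -/
structure JumpSetting {N : ℕ} (α C₁ C₂ : ℝ) (κ : Kernel (Eucl N) (Eucl N)) (u : Eucl N → ℝ)
    (x₀ : Eucl N) (R r d : ℝ) : Prop where
  alpha_pos : 0 < α
  alpha_lt : α < 2
  one_le_C₁ : 1 ≤ C₁
  one_le_C₂ : 1 ≤ C₂
  r_pos : 0 < r
  r_lt : 32 * r < R
  d_pos : 0 < d
  sfinite : IsSFiniteKernel κ
  symm : (pairMeasure κ).map Prod.swap = pairMeasure κ
  decay : ∀ᵐ x, ∀ ρ : ℝ, 0 < ρ → κ x (ball x ρ)ᶜ ≤ ENNReal.ofReal (C₂ / ρ ^ α)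
  measurable : Measurable u
  nonneg : ∀ x ∈ ball x₀ R, 0 ≤ u x
  energy_lt_top : ∫⁻ p in ball x₀ (3 / 4 * R) ×ˢ ball x₀ (3 / 4 * R),
    ENNReal.ofReal ((u p.2 - u p.1) ^ 2) ∂(pairMeasure κ) < ∞
  tail_lt_top : ∃ T : ℝ≥0∞, T < ∞ ∧ ∀ᵐ x, x ∈ ball x₀ (R / 2) →
    ∫⁻ y in (ball x₀ (3 / 4 * R))ᶜ, ENNReal.ofReal |u y| ∂(κ x) ≤ T
  neg_tail_le : ∀ᵐ x, x ∈ ball x₀ (R / 2) →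
    ∫⁻ y in (ball x₀ R)ᶜ, ENNReal.ofReal (-u y) ∂(κ x) ≤ ENNReal.ofReal (d / r ^ α)
  form_nonneg : ∀ φ : Eucl N → ℝ, Measurable φ → (∀ x, 0 ≤ φ x) → MemLp φ 2 volume →
    ∫⁻ p, ENNReal.ofReal ((φ p.2 - φ p.1) ^ 2) ∂(pairMeasure κ) < ∞ →
    (∀ x ∉ ball x₀ (R / 2), φ x = 0) →
    Integrable (fun p : Eucl N × Eucl N => (u p.2 - u p.1) * (φ p.2 - φ p.1)) (pairMeasure κ) →
    0 ≤ ∫ p, (u p.2 - u p.1) * (φ p.2 - φ p.1) ∂(pairMeasure κ)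
  poincare : ∀ (H : ℝ → ℝ) (K L : ℝ), (∀ t, |H t| ≤ K) → (∀ t t', |H t - H t'| ≤ L * |t - t'|) →
    ∀ y s, 0 < s → ball y s ⊆ ball x₀ R →
    ∫⁻ x in ball y s, ENNReal.ofReal ((H (u x) - ⨍ z in ball y s, H (u z)) ^ 2)
      ≤ ENNReal.ofReal (C₁ * s ^ α) * ∫⁻ p in ball y s ×ˢ ball y s,
        ENNReal.ofReal ((H (u p.2) - H (u p.1)) ^ 2) ∂(pairMeasure κ)

/-- A Lipschitz cutoff function between concentric balls of radii `s` and `s + g`. -/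
structure IsCutoff {N : ℕ} (ψ : Eucl N → ℝ) (y : Eucl N) (s g : ℝ) : Prop where
  continuous : Continuous ψ
  nonneg : ∀ x, 0 ≤ ψ x
  le_one : ∀ x, ψ x ≤ 1
  eq_one : ∀ x ∈ ball y s, ψ x = 1
  eq_zero : ∀ x ∉ ball y (s + g), ψ x = 0
  lipschitz : ∀ x z, |ψ z - ψ x| ≤ dist z x / g

theorem exists_isCutoff {N : ℕ} (y : Eucl N) (s : ℝ) {g : ℝ} (hg : 0 < g) :
    ∃ ψ : Eucl N → ℝ, IsCutoff ψ y s g := by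
  refine ⟨fun x => max 0 (min 1 ((s + g - dist x y) / g)), ?_, ?_, ?_, ?_, ?_, ?_⟩
  · fun_prop
  · exact fun x => le_max_left _ _
  · exact fun x => max_le zero_le_one (min_le_left _ _)
  · intro x hx
    rw [mem_ball] at hx
    have : 1 ≤ (s + g - dist x y) / g := by rw [le_div_iff₀ hg]; linarith
    simp [min_eq_left this]
  · intro x hx
    rw [mem_ball, not_lt] at hx
    have : (s + g - dist x y) / g ≤ 0 := div_nonpos_of_nonpos_of_nonneg (by linarith) hg.le
    exact max_eq_left ((min_le_right _ _).trans this)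
  · intro x z
    have h1 := abs_max_sub_max_le_max 0 (min 1 ((s + g - dist z y) / g)) 0
      (min 1 ((s + g - dist x y) / g))
    have h2 := abs_min_sub_min_le_max 1 ((s + g - dist z y) / g) 1 ((s + g - dist x y) / g)
    have h3 : |(s + g - dist z y) / g - (s + g - dist x y) / g| ≤ dist z x / g := by
      rw [← sub_div, abs_div, abs_of_pos hg]
      gcongr
      rw [show s + g - dist z y - (s + g - dist x y) = -(dist z y - dist x y) by ring, abs_neg]
      exact abs_dist_sub_le z x y
    simp only [sub_self, abs_zero] at h1 h2
    have h4 : 0 ≤ dist z x / g := by positivity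
    exact h1.trans (max_le h4 (h2.trans (max_le h4 h3)))

/-- The constant in the estimate of the energy density of a cutoff function. -/
noncomputable def jumpConst (α C₂ : ℝ) : ℝ := C₂ * 2 ^ α * (1 - 2 ^ α / 4)⁻¹

theorem two_rpow_div_four_lt_one {α : ℝ} (h : α < 2) : (2 : ℝ) ^ α / 4 < 1 := by
  have : (2 : ℝ) ^ α < 2 ^ (2 : ℝ) := Real.rpow_lt_rpow_of_exponent_lt one_lt_two h
  norm_num at this
  linarith

theorem jumpConst_pos {α C₂ : ℝ} (h : α < 2) (hC : 1 ≤ C₂) : 0 < jumpConst α C₂ := by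
  have := two_rpow_div_four_lt_one h
  have : 0 < 1 - (2 : ℝ) ^ α / 4 := by linarith
  unfold jumpConst
  positivity

/-- The difference of `ψ` is at most `min 1 (dist z x / g)`. If `dist z x` lies between `g / 2 ^ (i
+ 1)` and `g / 2 ^ i`, the `i`-th term alone suffices, and for `dist z x ≥ g` the term `i = 0` does.
Complements of balls replace annuli because their mass is what the decay hypothesis bounds. -/
theorem ofReal_sq_le_tsum_annuli {N : ℕ} {ψ : Eucl N → ℝ} {y : Eucl N} {s g : ℝ} (hg : 0 < g)
    (hψ : IsCutoff ψ y s g) (x z : Eucl N) :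
    ENNReal.ofReal ((ψ z - ψ x) ^ 2) ≤
      ∑' i : ℕ, (ball x (g / 2 ^ (i + 1)))ᶜ.indicator
        (fun _ => ENNReal.ofReal ((1 / 4) ^ i)) z := by
  have hdist : 0 ≤ dist z x := dist_nonneg
  rcases eq_or_ne z x with rfl | hne
  · simp
  have hpos : 0 < dist z x := dist_pos.2 hne
  by_cases h1 : g ≤ dist z x
  · refine le_trans ?_ (ENNReal.le_tsum 0)
    have hz : z ∈ (ball x (g / 2 ^ (0 + 1)))ᶜ := by
      simp only [mem_compl_iff, mem_ball, not_lt]; norm_num; linarith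
    rw [indicator_of_mem hz]
    apply ENNReal.ofReal_le_ofReal
    have := hψ.nonneg z; have := hψ.nonneg x; have := hψ.le_one z; have := hψ.le_one x
    norm_num
    rw [abs_le]; constructor <;> linarith
  · push Not at h1
    obtain ⟨i, hi1, hi2⟩ := exists_nat_pow_near_of_lt_one (x := dist z x / g) (y := 1 / 2)
      (by positivity) ((div_le_one hg).2 h1.le) (by norm_num) (by norm_num)
    refine le_trans ?_ (ENNReal.le_tsum i)
    have hz : z ∈ (ball x (g / 2 ^ (i + 1)))ᶜ := by
      simp only [mem_compl_iff, mem_ball, not_lt]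
      rw [lt_div_iff₀ hg] at hi1
      rw [one_div, inv_pow] at hi1
      rw [div_eq_inv_mul]; exact hi1.le
    rw [indicator_of_mem hz]
    apply ENNReal.ofReal_le_ofReal
    calc (ψ z - ψ x) ^ 2 = |ψ z - ψ x| ^ 2 := (sq_abs _).symm
      _ ≤ ((1 / 2) ^ i) ^ 2 := by
        gcongr; exact (hψ.lipschitz x z).trans hi2
      _ = (1 / 4) ^ i := by rw [← pow_mul, mul_comm, pow_mul]; norm_num

namespace JumpSetting

variable {N : ℕ} {α C₁ C₂ : ℝ} {κ : Kernel (Eucl N) (Eucl N)} {u : Eucl N → ℝ}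
  {x₀ : Eucl N} {R r d : ℝ}

theorem lintegral_sq_cutoff_le (S : JumpSetting α C₁ C₂ κ u x₀ R r d) {g : ℝ} (hg : 0 < g) :
    ∀ᵐ x, ∀ (ψ : Eucl N → ℝ) (y : Eucl N) (s : ℝ), IsCutoff ψ y s g →
    ∫⁻ z, ENNReal.ofReal ((ψ z - ψ x) ^ 2) ∂(κ x) ≤ ENNReal.ofReal (jumpConst α C₂ / g ^ α) := by
  filter_upwards [S.decay] with x hx ψ y s hψ
  have hα := S.alpha_lt
  have h2 := two_rpow_div_four_lt_one hα
  have hC := S.one_le_C₂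
  calc ∫⁻ z, ENNReal.ofReal ((ψ z - ψ x) ^ 2) ∂(κ x)
      ≤ ∫⁻ z, ∑' i : ℕ, (ball x (g / 2 ^ (i + 1)))ᶜ.indicator
        (fun _ => ENNReal.ofReal ((1 / 4) ^ i)) z ∂(κ x) :=
        lintegral_mono fun z => ofReal_sq_le_tsum_annuli hg hψ x z
    _ = ∑' i : ℕ, ENNReal.ofReal ((1 / 4) ^ i) * κ x (ball x (g / 2 ^ (i + 1)))ᶜ := by
        rw [lintegral_tsum fun i =>
          (measurable_const.indicator measurableSet_ball.compl).aemeasurable]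
        congr 1; ext i
        rw [lintegral_indicator_const measurableSet_ball.compl]
    -- The complement of the `i`-th ball has mass at most `C₂ * 2 ^ (α * (i + 1)) / g ^ α`, with
    -- weight `4 ^ (-i)`. The ratio `2 ^ α / 4` is below one exactly because `α < 2`.
    _ ≤ ∑' i : ℕ, ENNReal.ofReal (C₂ * 2 ^ α / g ^ α * (2 ^ α / 4) ^ i) := by
        refine ENNReal.tsum_le_tsum fun i => ?_
        refine (mul_le_mul_right (hx _ (by positivity)) _).trans ?_
        rw [← ENNReal.ofReal_mul (by positivity)]
        apply le_of_eq
        congr 1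
        rw [Real.div_rpow hg.le (by positivity), ← Real.rpow_natCast_mul (by norm_num)]
        rw [show (((i + 1 : ℕ) : ℝ) * α) = α * i + α by push_cast; ring,
          Real.rpow_add (by norm_num), Real.rpow_mul_natCast (by norm_num), div_pow, div_pow]
        have : (0:ℝ) < g ^ α := by positivity
        rw [one_pow]
        field_simp
    _ = ENNReal.ofReal (jumpConst α C₂ / g ^ α) := by
        rw [← ENNReal.ofReal_tsum_of_nonneg, tsum_mul_left, tsum_geometric_of_lt_one]
        · unfold jumpConst; congr 1; ring
        · positivity
        · exact h2
        · intro i; positivity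
        · exact (summable_geometric_of_lt_one (by positivity) h2).mul_left _

theorem lintegral_swap (S : JumpSetting α C₁ C₂ κ u x₀ R r d)
    {f : Eucl N × Eucl N → ℝ≥0∞} (hf : Measurable f) :
    ∫⁻ p, f p.swap ∂(pairMeasure κ) = ∫⁻ p, f p ∂(pairMeasure κ) := by
  conv_rhs => rw [← S.symm]
  rw [lintegral_map hf measurable_swap]

/-- Integration over pairs whose first point lies in `A`. -/
theorem lintegral_indicator_fst_le (S : JumpSetting α C₁ C₂ κ u x₀ R r d) {A : Set (Eucl N)}
    (hA : MeasurableSet A) {f : Eucl N × Eucl N → ℝ≥0∞} (hf : Measurable f) {c : ℝ≥0∞}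
    (h : ∀ᵐ x, x ∈ A → ∫⁻ y, f (x, y) ∂(κ x) ≤ c) :
    ∫⁻ p, A.indicator 1 p.1 * f p ∂(pairMeasure κ) ≤ c * volume A := by
  have := S.sfinite
  have hm : Measurable fun p : Eucl N × Eucl N => A.indicator (1 : Eucl N → ℝ≥0∞) p.1 :=
    (measurable_one.indicator hA).comp measurable_fst
  rw [Measure.lintegral_compProd (f := fun p => A.indicator 1 p.1 * f p) (hm.mul hf), ← setLIntegral_const, ← lintegral_indicator hA]
  apply lintegral_mono_ae
  filter_upwards [h] with x hx
  by_cases hxA : x ∈ A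
  · simpa [hxA] using hx hxA
  · simp [hxA]

end JumpSetting

/-! ### Integral bounds for the cutoff and tail terms. -/

/-- Pointwise majorant for the test function estimates. -/
noncomputable def majorant {N : ℕ} (c c' : ℝ) (A : Set (Eucl N)) (ψ u : Eucl N → ℝ)
    (x₀ : Eucl N) (R : ℝ) (p : Eucl N × Eucl N) : ℝ :=
  c * ((A.indicator 1 p.1 + A.indicator 1 p.2) * (ψ p.2 - ψ p.1) ^ 2) +
    c' * (A.indicator 1 p.1 * (ball x₀ R)ᶜ.indicator (fun y => max (-u y) 0) p.2 +
      A.indicator 1 p.2 * (ball x₀ R)ᶜ.indicator (fun y => max (-u y) 0) p.1)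

theorem ofReal_indicator_one {X : Type*} (A : Set X) (x : X) :
    ENNReal.ofReal (A.indicator 1 x) = A.indicator 1 x := by
  by_cases h : x ∈ A <;> simp [h]

theorem indicator_one_nonneg {X : Type*} (A : Set X) (x : X) : (0 : ℝ) ≤ A.indicator 1 x :=
  indicator_nonneg (fun _ _ => zero_le_one) x

theorem measurable_indicator_one_fst {N : ℕ} {A : Set (Eucl N)} (hA : MeasurableSet A) :
    Measurable fun p : Eucl N × Eucl N => A.indicator (1 : Eucl N → ℝ) p.1 :=
  (measurable_one.indicator hA).comp measurable_fst

theorem measurable_indicator_one_snd {N : ℕ} {A : Set (Eucl N)} (hA : MeasurableSet A) :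
    Measurable fun p : Eucl N × Eucl N => A.indicator (1 : Eucl N → ℝ) p.2 :=
  (measurable_one.indicator hA).comp measurable_snd

theorem majorant_nonneg {N : ℕ} {c c' : ℝ} (hc : 0 ≤ c) (hc' : 0 ≤ c') (A : Set (Eucl N))
    (ψ u : Eucl N → ℝ) (x₀ : Eucl N) (R : ℝ) (p : Eucl N × Eucl N) :
    0 ≤ majorant c c' A ψ u x₀ R p := by
  have h : ∀ y, 0 ≤ (ball x₀ R)ᶜ.indicator (fun y => max (-u y) 0) y := fun y =>
    indicator_nonneg (fun _ _ => le_max_right _ _) y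
  have := indicator_one_nonneg A p.1
  have := indicator_one_nonneg A p.2
  have := h p.1
  have := h p.2
  unfold majorant
  positivity

theorem measurable_majorant {N : ℕ} (c c' : ℝ) {A : Set (Eucl N)} (hA : MeasurableSet A)
    {ψ u : Eucl N → ℝ} (hψ : Measurable ψ) (hu : Measurable u) (x₀ : Eucl N) (R : ℝ) :
    Measurable (majorant c c' A ψ u x₀ R) := by
  have h1 := measurable_indicator_one_fst hA
  have h2 := measurable_indicator_one_snd hA
  have h3 : Measurable ((ball x₀ R)ᶜ.indicator fun y => max (-u y) 0) :=
    (hu.neg.max measurable_const).indicator measurableSet_ball.compl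
  have h4 : Measurable fun p : Eucl N × Eucl N =>
      (ball x₀ R)ᶜ.indicator (fun y => max (-u y) 0) p.1 := h3.comp measurable_fst
  have h5 : Measurable fun p : Eucl N × Eucl N =>
      (ball x₀ R)ᶜ.indicator (fun y => max (-u y) 0) p.2 := h3.comp measurable_snd
  have h6 : Measurable fun p : Eucl N × Eucl N => ψ p.1 := hψ.comp measurable_fst
  have h7 : Measurable fun p : Eucl N × Eucl N => ψ p.2 := hψ.comp measurable_snd
  exact (((h1.add h2).mul ((h7.sub h6).pow_const 2)).const_mul c).add
    (((h1.mul h5).add (h2.mul h4)).const_mul c')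

/-- Integrating `F + L ≤ U` with `∫ F ≥ 0` would suffice if everything were integrable. Nothing is
assumed on `L` and `U`: if `∫ U` is infinite the claim is void, and otherwise `L ≤ U - F` makes `L`
integrable. -/
theorem lintegral_ofReal_le_of_add_le {X : Type*} [MeasurableSpace X] {m : Measure X}
    {F L U : X → ℝ} (hF : Integrable F m) (h0 : 0 ≤ ∫ p, F p ∂m) (hL : Measurable L)
    (hU : Measurable U) (hL0 : ∀ p, 0 ≤ L p) (hU0 : ∀ p, 0 ≤ U p)
    (h : ∀ p, F p + L p ≤ U p) :
    ∫⁻ p, ENNReal.ofReal (L p) ∂m ≤ ∫⁻ p, ENNReal.ofReal (U p) ∂m := by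
  by_cases hfin : ∫⁻ p, ENNReal.ofReal (U p) ∂m = ∞
  · rw [hfin]; exact le_top
  have hUi : Integrable U m :=
    (lintegral_ofReal_ne_top_iff_integrable hU.aestronglyMeasurable
      (Filter.Eventually.of_forall hU0)).1 hfin
  have hLi : Integrable L m := by
    refine (hUi.sub hF).mono' hL.aestronglyMeasurable (Filter.Eventually.of_forall fun p => ?_)
    rw [Real.norm_of_nonneg (hL0 p), Pi.sub_apply]
    linarith [h p]
  rw [← ofReal_integral_eq_lintegral_ofReal hLi (Filter.Eventually.of_forall hL0),
    ← ofReal_integral_eq_lintegral_ofReal hUi (Filter.Eventually.of_forall hU0)]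
  apply ENNReal.ofReal_le_ofReal
  have : ∫ p, (F p + L p) ∂m ≤ ∫ p, U p ∂m := integral_mono (hF.add hLi) hUi h
  rw [integral_add hF hLi] at this
  linarith

namespace JumpSetting

variable {N : ℕ} {α C₁ C₂ : ℝ} {κ : Kernel (Eucl N) (Eucl N)} {u : Eucl N → ℝ}
  {x₀ : Eucl N} {R r d : ℝ}

theorem R_pos (S : JumpSetting α C₁ C₂ κ u x₀ R r d) : 0 < R := by
  linarith [S.r_pos, S.r_lt]

theorem lintegral_indicator_snd_le (S : JumpSetting α C₁ C₂ κ u x₀ R r d) {A : Set (Eucl N)}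
    (hA : MeasurableSet A) {f : Eucl N × Eucl N → ℝ≥0∞} (hf : Measurable f) {c : ℝ≥0∞}
    (h : ∀ᵐ x, x ∈ A → ∫⁻ y, f (y, x) ∂(κ x) ≤ c) :
    ∫⁻ p, A.indicator 1 p.2 * f p ∂(pairMeasure κ) ≤ c * volume A := by
  have hm : Measurable fun p : Eucl N × Eucl N => A.indicator (1 : Eucl N → ℝ≥0∞) p.2 :=
    (measurable_one.indicator hA).comp measurable_snd
  rw [← S.lintegral_swap (f := fun p => A.indicator 1 p.2 * f p) (hm.mul hf)]
  exact S.lintegral_indicator_fst_le hA (hf.comp measurable_swap) h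

theorem lintegral_cutoff_le (S : JumpSetting α C₁ C₂ κ u x₀ R r d) {A : Set (Eucl N)}
    (hA : MeasurableSet A) {ψ : Eucl N → ℝ} {y : Eucl N} {s g : ℝ} (hg : 0 < g)
    (hψ : IsCutoff ψ y s g) :
    ∫⁻ p, ENNReal.ofReal ((A.indicator 1 p.1 + A.indicator 1 p.2) * (ψ p.2 - ψ p.1) ^ 2)
      ∂(pairMeasure κ) ≤ ENNReal.ofReal (2 * (jumpConst α C₂ / g ^ α)) * volume A := by
  have h1 := measurable_indicator_one_fst hA
  have h2 := measurable_indicator_one_snd hA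
  have hψm := hψ.continuous.measurable
  have hm : Measurable fun p : Eucl N × Eucl N => ENNReal.ofReal ((ψ p.2 - ψ p.1) ^ 2) :=
    (((hψm.comp measurable_snd).sub (hψm.comp measurable_fst)).pow_const 2).ennreal_ofReal
  have hpt : ∀ p : Eucl N × Eucl N,
      ENNReal.ofReal ((A.indicator 1 p.1 + A.indicator 1 p.2) * (ψ p.2 - ψ p.1) ^ 2) =
      A.indicator 1 p.1 * ENNReal.ofReal ((ψ p.2 - ψ p.1) ^ 2) +
      A.indicator 1 p.2 * ENNReal.ofReal ((ψ p.2 - ψ p.1) ^ 2) := by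
    intro p
    have := indicator_one_nonneg A p.1
    have := indicator_one_nonneg A p.2
    rw [ENNReal.ofReal_mul (by positivity), ENNReal.ofReal_add (by positivity) (by positivity),
      ofReal_indicator_one, ofReal_indicator_one, add_mul]
  simp_rw [hpt]
  have hKJ := (jumpConst_pos S.alpha_lt S.one_le_C₂).le
  have hA1 : Measurable fun p : Eucl N × Eucl N => A.indicator (1 : Eucl N → ℝ≥0∞) p.1 *
      ENNReal.ofReal ((ψ p.2 - ψ p.1) ^ 2) :=
    ((measurable_one.indicator hA).comp measurable_fst).mul hm
  rw [lintegral_add_left hA1, two_mul,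
    ENNReal.ofReal_add (by positivity) (by positivity), add_mul]
  refine add_le_add (S.lintegral_indicator_fst_le hA hm ?_)
    (S.lintegral_indicator_snd_le hA hm ?_)
  · filter_upwards [S.lintegral_sq_cutoff_le hg] with x hx _ using hx ψ y s hψ
  · filter_upwards [S.lintegral_sq_cutoff_le hg] with x hx _
    refine le_trans (le_of_eq ?_) (hx ψ y s hψ)
    congr 1; ext z; congr 1; ring

/-- The cutoff term is paid for by the decay of the measures, the far term by the bound `d / r ^ α`
on the tail of the negative part. By the symmetry of the pair measure, the terms with the two points
exchanged cost the same, whence the factor 2. -/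
theorem lintegral_majorant_le (S : JumpSetting α C₁ C₂ κ u x₀ R r d) {A : Set (Eucl N)}
    (hA : MeasurableSet A) (hAR : A ⊆ ball x₀ (R / 2)) {ψ : Eucl N → ℝ} {y : Eucl N} {s g : ℝ}
    (hg : 0 < g) (hψ : IsCutoff ψ y s g) {c c' : ℝ} (hc : 0 ≤ c) (hc' : 0 ≤ c') :
    ∫⁻ p, ENNReal.ofReal (majorant c c' A ψ u x₀ R p) ∂(pairMeasure κ) ≤
      ENNReal.ofReal (2 * (c * (jumpConst α C₂ / g ^ α) + c' * (d / r ^ α))) * volume A := by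
  have hn : ∀ y, 0 ≤ (ball x₀ R)ᶜ.indicator (fun y => max (-u y) 0) y := fun y =>
    indicator_nonneg (fun _ _ => le_max_right _ _) y
  have h1 := measurable_indicator_one_fst hA
  have h2 := measurable_indicator_one_snd hA
  have hψm := hψ.continuous.measurable
  have hKJ := (jumpConst_pos S.alpha_lt S.one_le_C₂).le
  have hd := S.d_pos.le
  have hr := S.r_pos
  have hnm : Measurable ((ball x₀ R)ᶜ.indicator fun y => max (-u y) 0) :=
    (S.measurable.neg.max measurable_const).indicator measurableSet_ball.compl
  have hpt : ∀ p, ENNReal.ofReal (majorant c c' A ψ u x₀ R p) =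
      ENNReal.ofReal c * ENNReal.ofReal
        ((A.indicator 1 p.1 + A.indicator 1 p.2) * (ψ p.2 - ψ p.1) ^ 2) +
      ENNReal.ofReal c' * (A.indicator 1 p.1 *
          ENNReal.ofReal ((ball x₀ R)ᶜ.indicator (fun y => max (-u y) 0) p.2) +
        A.indicator 1 p.2 *
          ENNReal.ofReal ((ball x₀ R)ᶜ.indicator (fun y => max (-u y) 0) p.1)) := by
    intro p
    have := indicator_one_nonneg A p.1
    have := indicator_one_nonneg A p.2
    have := hn p.1
    have := hn p.2
    unfold majorant
    rw [ENNReal.ofReal_add (by positivity) (by positivity), ENNReal.ofReal_mul hc,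
      ENNReal.ofReal_mul hc', ENNReal.ofReal_add (by positivity) (by positivity),
      ENNReal.ofReal_mul (indicator_one_nonneg A p.1),
      ENNReal.ofReal_mul (indicator_one_nonneg A p.2), ofReal_indicator_one, ofReal_indicator_one]
  have hm1 : Measurable fun p : Eucl N × Eucl N =>
      ENNReal.ofReal ((A.indicator 1 p.1 + A.indicator 1 p.2) * (ψ p.2 - ψ p.1) ^ 2) :=
    ((h1.add h2).mul
      (((hψm.comp measurable_snd).sub (hψm.comp measurable_fst)).pow_const 2)).ennreal_ofReal
  have hm2 : Measurable fun p : Eucl N × Eucl N =>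
      ENNReal.ofReal ((ball x₀ R)ᶜ.indicator (fun y => max (-u y) 0) p.2) :=
    (hnm.comp measurable_snd).ennreal_ofReal
  have hm3 : Measurable fun p : Eucl N × Eucl N =>
      ENNReal.ofReal ((ball x₀ R)ᶜ.indicator (fun y => max (-u y) 0) p.1) :=
    (hnm.comp measurable_fst).ennreal_ofReal
  have hA1 : Measurable fun p : Eucl N × Eucl N => A.indicator (1 : Eucl N → ℝ≥0∞) p.1 :=
    (measurable_one.indicator hA).comp measurable_fst
  have hA2 : Measurable fun p : Eucl N × Eucl N => A.indicator (1 : Eucl N → ℝ≥0∞) p.2 :=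
    (measurable_one.indicator hA).comp measurable_snd
  have htail : ∀ᵐ x, x ∈ A →
      ∫⁻ z, ENNReal.ofReal ((ball x₀ R)ᶜ.indicator (fun y => max (-u y) 0) z) ∂(κ x) ≤
        ENNReal.ofReal (d / r ^ α) := by
    filter_upwards [S.neg_tail_le] with x hx hxA
    refine le_trans (le_of_eq ?_) (hx (hAR hxA))
    rw [← lintegral_indicator measurableSet_ball.compl]
    congr 1; ext z
    by_cases hz : z ∈ (ball x₀ R)ᶜ
    · rw [indicator_of_mem hz, indicator_of_mem hz]
      rcases le_total (-u z) 0 with h | h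
      · simp [max_eq_right h, ENNReal.ofReal_of_nonpos h]
      · simp [max_eq_left h]
    · simp only [indicator_of_notMem hz, ENNReal.ofReal_zero]
  have hm4 : Measurable fun p : Eucl N × Eucl N => A.indicator (1 : Eucl N → ℝ≥0∞) p.1 *
      ENNReal.ofReal ((ball x₀ R)ᶜ.indicator (fun y => max (-u y) 0) p.2) := hA1.mul hm2
  have hm5 : Measurable fun p : Eucl N × Eucl N => A.indicator (1 : Eucl N → ℝ≥0∞) p.2 *
      ENNReal.ofReal ((ball x₀ R)ᶜ.indicator (fun y => max (-u y) 0) p.1) := hA2.mul hm3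
  simp_rw [hpt]
  rw [lintegral_add_left (hm1.const_mul _), lintegral_const_mul _ hm1,
    lintegral_const_mul' _ _ ENNReal.ofReal_ne_top, lintegral_add_left hm4]
  have e1 := S.lintegral_cutoff_le hA hg hψ
  have e2 := S.lintegral_indicator_fst_le hA hm2 htail
  have e3 := S.lintegral_indicator_snd_le hA hm3 htail
  calc _ ≤ ENNReal.ofReal c * (ENNReal.ofReal (2 * (jumpConst α C₂ / g ^ α)) * volume A) +
        ENNReal.ofReal c' * (ENNReal.ofReal (d / r ^ α) * volume A +
          ENNReal.ofReal (d / r ^ α) * volume A) := by gcongr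
    _ = _ := by
      rw [← add_mul, ← ENNReal.ofReal_add (by positivity) (by positivity), ← mul_assoc,
        ← mul_assoc, ← ENNReal.ofReal_mul hc, ← ENNReal.ofReal_mul hc', ← add_mul,
        ← ENNReal.ofReal_add (by positivity) (by positivity)]
      congr 2; ring

end JumpSetting

/-! ### Admissibility of the test functions `ψ² H(u)`. -/

/-- Profiles `H` for which `ψ² H(u)` is an admissible test function. -/
structure IsTestProfile (H : ℝ → ℝ) (K L : ℝ) : Prop where
  nonneg : ∀ t, 0 ≤ H t
  le : ∀ t, H t ≤ K
  lipschitz : ∀ t t', |H t - H t'| ≤ L * |t - t'|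
  mul_le : ∀ t, 0 ≤ t → t * H t ≤ K

namespace IsTestProfile

variable {H : ℝ → ℝ} {K L : ℝ}

theorem continuous (hH : IsTestProfile H K L) : Continuous H := by
  have hL : 0 ≤ L := by
    have := (abs_nonneg _).trans (hH.lipschitz 0 1)
    simpa using this
  refine (LipschitzWith.of_dist_le_mul (K := L.toNNReal) fun x y => ?_).continuous
  rw [Real.coe_toNNReal L hL, Real.dist_eq, Real.dist_eq]
  exact hH.lipschitz x y

theorem sq_sub_le (hH : IsTestProfile H K L) {s t a b : ℝ} (hs : 0 ≤ s) (hs1 : s ≤ 1)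
    (ht : 0 ≤ t) (ht1 : t ≤ 1) :
    (t ^ 2 * H b - s ^ 2 * H a) ^ 2 ≤ 8 * K ^ 2 * (t - s) ^ 2 + 2 * L ^ 2 * (b - a) ^ 2 := by
  have h1 : (H b - H a) ^ 2 ≤ L ^ 2 * (b - a) ^ 2 := by
    rw [← sq_abs (H b - H a), ← sq_abs (b - a), ← mul_pow]
    exact pow_le_pow_left₀ (abs_nonneg _) (hH.lipschitz b a) 2
  have h2 : (H b) ^ 2 ≤ K ^ 2 := pow_le_pow_left₀ (hH.nonneg b) (hH.le b) 2
  have h3 : (t + s) ^ 2 ≤ 4 := by nlinarith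
  have h4 : ((t ^ 2 - s ^ 2) * H b) ^ 2 ≤ 4 * K ^ 2 * (t - s) ^ 2 := by
    calc ((t ^ 2 - s ^ 2) * H b) ^ 2 = (t + s) ^ 2 * (H b) ^ 2 * (t - s) ^ 2 := by ring
      _ ≤ 4 * K ^ 2 * (t - s) ^ 2 := by gcongr
  have h5 : (s ^ 2 * (H b - H a)) ^ 2 ≤ L ^ 2 * (b - a) ^ 2 := by
    have : (s ^ 2) ^ 2 ≤ 1 := pow_le_one₀ (by positivity) (pow_le_one₀ hs hs1)
    calc (s ^ 2 * (H b - H a)) ^ 2 = (s ^ 2) ^ 2 * (H b - H a) ^ 2 := by ring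
      _ ≤ 1 * (L ^ 2 * (b - a) ^ 2) := by gcongr
      _ = _ := one_mul _
  calc (t ^ 2 * H b - s ^ 2 * H a) ^ 2
      = ((t ^ 2 - s ^ 2) * H b + s ^ 2 * (H b - H a)) ^ 2 := by ring
    _ ≤ 2 * ((t ^ 2 - s ^ 2) * H b) ^ 2 + 2 * (s ^ 2 * (H b - H a)) ^ 2 := by
      nlinarith [sq_nonneg ((t ^ 2 - s ^ 2) * H b - s ^ 2 * (H b - H a))]
    _ ≤ _ := by linarith

end IsTestProfile

namespace JumpSetting

variable {N : ℕ} {α C₁ C₂ : ℝ} {κ : Kernel (Eucl N) (Eucl N)} {u : Eucl N → ℝ}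
  {x₀ : Eucl N} {R r d : ℝ}

/-- This gives finite energy of the test function. If both points lie in the support region `B`, a
product rule applies. If only one does, `ψ` vanishes at the other point, so the difference of `ψ`
already controls the test function. -/
theorem testFunction_sq_le {H : ℝ → ℝ} {K L : ℝ} (hH : IsTestProfile H K L)
    {ψ : Eucl N → ℝ} {B D : Set (Eucl N)} (hψ0 : ∀ x, 0 ≤ ψ x) (hψ1 : ∀ x, ψ x ≤ 1)
    (hψB : ∀ x ∉ B, ψ x = 0) (hBD : B ⊆ D) (u : Eucl N → ℝ) (x z : Eucl N) :
    (ψ z ^ 2 * H (u z) - ψ x ^ 2 * H (u x)) ^ 2 ≤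
      8 * K ^ 2 * ((B.indicator 1 x + B.indicator 1 z) * (ψ z - ψ x) ^ 2) +
        2 * L ^ 2 * (D ×ˢ D).indicator (fun p => (u p.2 - u p.1) ^ 2) (x, z) := by
  have hone : ∀ x z, x ∈ B → z ∉ B →
      (ψ x ^ 2 * H (u x)) ^ 2 ≤ 8 * K ^ 2 * ψ x ^ 2 := by
    intro x z hx hz
    have h2 : (H (u x)) ^ 2 ≤ K ^ 2 := pow_le_pow_left₀ (hH.nonneg _) (hH.le _) 2
    have h3 : ψ x ^ 2 ≤ 1 := pow_le_one₀ (hψ0 x) (hψ1 x)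
    calc (ψ x ^ 2 * H (u x)) ^ 2 = ψ x ^ 2 * (H (u x)) ^ 2 * ψ x ^ 2 := by ring
      _ ≤ 1 * K ^ 2 * ψ x ^ 2 := by gcongr
      _ ≤ _ := by nlinarith [mul_nonneg (sq_nonneg K) (sq_nonneg (ψ x))]
  have hi : ∀ p, 0 ≤ (D ×ˢ D).indicator (fun p => (u p.2 - u p.1) ^ 2) p := fun p =>
    indicator_nonneg (fun _ _ => sq_nonneg _) p
  have hi' := hi (x, z)
  have hL : 0 ≤ 2 * L ^ 2 * (D ×ˢ D).indicator (fun p => (u p.2 - u p.1) ^ 2) (x, z) := by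
    positivity
  by_cases hx : x ∈ B <;> by_cases hz : z ∈ B
  · have hxz : (x, z) ∈ D ×ˢ D := ⟨hBD hx, hBD hz⟩
    rw [indicator_of_mem hxz]
    simp only [indicator_of_mem hx, indicator_of_mem hz, Pi.one_apply]
    refine (hH.sq_sub_le (hψ0 x) (hψ1 x) (hψ0 z) (hψ1 z)).trans ?_
    nlinarith [mul_nonneg (sq_nonneg K) (sq_nonneg (ψ z - ψ x))]
  · have := hone x z hx hz
    simp only [indicator_of_mem hx, indicator_of_notMem hz, Pi.one_apply, hψB z hz]
    nlinarith
  · have := hone z x hz hx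
    simp only [indicator_of_mem hz, indicator_of_notMem hx, Pi.one_apply, hψB x hx]
    nlinarith
  · simp only [indicator_of_notMem hz, indicator_of_notMem hx, hψB x hx, hψB z hz]
    linarith

/-- An integrable majorant of the integrand of the form. Inside `D ×ˢ D` it is the
arithmetic-geometric mean inequality. When one point is far away, `|u z - u x|` is not square
integrable in general; the bound `t * H t ≤ K` absorbs the near value of `u` and only `1 + |u|` at
the far point is left, which the tail assumption handles. -/
theorem testFunction_form_le {H : ℝ → ℝ} {K L : ℝ} (hH : IsTestProfile H K L)
    {ψ : Eucl N → ℝ} {B D : Set (Eucl N)} (hψ0 : ∀ x, 0 ≤ ψ x) (hψ1 : ∀ x, ψ x ≤ 1)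
    (hψB : ∀ x ∉ B, ψ x = 0) (hBD : B ⊆ D) {u : Eucl N → ℝ} (hu : ∀ x ∈ B, 0 ≤ u x)
    (x z : Eucl N) :
    |(u z - u x) * (ψ z ^ 2 * H (u z) - ψ x ^ 2 * H (u x))| ≤
      (D ×ˢ D).indicator (fun p => (u p.2 - u p.1) ^ 2) (x, z) +
        (ψ z ^ 2 * H (u z) - ψ x ^ 2 * H (u x)) ^ 2 +
        K * (B.indicator 1 x * Dᶜ.indicator (fun y => 1 + |u y|) z +
          B.indicator 1 z * Dᶜ.indicator (fun y => 1 + |u y|) x) := by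
  have hK : 0 ≤ K := (hH.nonneg 0).trans (hH.le 0)
  have hn : ∀ y, 0 ≤ Dᶜ.indicator (fun y => 1 + |u y|) y := fun y =>
    indicator_nonneg (fun _ _ => by positivity) y
  have hT : 0 ≤ K * (B.indicator 1 x * Dᶜ.indicator (fun y => 1 + |u y|) z +
      B.indicator 1 z * Dᶜ.indicator (fun y => 1 + |u y|) x) := by
    have := hn x
    have := hn z
    have := indicator_one_nonneg B x
    have := indicator_one_nonneg B z
    positivity
  have hone : ∀ x z, x ∈ B → z ∉ D → |u z - u x| * (ψ x ^ 2 * H (u x)) ≤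
      K * (1 + |u z|) := by
    intro x z hx hz
    have h1 : ψ x ^ 2 ≤ 1 := pow_le_one₀ (hψ0 x) (hψ1 x)
    have h2 := hH.nonneg (u x)
    have h3 : |u z - u x| ≤ |u z| + u x := by
      refine (abs_sub _ _).trans ?_
      rw [abs_of_nonneg (hu x hx)]
    have hux := hu x hx
    calc |u z - u x| * (ψ x ^ 2 * H (u x)) ≤ (|u z| + u x) * (1 * H (u x)) := by gcongr
      _ = |u z| * H (u x) + u x * H (u x) := by ring
      _ ≤ |u z| * K + K := by
        gcongr
        · exact hH.le _
        · exact hH.mul_le _ (hu x hx)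
      _ = _ := by ring
  have hsq : 0 ≤ (ψ z ^ 2 * H (u z) - ψ x ^ 2 * H (u x)) ^ 2 := sq_nonneg _
  have hi : 0 ≤ (D ×ˢ D).indicator (fun p => (u p.2 - u p.1) ^ 2) (x, z) :=
    indicator_nonneg (fun _ _ => sq_nonneg _) _
  by_cases hx : x ∈ D <;> by_cases hz : z ∈ D
  · have hxz : (x, z) ∈ D ×ˢ D := ⟨hx, hz⟩
    rw [indicator_of_mem hxz] at hi ⊢
    rw [abs_mul]
    have h1 := sq_abs (u z - u x)
    have h2 := sq_abs (ψ z ^ 2 * H (u z) - ψ x ^ 2 * H (u x))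
    simp only at hi ⊢
    nlinarith [sq_nonneg (|u z - u x| - |ψ z ^ 2 * H (u z) - ψ x ^ 2 * H (u x)|)]
  · have hzB : z ∉ B := fun h => hz (hBD h)
    by_cases hxB : x ∈ B
    · have := hone x z hxB hz
      have h0 : 0 ≤ ψ x ^ 2 * H (u x) := mul_nonneg (sq_nonneg _) (hH.nonneg _)
      have hzc : z ∈ Dᶜ := hz
      simp only [indicator_of_mem hxB, indicator_of_notMem hzB, indicator_of_mem hzc,
        Pi.one_apply, one_mul, zero_mul, add_zero]
      rw [abs_mul]
      have : |ψ z ^ 2 * H (u z) - ψ x ^ 2 * H (u x)| = ψ x ^ 2 * H (u x) := by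
        rw [hψB z hzB]; simp [abs_of_nonneg h0]
      rw [this]
      linarith
    · rw [hψB x hxB, hψB z hzB] at *
      simp only [ne_eq, OfNat.ofNat_ne_zero, not_false_eq_true, zero_pow, zero_mul, sub_self,
        mul_zero, abs_zero] at *
      linarith
  · have hxB : x ∉ B := fun h => hx (hBD h)
    by_cases hzB : z ∈ B
    · have := hone z x hzB hx
      have h0 : 0 ≤ ψ z ^ 2 * H (u z) := mul_nonneg (sq_nonneg _) (hH.nonneg _)
      have hxc : x ∈ Dᶜ := hx
      simp only [indicator_of_mem hzB, indicator_of_notMem hxB, indicator_of_mem hxc,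
        Pi.one_apply, one_mul, zero_mul, zero_add]
      rw [abs_mul, abs_sub_comm (u z)]
      have : |ψ z ^ 2 * H (u z) - ψ x ^ 2 * H (u x)| = ψ z ^ 2 * H (u z) := by
        rw [hψB x hxB]; simp [abs_of_nonneg h0]
      rw [this]
      linarith
    · rw [hψB x hxB, hψB z hzB] at *
      simp only [ne_eq, OfNat.ofNat_ne_zero, not_false_eq_true, zero_pow, zero_mul, sub_self,
        mul_zero, abs_zero] at *
      linarith
  · have hxB : x ∉ B := fun h => hx (hBD h)
    have hzB : z ∉ B := fun h => hz (hBD h)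
    rw [hψB x hxB, hψB z hzB] at *
    simp only [ne_eq, OfNat.ofNat_ne_zero, not_false_eq_true, zero_pow, zero_mul, sub_self,
      mul_zero, abs_zero] at *
    linarith

end JumpSetting

namespace JumpSetting

variable {N : ℕ} {α C₁ C₂ : ℝ} {κ : Kernel (Eucl N) (Eucl N)} {u : Eucl N → ℝ}
  {x₀ : Eucl N} {R r d : ℝ}

theorem measurable_sq_sub (S : JumpSetting α C₁ C₂ κ u x₀ R r d) :
    Measurable fun p : Eucl N × Eucl N => (u p.2 - u p.1) ^ 2 :=
  ((S.measurable.comp measurable_snd).sub (S.measurable.comp measurable_fst)).pow_const 2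

theorem lintegral_indicator_sq_lt_top (S : JumpSetting α C₁ C₂ κ u x₀ R r d) :
    ∫⁻ p, ENNReal.ofReal ((ball x₀ (3 / 4 * R) ×ˢ ball x₀ (3 / 4 * R)).indicator
      (fun p : Eucl N × Eucl N => (u p.2 - u p.1) ^ 2) p) ∂(pairMeasure κ) < ∞ := by
  refine lt_of_eq_of_lt ?_ S.energy_lt_top
  rw [← lintegral_indicator (measurableSet_ball.prod measurableSet_ball)]
  congr 1; ext p
  by_cases hp : p ∈ ball x₀ (3 / 4 * R) ×ˢ ball x₀ (3 / 4 * R)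
  · rw [indicator_of_mem hp, indicator_of_mem hp]
  · rw [indicator_of_notMem hp, indicator_of_notMem hp, ENNReal.ofReal_zero]

theorem lintegral_testFunction_sq_lt_top (S : JumpSetting α C₁ C₂ κ u x₀ R r d)
    {H : ℝ → ℝ} {K L : ℝ} (hH : IsTestProfile H K L) {ψ : Eucl N → ℝ} {y : Eucl N} {s g : ℝ}
    (hg : 0 < g) (hψ : IsCutoff ψ y s g) (hB : ball y (s + g) ⊆ ball x₀ (R / 2)) :
    ∫⁻ p, ENNReal.ofReal ((ψ p.2 ^ 2 * H (u p.2) - ψ p.1 ^ 2 * H (u p.1)) ^ 2)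
      ∂(pairMeasure κ) < ∞ := by
  have hR := S.R_pos
  have hBD : ball y (s + g) ⊆ ball x₀ (3 / 4 * R) :=
    hB.trans (ball_subset_ball (by linarith))
  set f₁ : Eucl N × Eucl N → ℝ := fun p =>
    ((ball y (s + g)).indicator 1 p.1 + (ball y (s + g)).indicator 1 p.2) *
      (ψ p.2 - ψ p.1) ^ 2 with hf₁
  set f₂ : Eucl N × Eucl N → ℝ := (ball x₀ (3 / 4 * R) ×ˢ ball x₀ (3 / 4 * R)).indicator
      (fun p : Eucl N × Eucl N => (u p.2 - u p.1) ^ 2) with hf₂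
  have hm₁ : Measurable f₁ := ((measurable_indicator_one_fst measurableSet_ball).add
    (measurable_indicator_one_snd measurableSet_ball)).mul
    (((hψ.continuous.measurable.comp measurable_snd).sub
      (hψ.continuous.measurable.comp measurable_fst)).pow_const 2)
  calc _ ≤ ∫⁻ p, (ENNReal.ofReal (8 * K ^ 2) * ENNReal.ofReal (f₁ p) +
        ENNReal.ofReal (2 * L ^ 2) * ENNReal.ofReal (f₂ p)) ∂(pairMeasure κ) := by
        refine lintegral_mono fun p => ?_
        rw [← ENNReal.ofReal_mul (by positivity), ← ENNReal.ofReal_mul (by positivity)]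
        refine le_trans (ENNReal.ofReal_le_ofReal ?_) ENNReal.ofReal_add_le
        exact testFunction_sq_le hH hψ.nonneg hψ.le_one hψ.eq_zero hBD u p.1 p.2
    _ = ENNReal.ofReal (8 * K ^ 2) * ∫⁻ p, ENNReal.ofReal (f₁ p) ∂(pairMeasure κ) +
        ENNReal.ofReal (2 * L ^ 2) * ∫⁻ p, ENNReal.ofReal (f₂ p) ∂(pairMeasure κ) := by
        rw [lintegral_add_left (hm₁.ennreal_ofReal.const_mul _),
          lintegral_const_mul' _ _ ENNReal.ofReal_ne_top,
          lintegral_const_mul' _ _ ENNReal.ofReal_ne_top]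
    _ < ∞ := by
        refine ENNReal.add_lt_top.2 ⟨ENNReal.mul_lt_top ENNReal.ofReal_lt_top ?_,
          ENNReal.mul_lt_top ENNReal.ofReal_lt_top S.lintegral_indicator_sq_lt_top⟩
        exact (S.lintegral_cutoff_le measurableSet_ball hg hψ).trans_lt
          (ENNReal.mul_lt_top ENNReal.ofReal_lt_top measure_ball_lt_top)

theorem lintegral_far_lt_top (S : JumpSetting α C₁ C₂ κ u x₀ R r d) {B : Set (Eucl N)}
    (hBm : MeasurableSet B) (hB : B ⊆ ball x₀ (R / 2)) :
    ∫⁻ p, ENNReal.ofReal (B.indicator 1 p.1 *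
        (ball x₀ (3 / 4 * R))ᶜ.indicator (fun y => 1 + |u y|) p.2 + B.indicator 1 p.2 *
        (ball x₀ (3 / 4 * R))ᶜ.indicator (fun y => 1 + |u y|) p.1) ∂(pairMeasure κ) < ∞ := by
  have hR := S.R_pos
  have hn : ∀ y, 0 ≤ (ball x₀ (3 / 4 * R))ᶜ.indicator (fun y => 1 + |u y|) y := fun y =>
    indicator_nonneg (fun _ _ => by positivity) y
  have hum : Measurable fun y => |u y| := continuous_abs.measurable.comp S.measurable
  have hnm : Measurable ((ball x₀ (3 / 4 * R))ᶜ.indicator (fun y => 1 + |u y|)) :=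
    (measurable_const.add hum).indicator measurableSet_ball.compl
  obtain ⟨T, hT, htail⟩ := S.tail_lt_top
  have hfar : ∀ᵐ x, x ∈ B → ∫⁻ z, ENNReal.ofReal
      ((ball x₀ (3 / 4 * R))ᶜ.indicator (fun y => 1 + |u y|) z) ∂(κ x) ≤
      ENNReal.ofReal (C₂ / (R / 4) ^ α) + T := by
    filter_upwards [htail, S.decay] with x hx hx' hxB
    have hmem := hB hxB
    calc _ = ∫⁻ z in (ball x₀ (3 / 4 * R))ᶜ, (1 + ENNReal.ofReal |u z|) ∂(κ x) := by
          rw [← lintegral_indicator measurableSet_ball.compl]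
          congr 1; ext z
          by_cases hz : z ∈ (ball x₀ (3 / 4 * R))ᶜ
          · rw [indicator_of_mem hz, indicator_of_mem hz,
              ENNReal.ofReal_add zero_le_one (abs_nonneg _), ENNReal.ofReal_one]
          · rw [indicator_of_notMem hz, indicator_of_notMem hz, ENNReal.ofReal_zero]
      _ = κ x (ball x₀ (3 / 4 * R))ᶜ +
          ∫⁻ z in (ball x₀ (3 / 4 * R))ᶜ, ENNReal.ofReal |u z| ∂(κ x) := by
          rw [lintegral_add_left measurable_const, setLIntegral_const, one_mul]
      _ ≤ _ := by
          refine add_le_add (le_trans (measure_mono ?_) (hx' (R / 4) (by positivity))) (hx hmem)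
          refine compl_subset_compl.2 (ball_subset_ball' ?_)
          rw [mem_ball] at hmem
          linarith
  have hm2 : Measurable fun p : Eucl N × Eucl N =>
      ENNReal.ofReal ((ball x₀ (3 / 4 * R))ᶜ.indicator (fun y => 1 + |u y|) p.2) :=
    (hnm.comp measurable_snd).ennreal_ofReal
  have hm3 : Measurable fun p : Eucl N × Eucl N =>
      ENNReal.ofReal ((ball x₀ (3 / 4 * R))ᶜ.indicator (fun y => 1 + |u y|) p.1) :=
    (hnm.comp measurable_fst).ennreal_ofReal
  have hm4 : Measurable fun p : Eucl N × Eucl N => B.indicator (1 : Eucl N → ℝ≥0∞) p.1 *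
      ENNReal.ofReal ((ball x₀ (3 / 4 * R))ᶜ.indicator (fun y => 1 + |u y|) p.2) :=
    ((measurable_one.indicator hBm).comp measurable_fst).mul hm2
  have hc : ENNReal.ofReal (C₂ / (R / 4) ^ α) + T < ∞ :=
    ENNReal.add_lt_top.2 ⟨ENNReal.ofReal_lt_top, hT⟩
  have hvol : volume B < ∞ := (measure_mono hB).trans_lt measure_ball_lt_top
  calc _ ≤ ∫⁻ p, (B.indicator 1 p.1 * ENNReal.ofReal
          ((ball x₀ (3 / 4 * R))ᶜ.indicator (fun y => 1 + |u y|) p.2) +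
        B.indicator 1 p.2 * ENNReal.ofReal
          ((ball x₀ (3 / 4 * R))ᶜ.indicator (fun y => 1 + |u y|) p.1)) ∂(pairMeasure κ) := by
        refine lintegral_mono fun p => ?_
        refine ENNReal.ofReal_add_le.trans (le_of_eq ?_)
        rw [ENNReal.ofReal_mul (indicator_one_nonneg B p.1),
          ENNReal.ofReal_mul (indicator_one_nonneg B p.2), ofReal_indicator_one,
          ofReal_indicator_one]
    _ < ∞ := by
        rw [lintegral_add_left hm4]
        exact ENNReal.add_lt_top.2
          ⟨(S.lintegral_indicator_fst_le hBm hm2 hfar).trans_lt (ENNReal.mul_lt_top hc hvol),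
          (S.lintegral_indicator_snd_le hBm hm3 hfar).trans_lt (ENNReal.mul_lt_top hc hvol)⟩

/-- Testing the super-solution property with `ψ² H(u)`. -/
theorem lintegral_le_of_test (S : JumpSetting α C₁ C₂ κ u x₀ R r d)
    {H : ℝ → ℝ} {K L : ℝ} (hH : IsTestProfile H K L) {ψ : Eucl N → ℝ} {y : Eucl N} {s g : ℝ}
    (hg : 0 < g) (hψ : IsCutoff ψ y s g) (hB : ball y (s + g) ⊆ ball x₀ (R / 2))
    {Λ U : Eucl N × Eucl N → ℝ} (hΛ : Measurable Λ) (hU : Measurable U) (hΛ0 : ∀ p, 0 ≤ Λ p)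
    (hU0 : ∀ p, 0 ≤ U p)
    (h : ∀ x z, (u z - u x) * (ψ z ^ 2 * H (u z) - ψ x ^ 2 * H (u x)) + Λ (x, z) ≤ U (x, z)) :
    ∫⁻ p, ENNReal.ofReal (Λ p) ∂(pairMeasure κ) ≤
      ∫⁻ p, ENNReal.ofReal (U p) ∂(pairMeasure κ) := by
  have hR := S.R_pos
  have hBD : ball y (s + g) ⊆ ball x₀ (3 / 4 * R) :=
    hB.trans (ball_subset_ball (by linarith))
  have hu0 : ∀ x ∈ ball y (s + g), 0 ≤ u x := fun x hx =>
    S.nonneg x (ball_subset_ball (by linarith) (hB hx))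
  set φ : Eucl N → ℝ := fun x => ψ x ^ 2 * H (u x) with hφ
  have hφm : Measurable φ :=
    (hψ.continuous.measurable.pow_const 2).mul (hH.continuous.measurable.comp S.measurable)
  have hφ0 : ∀ x, 0 ≤ φ x := fun x => mul_nonneg (sq_nonneg _) (hH.nonneg _)
  have hφB : ∀ x ∉ ball y (s + g), φ x = 0 := fun x hx => by simp [hφ, hψ.eq_zero x hx]
  have hφK : ∀ x, ‖φ x‖ ≤ (ball x₀ (R / 2)).indicator (fun _ => K) x := by
    intro x
    rw [Real.norm_of_nonneg (hφ0 x)]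
    by_cases hx : x ∈ ball x₀ (R / 2)
    · rw [indicator_of_mem hx]
      have h1 : ψ x ^ 2 ≤ 1 := pow_le_one₀ (hψ.nonneg x) (hψ.le_one x)
      have h2 := hH.nonneg (u x)
      have h3 := hH.le (u x)
      simp only [hφ]
      nlinarith
    · rw [indicator_of_notMem hx, hφB x fun h => hx (hB h)]
  have henergy := S.lintegral_testFunction_sq_lt_top hH hg hψ hB
  have hL2 : MemLp φ 2 volume := by
    refine MemLp.mono (g := (ball x₀ (R / 2)).indicator fun _ => K)
      (memLp_indicator_const 2 measurableSet_ball K (Or.inr measure_ball_lt_top.ne))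
      hφm.aestronglyMeasurable (Filter.Eventually.of_forall fun x => ?_)
    exact (hφK x).trans (le_abs_self _)
  have hFm : Measurable fun p : Eucl N × Eucl N => (u p.2 - u p.1) * (φ p.2 - φ p.1) :=
    ((S.measurable.comp measurable_snd).sub (S.measurable.comp measurable_fst)).mul
      ((hφm.comp measurable_snd).sub (hφm.comp measurable_fst))
  have hφsq : Measurable fun p : Eucl N × Eucl N => (φ p.2 - φ p.1) ^ 2 :=
    ((hφm.comp measurable_snd).sub (hφm.comp measurable_fst)).pow_const 2
  -- Needed because a Bochner integral is zero for a non-integrable function: without integrability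
  -- the sign of the iterated integral would say nothing about the pair integral.
  have hFi : Integrable (fun p : Eucl N × Eucl N => (u p.2 - u p.1) * (φ p.2 - φ p.1))
      (pairMeasure κ) := by
    refine ⟨hFm.aestronglyMeasurable, ?_⟩
    have hpt : ∀ p : Eucl N × Eucl N, ‖(u p.2 - u p.1) * (φ p.2 - φ p.1)‖ₑ ≤
        ENNReal.ofReal ((ball x₀ (3 / 4 * R) ×ˢ ball x₀ (3 / 4 * R)).indicator
          (fun p => (u p.2 - u p.1) ^ 2) p) + ENNReal.ofReal ((φ p.2 - φ p.1) ^ 2) +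
        ENNReal.ofReal K * ENNReal.ofReal ((ball y (s + g)).indicator 1 p.1 *
          (ball x₀ (3 / 4 * R))ᶜ.indicator (fun y => 1 + |u y|) p.2 +
          (ball y (s + g)).indicator 1 p.2 *
          (ball x₀ (3 / 4 * R))ᶜ.indicator (fun y => 1 + |u y|) p.1) := by
      intro p
      rw [← ENNReal.ofReal_mul ((hH.nonneg 0).trans (hH.le 0)), Real.enorm_eq_ofReal_abs]
      refine (ENNReal.ofReal_le_ofReal (testFunction_form_le hH hψ.nonneg hψ.le_one hψ.eq_zero hBD
        hu0 p.1 p.2)).trans ?_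
      exact ENNReal.ofReal_add_le.trans (add_le_add_left ENNReal.ofReal_add_le _)
    refine (lintegral_mono hpt).trans_lt ?_
    have hm1 : Measurable fun p => ENNReal.ofReal
        ((ball x₀ (3 / 4 * R) ×ˢ ball x₀ (3 / 4 * R)).indicator
          (fun p => (u p.2 - u p.1) ^ 2) p) :=
      (S.measurable_sq_sub.indicator (measurableSet_ball.prod measurableSet_ball)).ennreal_ofReal
    rw [lintegral_add_left (hm1.fun_add hφsq.ennreal_ofReal), lintegral_add_left hm1,
      lintegral_const_mul' _ _ ENNReal.ofReal_ne_top]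
    exact ENNReal.add_lt_top.2 ⟨ENNReal.add_lt_top.2 ⟨S.lintegral_indicator_sq_lt_top, henergy⟩,
      ENNReal.mul_lt_top ENNReal.ofReal_lt_top
        (S.lintegral_far_lt_top measurableSet_ball hB)⟩
  refine lintegral_ofReal_le_of_add_le hFi ?_ hΛ hU hΛ0 hU0 fun p => h p.1 p.2
  exact S.form_nonneg φ hφm hφ0 hL2 henergy (fun x hx => hφB x fun h => hx (hB h)) hFi

end JumpSetting

/-! ### The two test profiles and their pointwise inequalities. -/

/-- Profile of the truncation `(k - (u + d))₊`. -/
noncomputable def truncProfile (k d t : ℝ) : ℝ := min (max (k - d - t) 0) k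

theorem truncProfile_nonneg {k : ℝ} (hk : 0 ≤ k) (d t : ℝ) : 0 ≤ truncProfile k d t :=
  le_min (le_max_right _ _) hk

theorem truncProfile_le (k d t : ℝ) : truncProfile k d t ≤ k := min_le_right _ _

theorem truncProfile_of_nonneg {k d t : ℝ} (hk : 0 ≤ k) (hd : 0 ≤ d) (ht : 0 ≤ t) :
    truncProfile k d t = max (k - d - t) 0 :=
  min_eq_left (max_le (by linarith) hk)

theorem truncProfile_lipschitz (k d t t' : ℝ) :
    |truncProfile k d t - truncProfile k d t'| ≤ 1 * |t - t'| := by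
  have h1 := abs_min_sub_min_le_max (max (k - d - t) 0) k (max (k - d - t') 0) k
  have h2 := abs_max_sub_max_le_max (k - d - t) 0 (k - d - t') 0
  rw [show k - d - t - (k - d - t') = -(t - t') by ring, abs_neg] at h2
  simp only [sub_self, abs_zero] at h1 h2
  have := abs_nonneg (t - t')
  rw [one_mul]
  exact h1.trans (max_le (h2.trans (max_le le_rfl this)) this)

/-- The term `k ^ 2` comes from `t * H t`: for `t ≥ 0` the profile vanishes as soon as `t ≥ k - d`.
The outer minimum keeps the profile bounded for negative arguments, which `u` may take outside the
ball. -/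
theorem isTestProfile_truncProfile {k d : ℝ} (hk : 0 ≤ k) (hd : 0 ≤ d) :
    IsTestProfile (truncProfile k d) (k + k ^ 2) 1 where
  nonneg := truncProfile_nonneg hk d
  le t := (truncProfile_le k d t).trans (by nlinarith)
  lipschitz := truncProfile_lipschitz k d
  mul_le t ht := by
    rw [truncProfile_of_nonneg hk hd ht]
    rcases le_total (k - d - t) 0 with h | h
    · rw [max_eq_right h]; nlinarith
    · rw [max_eq_left h]; nlinarith

/-- Here `p`, `q` are the values of `u` at the two points, `a`, `b` those of the truncation and `s`,
`t` those of the cutoff. If both points are below the level then `q - p = a - b` and the relation is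
an identity. Otherwise one of `a`, `b` vanishes and the right side is zero. The product `a * b` on
the right is what confines the Caccioppoli bound to the sublevel set. -/
theorem trunc_algebra {a b p q s t : ℝ} (h : (a = 0 ∧ 0 ≤ b ∧ q - p ≤ -b) ∨
    (b = 0 ∧ 0 ≤ a ∧ a ≤ q - p) ∨ (a = 0 ∧ b = 0) ∨ q - p = a - b) :
    (q - p) * (t ^ 2 * b - s ^ 2 * a) + (t * b - s * a) ^ 2 ≤ a * b * (t - s) ^ 2 := by
  rcases h with ⟨rfl, hb, h⟩ | ⟨rfl, ha, h⟩ | ⟨rfl, rfl⟩ | h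
  · nlinarith [mul_nonneg (sq_nonneg t) (mul_nonneg hb (sub_nonneg.2 h))]
  · nlinarith [mul_nonneg (sq_nonneg s) (mul_nonneg ha (sub_nonneg.2 h))]
  · simp
  · rw [h]; apply le_of_eq; ring

/-- With `τ = log (b / a)` the right side is `2 cosh τ - 2 = 4 sinh² (τ / 2)`, and `|sinh x| ≥ |x|`.
-/
theorem log_sq_le {a b : ℝ} (ha : 0 < a) (hb : 0 < b) :
    (Real.log b - Real.log a) ^ 2 ≤ b / a + a / b - 2 := by
  rw [← Real.log_div hb.ne' ha.ne']
  set τ := Real.log (b / a) with hτ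
  have h1 : b / a = Real.exp τ := (Real.exp_log (by positivity)).symm
  have h2 : a / b = Real.exp (-τ) := by rw [Real.exp_neg, ← h1, inv_div]
  rw [h1, h2]
  have h3 : Real.exp τ + Real.exp (-τ) = 2 * Real.cosh τ := by rw [Real.cosh_eq]; ring
  have h4 : Real.cosh τ = 1 + 2 * Real.sinh (τ / 2) ^ 2 := by
    rw [show τ = 2 * (τ / 2) by ring, Real.cosh_two_mul, Real.cosh_sq]
    rw [show 2 * (τ / 2) / 2 = τ / 2 by ring]; ring
  have h5 : (τ / 2) ^ 2 ≤ Real.sinh (τ / 2) ^ 2 := by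
    rw [← sq_abs, ← sq_abs (Real.sinh _), Real.abs_sinh]
    exact pow_le_pow_left₀ (abs_nonneg _) (Real.self_le_sinh_iff.2 (abs_nonneg _)) 2
  rw [h3, h4]
  nlinarith

/-- Profile of the reciprocal `1 / (u + d)`. -/
noncomputable def recipProfile (d t : ℝ) : ℝ := (max (t + d) d)⁻¹

theorem isTestProfile_recipProfile {d : ℝ} (hd : 0 < d) :
    IsTestProfile (recipProfile d) (1 + d⁻¹) (d⁻¹ ^ 2) where
  nonneg t := inv_nonneg.2 (hd.le.trans (le_max_right _ _))
  le t := by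
    have : recipProfile d t ≤ d⁻¹ := inv_anti₀ hd (le_max_right _ _)
    linarith
  lipschitz t t' := by
    have h1 : 0 < max (t + d) d := lt_max_of_lt_right hd
    have h2 : 0 < max (t' + d) d := lt_max_of_lt_right hd
    have h3 := abs_max_sub_max_le_max (t' + d) d (t + d) d
    rw [add_sub_add_right_eq_sub, sub_self, abs_zero, max_eq_left (abs_nonneg (t' - t)),
      abs_sub_comm t'] at h3
    unfold recipProfile
    rw [inv_sub_inv h1.ne' h2.ne', abs_div, abs_mul, abs_of_pos h1, abs_of_pos h2, div_eq_inv_mul,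
      mul_inv, sq]
    gcongr
    · exact le_max_right _ _
    · exact le_max_right _ _
  mul_le t ht := by
    unfold recipProfile
    rw [max_eq_left (by linarith), ← div_eq_mul_inv]
    have : t / (t + d) ≤ 1 := (div_le_one (by linarith)).2 (by linarith)
    have : 0 < d⁻¹ := inv_pos.2 hd
    linarith

theorem log_max_lipschitz {d : ℝ} (hd : 0 < d) (t t' : ℝ) :
    |Real.log (max (t + d) d) - Real.log (max (t' + d) d)| ≤ d⁻¹ * |t - t'| := by
  have key : ∀ x y : ℝ, d ≤ x → d ≤ y → Real.log x - Real.log y ≤ d⁻¹ * |x - y| := by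
    intro x y hx hy
    have hx0 : 0 < x := hd.trans_le hx
    have hy0 : 0 < y := hd.trans_le hy
    rw [← Real.log_div hx0.ne' hy0.ne']
    calc Real.log (x / y) ≤ x / y - 1 := Real.log_le_sub_one_of_pos (by positivity)
      _ = y⁻¹ * (x - y) := by field_simp
      _ ≤ y⁻¹ * |x - y| := by gcongr; exact le_abs_self _
      _ ≤ d⁻¹ * |x - y| := by gcongr
  have h3 := abs_max_sub_max_le_max (t + d) d (t' + d) d
  rw [add_sub_add_right_eq_sub, sub_self, abs_zero, max_eq_left (abs_nonneg (t - t'))] at h3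
  have hd' : 0 ≤ d⁻¹ := (inv_pos.2 hd).le
  have h4 := mul_le_mul_of_nonneg_left h3 hd'
  rw [abs_le]
  constructor
  · have := key _ _ (le_max_right (t' + d) d) (le_max_right (t + d) d)
    rw [abs_sub_comm] at this
    linarith
  · have := key _ _ (le_max_right (t + d) d) (le_max_right (t' + d) d)
    linarith

/-- The difference of the two sides is the square `(s * b - t * a) ^ 2 / (a * b)`. -/
theorem recip_algebra {a b s t : ℝ} (ha : 0 < a) (hb : 0 < b) :
    (b - a) * (t ^ 2 * b⁻¹ - s ^ 2 * a⁻¹) ≤ (t - s) ^ 2 := by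
  have h : (t - s) ^ 2 - (b - a) * (t ^ 2 * b⁻¹ - s ^ 2 * a⁻¹) = (s * b - t * a) ^ 2 / (a * b) := by
    field_simp; ring
  have : 0 ≤ (s * b - t * a) ^ 2 / (a * b) := by positivity
  linarith

namespace JumpSetting

variable {N : ℕ} {α C₁ C₂ : ℝ} {κ : Kernel (Eucl N) (Eucl N)} {u : Eucl N → ℝ}
  {x₀ : Eucl N} {R r d : ℝ}

/-- Inside `B_R` this is `trunc_algebra`, the truncation being at most `k₀`. If `z` is outside, `ψ z
= 0` and the term is `(u x - u z) * ψ x ^ 2 * H (u x)`: positive values of `u z` help, so only `u₋`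
at `z` enters, and `u x < k₀` wherever the truncation is non-zero. The factor `ψ x ^ 2` is then the
squared difference of the cutoff. -/
theorem trunc_pointwise (S : JumpSetting α C₁ C₂ κ u x₀ R r d) {k k₀ : ℝ} (hk : 0 ≤ k)
    (hkk : k ≤ k₀) {ψ : Eucl N → ℝ} {s g : ℝ} (hψ : IsCutoff ψ x₀ s g)
    (hg : 0 < g) (hsR : s + g ≤ R / 2) (x z : Eucl N) :
    (u z - u x) * (ψ z ^ 2 * truncProfile k d (u z) - ψ x ^ 2 * truncProfile k d (u x)) +
      (ball x₀ s ×ˢ ball x₀ s).indicator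
        (fun p => (truncProfile k d (u p.2) - truncProfile k d (u p.1)) ^ 2) (x, z) ≤
    majorant (k₀ ^ 2) k₀ {x ∈ ball x₀ (s + g) | u x + d < k} ψ u x₀ R (x, z) := by
  have hR := S.R_pos
  have hd := S.d_pos
  have hk₀ : 0 ≤ k₀ := hk.trans hkk
  set A : Set (Eucl N) := {x ∈ ball x₀ (s + g) | u x + d < k} with hA
  have hball : ball x₀ (s + g) ⊆ ball x₀ R := ball_subset_ball (by linarith)
  have hball' : ball x₀ s ⊆ ball x₀ (s + g) := ball_subset_ball (by linarith)
  have hmaj := majorant_nonneg (sq_nonneg k₀) hk₀ A ψ u x₀ R (x, z)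
  have hn : ∀ y, 0 ≤ (ball x₀ R)ᶜ.indicator (fun y => max (-u y) 0) y := fun y =>
    indicator_nonneg (fun _ _ => le_max_right _ _) y
  have hcross : ∀ x z, x ∈ ball x₀ R → z ∉ ball x₀ R →
      (u x - u z) * (ψ x ^ 2 * truncProfile k d (u x)) ≤
        A.indicator 1 x * (k₀ ^ 2 * ψ x ^ 2 + k₀ * max (-u z) 0) := by
    intro x z hx hz
    have hux := S.nonneg x hx
    have hT : truncProfile k d (u x) = max (k - d - u x) 0 :=
      truncProfile_of_nonneg hk hd.le hux
    by_cases hxA : x ∈ A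
    · rw [indicator_of_mem hxA, Pi.one_apply, one_mul]
      have hlt := hxA.2
      have h0 := truncProfile_nonneg hk d (u x)
      have h1 : truncProfile k d (u x) ≤ k₀ := (truncProfile_le _ _ _).trans hkk
      have hψ1 : ψ x ^ 2 ≤ 1 := pow_le_one₀ (hψ.nonneg x) (hψ.le_one x)
      have hm0 : 0 ≤ max (-u z) 0 := le_max_right _ _
      have hm1 : -u z ≤ max (-u z) 0 := le_max_left _ _
      calc (u x - u z) * (ψ x ^ 2 * truncProfile k d (u x))
          ≤ (k₀ + max (-u z) 0) * (ψ x ^ 2 * truncProfile k d (u x)) := by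
            gcongr; linarith
        _ ≤ (k₀ + max (-u z) 0) * (ψ x ^ 2 * k₀) := by gcongr
        _ = k₀ ^ 2 * ψ x ^ 2 + k₀ * (max (-u z) 0 * ψ x ^ 2) := by ring
        _ ≤ k₀ ^ 2 * ψ x ^ 2 + k₀ * (max (-u z) 0 * 1) := by gcongr
        _ = _ := by ring
    · rw [indicator_of_notMem hxA, zero_mul]
      have : ψ x ^ 2 * truncProfile k d (u x) = 0 := by
        by_cases hxb : x ∈ ball x₀ (s + g)
        · have : ¬ u x + d < k := fun h => hxA ⟨hxb, h⟩
          rw [hT, max_eq_right (by linarith), mul_zero]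
        · rw [hψ.eq_zero x hxb]; ring
      rw [this, mul_zero]
  by_cases hx : x ∈ ball x₀ R <;> by_cases hz : z ∈ ball x₀ R
  · have hux := S.nonneg x hx
    have huz := S.nonneg z hz
    have hTx : truncProfile k d (u x) = max (k - d - u x) 0 :=
      truncProfile_of_nonneg hk hd.le hux
    have hTz : truncProfile k d (u z) = max (k - d - u z) 0 :=
      truncProfile_of_nonneg hk hd.le huz
    have halg : (u z - u x) *
        (ψ z ^ 2 * truncProfile k d (u z) - ψ x ^ 2 * truncProfile k d (u x)) +
        (ψ z * truncProfile k d (u z) - ψ x * truncProfile k d (u x)) ^ 2 ≤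
        truncProfile k d (u x) * truncProfile k d (u z) * (ψ z - ψ x) ^ 2 := by
      apply trunc_algebra
      rw [hTx, hTz]
      rcases le_total (k - d - u x) 0 with h1 | h1 <;>
        rcases le_total (k - d - u z) 0 with h2 | h2
      · exact Or.inr (Or.inr (Or.inl ⟨max_eq_right h1, max_eq_right h2⟩))
      · rw [max_eq_right h1, max_eq_left h2]
        exact Or.inl ⟨rfl, h2, by linarith⟩
      · rw [max_eq_left h1, max_eq_right h2]
        exact Or.inr (Or.inl ⟨rfl, h1, by linarith⟩)
      · rw [max_eq_left h1, max_eq_left h2]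
        exact Or.inr (Or.inr (Or.inr (by ring)))
    have hΛ : (ball x₀ s ×ˢ ball x₀ s).indicator
        (fun p => (truncProfile k d (u p.2) - truncProfile k d (u p.1)) ^ 2) (x, z) ≤
        (ψ z * truncProfile k d (u z) - ψ x * truncProfile k d (u x)) ^ 2 := by
      by_cases hxz : (x, z) ∈ ball x₀ s ×ˢ ball x₀ s
      · rw [indicator_of_mem hxz, hψ.eq_one x hxz.1, hψ.eq_one z hxz.2, one_mul, one_mul]
      · rw [indicator_of_notMem hxz]; exact sq_nonneg _
    have hU : truncProfile k d (u x) * truncProfile k d (u z) * (ψ z - ψ x) ^ 2 ≤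
        majorant (k₀ ^ 2) k₀ A ψ u x₀ R (x, z) := by
      have hTx0 := truncProfile_nonneg hk d (u x)
      have hTz0 := truncProfile_nonneg hk d (u z)
      have hTxk := (truncProfile_le k d (u x)).trans hkk
      have hTzk := (truncProfile_le k d (u z)).trans hkk
      by_cases hzero : truncProfile k d (u x) * truncProfile k d (u z) * (ψ z - ψ x) ^ 2 = 0
      · rw [hzero]; exact hmaj
      have hx1 : u x + d < k := by
        by_contra hcon
        rw [hTx, max_eq_right (by linarith)] at hzero
        simp at hzero
      have hz1 : u z + d < k := by
        by_contra hcon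
        rw [hTz, max_eq_right (by linarith)] at hzero
        simp at hzero
      have hone : 1 ≤ A.indicator (1 : Eucl N → ℝ) x + A.indicator (1 : Eucl N → ℝ) z := by
        have hAx := indicator_one_nonneg A x
        have hAz := indicator_one_nonneg A z
        by_cases hxb : x ∈ ball x₀ (s + g)
        · have : x ∈ A := ⟨hxb, hx1⟩
          rw [indicator_of_mem this, Pi.one_apply]; linarith
        by_cases hzb : z ∈ ball x₀ (s + g)
        · have : z ∈ A := ⟨hzb, hz1⟩
          rw [indicator_of_mem this, Pi.one_apply]; linarith
        rw [hψ.eq_zero x hxb, hψ.eq_zero z hzb] at hzero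
        simp at hzero
      unfold majorant
      simp only [indicator_of_notMem (show x ∉ (ball x₀ R)ᶜ from fun h => h hx),
        indicator_of_notMem (show z ∉ (ball x₀ R)ᶜ from fun h => h hz), mul_zero, add_zero]
      calc truncProfile k d (u x) * truncProfile k d (u z) * (ψ z - ψ x) ^ 2
          ≤ k₀ * k₀ * (1 * (ψ z - ψ x) ^ 2) := by rw [one_mul]; gcongr
        _ ≤ k₀ * k₀ * ((A.indicator 1 x + A.indicator 1 z) * (ψ z - ψ x) ^ 2) := by gcongr
        _ = _ := by ring
    linarith
  · have hzb : z ∉ ball x₀ (s + g) := fun h => hz (hball h)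
    have hxz : (x, z) ∉ ball x₀ s ×ˢ ball x₀ s := fun h => hzb (hball' h.2)
    have hzA : z ∉ A := fun h => hzb h.1
    have := hcross x z hx hz
    unfold majorant
    simp only [indicator_of_notMem hxz, hψ.eq_zero z hzb, indicator_of_notMem hzA,
      indicator_of_mem (show z ∈ (ball x₀ R)ᶜ from hz)]
    linarith
  · have hxb : x ∉ ball x₀ (s + g) := fun h => hx (hball h)
    have hxz : (x, z) ∉ ball x₀ s ×ˢ ball x₀ s := fun h => hxb (hball' h.1)
    have hxA : x ∉ A := fun h => hxb h.1
    have := hcross z x hz hx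
    unfold majorant
    simp only [indicator_of_notMem hxz, hψ.eq_zero x hxb, indicator_of_notMem hxA,
      indicator_of_mem (show x ∈ (ball x₀ R)ᶜ from hx)]
    linarith
  · have hxb : x ∉ ball x₀ (s + g) := fun h => hx (hball h)
    have hzb : z ∉ ball x₀ (s + g) := fun h => hz (hball h)
    have hxz : (x, z) ∉ ball x₀ s ×ˢ ball x₀ s := fun h => hxb (hball' h.1)
    rw [indicator_of_notMem hxz, hψ.eq_zero x hxb, hψ.eq_zero z hzb]
    simpa using hmaj

/-- Where `ψ = 1` at both points the form produces `2 - b / a - a / b`, hence minus the squared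
difference of logarithms. At other pairs inside `B_R` the sign is lost only up to the cutoff term,
by `recip_algebra`. For a far point, `1 / w ≤ 1 / d` gives the factor `d⁻¹` in front of the tail. -/
theorem log_pointwise (S : JumpSetting α C₁ C₂ κ u x₀ R r d)
    {ψ : Eucl N → ℝ} {y : Eucl N} {s g : ℝ} (hψ : IsCutoff ψ y s g)
    (hg : 0 < g) (hball : ball y (s + g) ⊆ ball x₀ R) (x z : Eucl N) :
    (u z - u x) * (ψ z ^ 2 * recipProfile d (u z) - ψ x ^ 2 * recipProfile d (u x)) +
      (ball y s ×ˢ ball y s).indicator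
        (fun p => (Real.log (max (u p.2 + d) d) - Real.log (max (u p.1 + d) d)) ^ 2) (x, z) ≤
    majorant 1 d⁻¹ (ball y (s + g)) ψ u x₀ R (x, z) := by
  have hd := S.d_pos
  have hd' : 0 ≤ d⁻¹ := (inv_pos.2 hd).le
  set A : Set (Eucl N) := ball y (s + g) with hA
  have hball' : ball y s ⊆ A := ball_subset_ball (by linarith)
  have hmaj := majorant_nonneg zero_le_one hd' A ψ u x₀ R (x, z)
  have hmax : ∀ x ∈ ball x₀ R, max (u x + d) d = u x + d := fun x hx =>
    max_eq_left (by linarith [S.nonneg x hx])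
  have hcross : ∀ x z, x ∈ ball x₀ R → z ∉ ball x₀ R →
      (u x - u z) * (ψ x ^ 2 * recipProfile d (u x)) ≤
        A.indicator 1 x * (ψ x ^ 2 + d⁻¹ * max (-u z) 0) := by
    intro x z hx hz
    have hux := S.nonneg x hx
    by_cases hxA : x ∈ A
    · rw [indicator_of_mem hxA, Pi.one_apply, one_mul]
      have hψ1 : ψ x ^ 2 ≤ 1 := pow_le_one₀ (hψ.nonneg x) (hψ.le_one x)
      have hm0 : 0 ≤ max (-u z) 0 := le_max_right _ _
      have hm1 : -u z ≤ max (-u z) 0 := le_max_left _ _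
      have hw : 0 < u x + d := by linarith
      rw [recipProfile, hmax x hx]
      calc (u x - u z) * (ψ x ^ 2 * (u x + d)⁻¹)
          ≤ ((u x + d) + max (-u z) 0) * (ψ x ^ 2 * (u x + d)⁻¹) := by
            gcongr; linarith
        _ = ψ x ^ 2 + (u x + d)⁻¹ * (max (-u z) 0 * ψ x ^ 2) := by
            field_simp
        _ ≤ ψ x ^ 2 + d⁻¹ * (max (-u z) 0 * 1) := by
            gcongr; linarith
        _ = _ := by ring
    · rw [indicator_of_notMem hxA, hψ.eq_zero x hxA]; simp
  by_cases hx : x ∈ ball x₀ R <;> by_cases hz : z ∈ ball x₀ R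
  · have hux := S.nonneg x hx
    have huz := S.nonneg z hz
    have hwx : 0 < u x + d := by linarith
    have hwz : 0 < u z + d := by linarith
    by_cases hxz : (x, z) ∈ ball y s ×ˢ ball y s
    · refine le_trans ?_ hmaj
      rw [indicator_of_mem hxz, hψ.eq_one x hxz.1, hψ.eq_one z hxz.2]
      simp only [recipProfile, hmax x hx, hmax z hz]
      have h1 := log_sq_le hwx hwz
      have h2 : (u z - u x) * (1 ^ 2 * (u z + d)⁻¹ - 1 ^ 2 * (u x + d)⁻¹) =
          2 - (u z + d) / (u x + d) - (u x + d) / (u z + d) := by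
        field_simp; ring
      linarith
    · rw [indicator_of_notMem hxz, add_zero, recipProfile, recipProfile, hmax x hx, hmax z hz]
      have h1 := recip_algebra (s := ψ x) (t := ψ z) hwx hwz
      rw [add_sub_add_right_eq_sub] at h1
      by_cases hzero : (ψ z - ψ x) ^ 2 = 0
      · exact h1.trans (hzero.le.trans hmaj)
      have hone : 1 ≤ A.indicator (1 : Eucl N → ℝ) x + A.indicator (1 : Eucl N → ℝ) z := by
        have hAx := indicator_one_nonneg A x
        have hAz := indicator_one_nonneg A z
        by_cases hxb : x ∈ A
        · rw [indicator_of_mem hxb, Pi.one_apply]; linarith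
        by_cases hzb : z ∈ A
        · rw [indicator_of_mem hzb, Pi.one_apply]; linarith
        rw [hψ.eq_zero x hxb, hψ.eq_zero z hzb] at hzero
        simp at hzero
      unfold majorant
      simp only [indicator_of_notMem (show x ∉ (ball x₀ R)ᶜ from fun h => h hx),
        indicator_of_notMem (show z ∉ (ball x₀ R)ᶜ from fun h => h hz), mul_zero, add_zero]
      nlinarith [sq_nonneg (ψ z - ψ x)]
  · have hzb : z ∉ A := fun h => hz (hball h)
    have hxz : (x, z) ∉ ball y s ×ˢ ball y s := fun h => hzb (hball' h.2)
    have := hcross x z hx hz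
    unfold majorant
    simp only [indicator_of_notMem hxz, hψ.eq_zero z hzb, indicator_of_notMem hzb,
      indicator_of_mem (show z ∈ (ball x₀ R)ᶜ from hz)]
    linarith
  · have hxb : x ∉ A := fun h => hx (hball h)
    have hxz : (x, z) ∉ ball y s ×ˢ ball y s := fun h => hxb (hball' h.1)
    have := hcross z x hz hx
    unfold majorant
    simp only [indicator_of_notMem hxz, hψ.eq_zero x hxb, indicator_of_notMem hxb,
      indicator_of_mem (show x ∈ (ball x₀ R)ᶜ from hx)]
    linarith
  · have hxb : x ∉ A := fun h => hx (hball h)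
    have hzb : z ∉ A := fun h => hz (hball h)
    have hxz : (x, z) ∉ ball y s ×ˢ ball y s := fun h => hxb (hball' h.1)
    rw [indicator_of_notMem hxz, hψ.eq_zero x hxb, hψ.eq_zero z hzb]
    simpa using hmaj

end JumpSetting

/-! ### Caccioppoli, logarithmic and Faber-Krahn estimates. -/

theorem setLIntegral_ofReal_eq {X : Type*} [MeasurableSpace X] {m : Measure X} {A : Set X}
    (hA : MeasurableSet A) (f : X → ℝ) :
    ∫⁻ p in A, ENNReal.ofReal (f p) ∂m = ∫⁻ p, ENNReal.ofReal (A.indicator f p) ∂m := by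
  rw [← lintegral_indicator hA]
  congr 1; ext p
  by_cases hp : p ∈ A
  · rw [indicator_of_mem hp, indicator_of_mem hp]
  · rw [indicator_of_notMem hp, indicator_of_notMem hp, ENNReal.ofReal_zero]

/-- On a set where a bounded function vanishes on three quarters of the measure, its square is
controlled by its variance. -/
theorem lintegral_sq_le_variance {X : Type*} [MeasurableSpace X] {m : Measure X} {B : Set X}
    (hBfin : m B ≠ ∞) {f : X → ℝ} (hf : Measurable f) {K : ℝ}
    (hK : ∀ x, |f x| ≤ K) (hsupp : 4 * m {x ∈ B | f x ≠ 0} ≤ m B) :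
    ∫⁻ x in B, ENNReal.ofReal (f x ^ 2) ∂m ≤
      2 * ∫⁻ x in B, ENNReal.ofReal ((f x - ⨍ z in B, f z ∂m) ^ 2) ∂m := by
  set c := ⨍ z in B, f z ∂m with hc
  have : IsFiniteMeasure (m.restrict B) :=
    ⟨by rw [Measure.restrict_apply_univ]; exact hBfin.lt_top⟩
  have hfi : Integrable f (m.restrict B) := by
    refine Integrable.of_bound hf.aestronglyMeasurable K (Filter.Eventually.of_forall fun x => ?_)
    exact hK x
  have hf2 : Integrable (fun x => f x ^ 2) (m.restrict B) := by
    refine Integrable.of_bound (hf.pow_const 2).aestronglyMeasurable (K ^ 2)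
      (Filter.Eventually.of_forall fun x => ?_)
    rw [Real.norm_of_nonneg (sq_nonneg _), ← sq_abs]
    exact pow_le_pow_left₀ (abs_nonneg _) (hK x) 2
  set b := m.real B with hb
  have hcb : ∫ x in B, f x ∂m = c * b := by
    rw [hc, ← measure_smul_setAverage f hBfin, smul_eq_mul, mul_comm]
  have hlin : Integrable (fun x => f x ^ 2 - 2 * c * f x) (m.restrict B) :=
    hf2.sub (hfi.const_mul _)
  have hvar : ∫ x in B, (f x - c) ^ 2 ∂m = ∫ x in B, f x ^ 2 ∂m - c ^ 2 * b := by
    have h1 : ∀ x, (f x - c) ^ 2 = f x ^ 2 - (2 * c) * f x + c ^ 2 := fun x => by ring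
    simp_rw [h1]
    rw [integral_add hlin (integrable_const _),
      integral_sub hf2 (hfi.const_mul _), integral_const_mul, hcb, integral_const]
    simp only [measureReal_restrict_apply_univ, smul_eq_mul]
    rw [← hb]; ring
  set A := {x | f x ≠ 0} with hA
  have hAm : MeasurableSet A := (hf (measurableSet_singleton 0)).compl
  have hAB : (m.restrict B).real A ≤ b / 4 := by
    have h1 : 4 * (m.restrict B) A ≤ m B := by
      rw [Measure.restrict_apply hAm]
      refine le_trans (le_of_eq ?_) hsupp
      congr 2; ext x; simp [hA, and_comm]
    have h2 := ENNReal.toReal_mono hBfin h1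
    rw [ENNReal.toReal_mul] at h2
    simp only [ENNReal.toReal_ofNat] at h2
    rw [hb, measureReal_def, measureReal_def]
    linarith
  -- On the support of `f` use `4 * c * f ≤ f ^ 2 + (2 * c) ^ 2`. As the support has at most a
  -- quarter of the measure, `3 * c ^ 2 * b ≤ ∫ f ^ 2`, more than enough to absorb the square of the
  -- mean in the variance.
  have hcs : (4 * c) * (c * b) ≤ ∫ x in B, f x ^ 2 ∂m + (2 * c) ^ 2 * (b / 4) := by
    rw [← hcb, ← integral_const_mul]
    calc ∫ x in B, 4 * c * f x ∂m
        ≤ ∫ x in B, (f x ^ 2 + A.indicator (fun _ => (2 * c) ^ 2) x) ∂m := by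
          refine integral_mono (hfi.const_mul _)
            (hf2.add ((integrable_const _).indicator hAm)) fun x => ?_
          by_cases hx : x ∈ A
          · simp only [indicator_of_mem hx]
            nlinarith [sq_nonneg (f x - 2 * c)]
          · have : f x = 0 := by simpa [hA] using hx
            simp only [indicator_of_notMem hx, this]; simp
      _ = ∫ x in B, f x ^ 2 ∂m + (m.restrict B).real A * (2 * c) ^ 2 := by
          rw [integral_add hf2 ((integrable_const _).indicator hAm), integral_indicator_const _ hAm,
            smul_eq_mul]
      _ ≤ _ := by rw [mul_comm ((2 * c) ^ 2)]; gcongr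
  have hle : ∫ x in B, f x ^ 2 ∂m ≤ 2 * ∫ x in B, (f x - c) ^ 2 ∂m := by
    have hb0 : 0 ≤ c ^ 2 * b := mul_nonneg (sq_nonneg c) measureReal_nonneg
    rw [hvar]; nlinarith
  have hv2 : Integrable (fun x => (f x - c) ^ 2) (m.restrict B) := by
    have h1 : ∀ x, (f x - c) ^ 2 = f x ^ 2 - (2 * c) * f x + c ^ 2 := fun x => by ring
    simp_rw [h1]
    exact hlin.add (integrable_const _)
  rw [← ofReal_integral_eq_lintegral_ofReal hf2 (Filter.Eventually.of_forall fun _ => sq_nonneg _),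
    ← ofReal_integral_eq_lintegral_ofReal hv2 (Filter.Eventually.of_forall fun _ => sq_nonneg _)]
  refine (ENNReal.ofReal_le_ofReal hle).trans (le_of_eq ?_)
  rw [ENNReal.ofReal_mul zero_le_two, ENNReal.ofReal_ofNat]

namespace JumpSetting

variable {N : ℕ} {α C₁ C₂ : ℝ} {κ : Kernel (Eucl N) (Eucl N)} {u : Eucl N → ℝ}
  {x₀ : Eucl N} {R r d : ℝ}

/-- Caccioppoli inequality for truncations. -/
theorem energy_trunc_le (S : JumpSetting α C₁ C₂ κ u x₀ R r d) {k k₀ : ℝ} (hk : 0 ≤ k)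
    (hkk : k ≤ k₀) (hdk : d ≤ k₀) {s g : ℝ} (hg : 0 < g) (hgr : g ≤ r) (hsR : s + g ≤ R / 2) :
    ∫⁻ p in ball x₀ s ×ˢ ball x₀ s, ENNReal.ofReal
      ((truncProfile k d (u p.2) - truncProfile k d (u p.1)) ^ 2) ∂(pairMeasure κ) ≤
    ENNReal.ofReal (2 * (k₀ ^ 2 * ((jumpConst α C₂ + 1) / g ^ α))) *
      volume {x ∈ ball x₀ (s + g) | u x + d < k} := by
  have hR := S.R_pos
  have hd := S.d_pos
  have hk₀ : 0 ≤ k₀ := hk.trans hkk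
  obtain ⟨ψ, hψ⟩ := exists_isCutoff x₀ s hg
  have hB : ball x₀ (s + g) ⊆ ball x₀ (R / 2) := ball_subset_ball hsR
  have hT := isTestProfile_truncProfile hk hd.le
  have hTm : Measurable fun x => truncProfile k d (u x) :=
    hT.continuous.measurable.comp S.measurable
  have hAm : MeasurableSet {x ∈ ball x₀ (s + g) | u x + d < k} :=
    measurableSet_ball.inter (measurableSet_lt (S.measurable.add_const d) measurable_const)
  rw [setLIntegral_ofReal_eq (measurableSet_ball.prod measurableSet_ball)]
  refine (S.lintegral_le_of_test hT hg hψ hB ?_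
    (measurable_majorant (k₀ ^ 2) k₀ hAm hψ.continuous.measurable S.measurable x₀ R)
    (fun p => indicator_nonneg (fun _ _ => sq_nonneg _) p)
    (majorant_nonneg (sq_nonneg k₀) hk₀ _ _ _ _ _)
    (S.trunc_pointwise hk hkk hψ hg hsR)).trans ?_
  · exact (((hTm.comp measurable_snd).sub (hTm.comp measurable_fst)).pow_const 2).indicator
      (measurableSet_ball.prod measurableSet_ball)
  refine (S.lintegral_majorant_le hAm ((sep_subset _ _).trans hB) hg hψ (sq_nonneg k₀) hk₀).trans ?_
  gcongr
  -- The assumptions `d ≤ k₀` and `g ≤ r` let the cutoff scale absorb the tail term.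
  have h1 : d / r ^ α ≤ k₀ / g ^ α := by
    have := S.alpha_pos
    gcongr
  calc k₀ ^ 2 * (jumpConst α C₂ / g ^ α) + k₀ * (d / r ^ α)
      ≤ k₀ ^ 2 * (jumpConst α C₂ / g ^ α) + k₀ * (k₀ / g ^ α) := by gcongr
    _ = _ := by ring

/-- Logarithmic energy estimate. -/
theorem energy_log_le (S : JumpSetting α C₁ C₂ κ u x₀ R r d) {y : Eucl N} {s : ℝ} (hs : 0 < s)
    (hsr : s ≤ 8 * r) (hB : ball y (2 * s) ⊆ ball x₀ (R / 2)) :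
    ∫⁻ p in ball y s ×ˢ ball y s, ENNReal.ofReal
      ((Real.log (max (u p.2 + d) d) - Real.log (max (u p.1 + d) d)) ^ 2) ∂(pairMeasure κ) ≤
    ENNReal.ofReal (2 * ((jumpConst α C₂ + 64) / s ^ α)) * volume (ball y (2 * s)) := by
  have hR := S.R_pos
  have hd := S.d_pos
  have hr := S.r_pos
  rw [two_mul s] at *
  obtain ⟨ψ, hψ⟩ := exists_isCutoff y s hs
  have hd' : 0 ≤ d⁻¹ := (inv_pos.2 hd).le
  have hTm : Measurable fun x => Real.log (max (u x + d) d) :=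
    ((S.measurable.add_const d).max measurable_const).log
  rw [setLIntegral_ofReal_eq (measurableSet_ball.prod measurableSet_ball)]
  refine (S.lintegral_le_of_test (isTestProfile_recipProfile hd) hs hψ hB ?_
    (measurable_majorant 1 d⁻¹ measurableSet_ball hψ.continuous.measurable S.measurable x₀ R)
    (fun p => indicator_nonneg (fun _ _ => sq_nonneg _) p)
    (majorant_nonneg zero_le_one hd' _ _ _ _ _)
    (S.log_pointwise hψ hs (hB.trans (ball_subset_ball (by linarith))))).trans ?_
  · exact (((hTm.comp measurable_snd).sub (hTm.comp measurable_fst)).pow_const 2).indicator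
      (measurableSet_ball.prod measurableSet_ball)
  refine (S.lintegral_majorant_le measurableSet_ball hB hs hψ zero_le_one hd').trans ?_
  gcongr
  -- The shift by `d` cancels the size of the tail, so the logarithmic estimate does not depend on
  -- `d`.
  have h1 : d⁻¹ * (d / r ^ α) = 1 / r ^ α := by field_simp
  have h2 : s ^ α ≤ 64 * r ^ α := by
    calc s ^ α ≤ (8 * r) ^ α := Real.rpow_le_rpow hs.le hsr S.alpha_pos.le
      _ = 8 ^ α * r ^ α := Real.mul_rpow (by norm_num) hr.le
      _ ≤ 8 ^ (2 : ℝ) * r ^ α := by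
        gcongr
        · norm_num
        · exact S.alpha_lt.le
      _ = _ := by norm_num
  have h3 : 1 / r ^ α ≤ 64 / s ^ α := by
    have : 0 < r ^ α := by positivity
    have : 0 < s ^ α := by positivity
    rw [div_le_div_iff₀ (by positivity) (by positivity)]
    linarith
  rw [h1, add_div, one_mul]
  gcongr

/-- The truncated logarithm has bounded mean square oscillation. -/
theorem oscillation_log_le (S : JumpSetting α C₁ C₂ κ u x₀ R r d) (n : ℕ) {y : Eucl N} {s : ℝ}
    (hs : 0 < s) (hsr : s ≤ 8 * r) (hB : ball y (2 * s) ⊆ ball x₀ (R / 2)) :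
    ∫⁻ x in ball y s, ENNReal.ofReal ((min (Real.log (max (u x + d) d)) n -
      ⨍ z in ball y s, min (Real.log (max (u z + d) d)) n) ^ 2) ≤
    ENNReal.ofReal (2 * C₁ * (jumpConst α C₂ + 64)) * volume (ball y (2 * s)) := by
  have hR := S.R_pos
  have hd := S.d_pos
  have hJ := jumpConst_pos S.alpha_lt S.one_le_C₂
  have hC := S.one_le_C₁
  have hmin : ∀ a b : ℝ, |min a n - min b n| ≤ |a - b| := by
    intro a b
    have h := abs_min_sub_min_le_max a (n : ℝ) b n
    rwa [sub_self, abs_zero, max_eq_left (abs_nonneg (a - b))] at h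
  -- Truncation at `n` makes the profile bounded, as the Poincaré inequality in this setting
  -- requires; the resulting constant does not see `n`.
  have hP := S.poincare (fun t => min (Real.log (max (t + d) d)) n) (|Real.log d| + n) d⁻¹
    (fun t => ?_) (fun t t' => (hmin _ _).trans (log_max_lipschitz hd t t')) y s hs
    (((ball_subset_ball (by linarith)).trans hB).trans (ball_subset_ball (by linarith)))
  · refine hP.trans ?_
    calc _ ≤ ENNReal.ofReal (C₁ * s ^ α) * (ENNReal.ofReal
          (2 * ((jumpConst α C₂ + 64) / s ^ α)) * volume (ball y (2 * s))) := by
          gcongr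
          refine (lintegral_mono fun p => ENNReal.ofReal_le_ofReal ?_).trans
            (S.energy_log_le hs hsr hB)
          rw [← sq_abs, ← sq_abs (Real.log _ - _)]
          exact pow_le_pow_left₀ (abs_nonneg _) (hmin _ _) 2
      _ = _ := by
          rw [← mul_assoc, ← ENNReal.ofReal_mul (by positivity)]
          congr 2
          have : 0 < s ^ α := by positivity
          field_simp
  · have h1 : Real.log d ≤ Real.log (max (t + d) d) := Real.log_le_log hd (le_max_right _ _)
    have h2 := neg_abs_le (Real.log d)
    have h3 := abs_nonneg (Real.log d)
    have h4 : (0 : ℝ) ≤ n := Nat.cast_nonneg n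
    rw [abs_le]
    exact ⟨by rw [neg_add]; exact le_min (by linarith) (by linarith),
      (min_le_right _ _).trans (by linarith)⟩

/-- A local Faber-Krahn inequality, obtained by averaging the Poincaré inequality over all balls
of a fixed radius. -/
theorem lintegral_sq_le_energy (S : JumpSetting α C₁ C₂ κ u x₀ R r d) {H : ℝ → ℝ} {K L : ℝ}
    (hHm : Measurable H) (hHK : ∀ t, |H t| ≤ K) (hHL : ∀ t t', |H t - H t'| ≤ L * |t - t'|)
    {ρ s : ℝ} (hs : 0 < s) (hρ : ρ ≤ R)
    (hsupp : 4 * volume {x ∈ ball x₀ ρ | H (u x) ≠ 0} ≤ volume (ball x₀ s)) :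
    ∫⁻ x in ball x₀ (ρ - 2 * s), ENNReal.ofReal (H (u x) ^ 2) ≤
      ENNReal.ofReal (2 * C₁ * s ^ α) * ∫⁻ p in ball x₀ ρ ×ˢ ball x₀ ρ,
        ENNReal.ofReal ((H (u p.2) - H (u p.1)) ^ 2) ∂(pairMeasure κ) := by
  have := S.sfinite
  have hC := S.one_le_C₁
  have hfm : Measurable fun x => H (u x) := hHm.comp S.measurable
  set q : Eucl N × Eucl N → ℝ≥0∞ := fun p => ENNReal.ofReal ((H (u p.2) - H (u p.1)) ^ 2) with hq
  have hqm : Measurable q :=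
    (((hfm.comp measurable_snd).sub (hfm.comp measurable_fst)).pow_const 2).ennreal_ofReal
  set f : Eucl N → ℝ≥0∞ := fun x => ENNReal.ofReal (H (u x) ^ 2) with hf
  have hfm2 : Measurable f := (hfm.pow_const 2).ennreal_ofReal
  have hvol : ∀ x : Eucl N, volume (ball x s) = volume (ball x₀ s) := fun x => by
    rw [Measure.addHaar_ball_center, Measure.addHaar_ball_center volume x₀]
  have hloc : ∀ z ∈ ball x₀ (ρ - s), ∫⁻ x in ball z s, f x ≤
      ENNReal.ofReal (2 * C₁ * s ^ α) * ∫⁻ p in ball z s ×ˢ ball z s, q p ∂(pairMeasure κ) := by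
    intro z hz
    have hsub : ball z s ⊆ ball x₀ ρ := ball_subset_ball' (by rw [mem_ball] at hz; linarith)
    refine (lintegral_sq_le_variance measure_ball_lt_top.ne hfm
      (fun x => hHK _) ?_).trans ?_
    · refine le_trans ?_ (hsupp.trans (hvol z).ge)
      gcongr
    · have := S.poincare H K L hHK hHL z s hs (hsub.trans (ball_subset_ball hρ))
      calc _ ≤ 2 * (ENNReal.ofReal (C₁ * s ^ α) *
            ∫⁻ p in ball z s ×ˢ ball z s, q p ∂(pairMeasure κ)) := by gcongr
        _ = _ := by
          rw [← mul_assoc, mul_assoc 2 C₁, ENNReal.ofReal_mul zero_le_two, ENNReal.ofReal_ofNat]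
  -- By Fubini: a point `x` of the smaller ball lies in `ball z s` for all `z` in `ball x s`, and
  -- these centres are all admissible.
  have hleft : volume (ball x₀ s) * ∫⁻ x in ball x₀ (ρ - 2 * s), f x ≤
      ∫⁻ z in ball x₀ (ρ - s), ∫⁻ x in ball z s, f x := by
    have hset : MeasurableSet {p : Eucl N × Eucl N | p.2 ∈ ball p.1 s} :=
      (isOpen_lt (continuous_snd.dist continuous_fst) continuous_const).measurableSet
    have h1 : ∀ z, ∫⁻ x in ball z s, f x =
        ∫⁻ x, {p : Eucl N × Eucl N | p.2 ∈ ball p.1 s}.indicator (fun p => f p.2) (z, x) := by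
      intro z
      rw [← lintegral_indicator measurableSet_ball]
      rfl
    simp_rw [h1]
    have hm : Measurable (Function.uncurry fun z x : Eucl N =>
        {p : Eucl N × Eucl N | p.2 ∈ ball p.1 s}.indicator (fun p => f p.2) (z, x)) :=
      (hfm2.comp measurable_snd).indicator hset
    rw [lintegral_lintegral_swap hm.aemeasurable,
      ← lintegral_const_mul _ hfm2, ← lintegral_indicator measurableSet_ball]
    refine lintegral_mono fun x => ?_
    by_cases hx : x ∈ ball x₀ (ρ - 2 * s)
    · rw [indicator_of_mem hx]
      have hsub : ball x s ⊆ ball x₀ (ρ - s) :=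
        ball_subset_ball' (by rw [mem_ball] at hx; linarith)
      calc volume (ball x₀ s) * f x = ∫⁻ z in ball x s, f x := by
            rw [setLIntegral_const, hvol x, mul_comm]
        _ = ∫⁻ z in ball x s, {p : Eucl N × Eucl N | p.2 ∈ ball p.1 s}.indicator
              (fun p => f p.2) (z, x) := by
            refine setLIntegral_congr_fun measurableSet_ball fun z hz => ?_
            have : (z, x) ∈ {p : Eucl N × Eucl N | p.2 ∈ ball p.1 s} := by
              simpa [dist_comm] using hz
            rw [indicator_of_mem this]
        _ ≤ _ := lintegral_mono_set hsub
    · rw [indicator_of_notMem hx]; exact zero_le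
  -- Conversely, a pair lies in `ball z s ×ˢ ball z s` only for centres `z` within `s` of its first
  -- point. Both sides thus carry the same factor `volume (ball x₀ s)`, which cancels.
  have hright : ∫⁻ z in ball x₀ (ρ - s), ∫⁻ p in ball z s ×ˢ ball z s, q p ∂(pairMeasure κ) ≤
      volume (ball x₀ s) * ∫⁻ p in ball x₀ ρ ×ˢ ball x₀ ρ, q p ∂(pairMeasure κ) := by
    have hset : MeasurableSet {w : Eucl N × (Eucl N × Eucl N) |
        w.2 ∈ ball w.1 s ×ˢ ball w.1 s} := by
      refine IsOpen.measurableSet ?_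
      exact (isOpen_lt (continuous_snd.fst.dist continuous_fst) continuous_const).inter
        (isOpen_lt (continuous_snd.snd.dist continuous_fst) continuous_const)
    have h1 : ∀ z, ∫⁻ p in ball z s ×ˢ ball z s, q p ∂(pairMeasure κ) =
        ∫⁻ p, {w : Eucl N × (Eucl N × Eucl N) | w.2 ∈ ball w.1 s ×ˢ ball w.1 s}.indicator
          (fun w => q w.2) (z, p) ∂(pairMeasure κ) := by
      intro z
      rw [← lintegral_indicator (measurableSet_ball.prod measurableSet_ball)]
      rfl
    simp_rw [h1]
    have hm : Measurable (Function.uncurry fun (z : Eucl N) (p : Eucl N × Eucl N) =>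
        {w : Eucl N × (Eucl N × Eucl N) | w.2 ∈ ball w.1 s ×ˢ ball w.1 s}.indicator
          (fun w => q w.2) (z, p)) :=
      (hqm.comp measurable_snd).indicator hset
    rw [lintegral_lintegral_swap hm.aemeasurable,
      ← lintegral_const_mul _ hqm,
      ← lintegral_indicator (measurableSet_ball.prod measurableSet_ball)]
    refine lintegral_mono fun p => ?_
    by_cases hp : p ∈ ball x₀ ρ ×ˢ ball x₀ ρ
    · rw [indicator_of_mem hp]
      calc ∫⁻ z in ball x₀ (ρ - s), {w : Eucl N × (Eucl N × Eucl N) |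
            w.2 ∈ ball w.1 s ×ˢ ball w.1 s}.indicator (fun w => q w.2) (z, p)
          ≤ ∫⁻ z, (ball p.1 s).indicator (fun _ => q p) z := by
            refine (setLIntegral_le_lintegral _ _).trans (lintegral_mono fun z => ?_)
            by_cases hz : (z, p) ∈ {w : Eucl N × (Eucl N × Eucl N) |
                w.2 ∈ ball w.1 s ×ˢ ball w.1 s}
            · have hz' : z ∈ ball p.1 s := by
                have h := hz.1
                rw [mem_ball] at h ⊢
                rwa [dist_comm]
              rw [indicator_of_mem hz, indicator_of_mem hz']
            · rw [indicator_of_notMem hz]; exact zero_le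
        _ = _ := by rw [lintegral_indicator_const measurableSet_ball, hvol, mul_comm]
    · rw [indicator_of_notMem hp]
      refine le_of_eq (setLIntegral_eq_zero measurableSet_ball fun z hz => ?_)
      apply indicator_of_notMem
      intro h
      have hsub : ball z s ⊆ ball x₀ ρ := ball_subset_ball' (by rw [mem_ball] at hz; linarith)
      exact hp ⟨hsub h.1, hsub h.2⟩
  have hpos : volume (ball x₀ s) ≠ 0 := (measure_ball_pos _ _ hs).ne'
  have htop : volume (ball x₀ s) ≠ ∞ := measure_ball_lt_top.ne
  rw [← ENNReal.mul_le_mul_iff_right hpos htop]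
  calc _ ≤ ∫⁻ z in ball x₀ (ρ - s), ∫⁻ x in ball z s, f x := hleft
    _ ≤ ∫⁻ z in ball x₀ (ρ - s), ENNReal.ofReal (2 * C₁ * s ^ α) *
        ∫⁻ p in ball z s ×ˢ ball z s, q p ∂(pairMeasure κ) :=
        setLIntegral_mono' measurableSet_ball hloc
    _ = ENNReal.ofReal (2 * C₁ * s ^ α) * ∫⁻ z in ball x₀ (ρ - s),
        ∫⁻ p in ball z s ×ˢ ball z s, q p ∂(pairMeasure κ) :=
        lintegral_const_mul' _ _ ENNReal.ofReal_ne_top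
    _ ≤ _ := by
        refine (mul_le_mul_right hright _).trans (le_of_eq ?_)
        ring

end JumpSetting

/-! ### De Giorgi's iteration without a Sobolev inequality. -/

theorem volume_ball_mul {N : ℕ} (x y : Eucl N) {c : ℝ} (hc : 0 < c) (s : ℝ) :
    volume (ball x (c * s)) = ENNReal.ofReal (c ^ N) * volume (ball y s) := by
  rw [Measure.addHaar_ball_mul_of_pos volume x hc, Measure.addHaar_ball_center volume y]
  simp

namespace JumpSetting

variable {N : ℕ} {α C₁ C₂ : ℝ} {κ : Kernel (Eucl N) (Eucl N)} {u : Eucl N → ℝ}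
  {x₀ : Eucl N} {R r d : ℝ}

/-- One step of De Giorgi's iteration. -/
theorem volume_sublevel_step (S : JumpSetting α C₁ C₂ κ u x₀ R r d) {k : ℝ} (hdk : d ≤ k)
    {θ Λ : ℝ} (hθ : 0 < θ) (hθ4 : θ ≤ 1 / 4) (hΛ : 0 < Λ) (hΛ2 : Λ ≤ 1 / 2)
    (hΛα : Λ ^ α = 1 / 16) (hθC : 256 * C₁ * (jumpConst α C₂ + 1) * θ ^ α ≤ Λ ^ N) (j : ℕ)
    (hsmall : 4 * volume {x ∈ ball x₀ (2 * r + 2 * r / 2 ^ j) | u x + d < k / 2 * (1 + 1 / 2 ^ j)} ≤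
      volume (ball x₀ (θ * r * Λ ^ j))) :
    4 * volume {x ∈ ball x₀ (2 * r + 2 * r / 2 ^ (j + 1)) |
        u x + d < k / 2 * (1 + 1 / 2 ^ (j + 1))} ≤
      volume (ball x₀ (θ * r * Λ ^ (j + 1))) := by
  have hR := S.R_pos
  have hr := S.r_pos
  have hrR := S.r_lt
  have hd := S.d_pos
  have hk : 0 < k := hd.trans_le hdk
  have hC := S.one_le_C₁
  have hα := S.alpha_pos
  have hJ := jumpConst_pos S.alpha_lt S.one_le_C₂
  set e : ℝ := 1 / 2 ^ j with he
  have he0 : 0 < e := by positivity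
  have he1 : e ≤ 1 := by
    rw [he, one_div]; exact inv_le_one_of_one_le₀ (one_le_pow₀ one_le_two)
  have he2 : (1 : ℝ) / 2 ^ (j + 1) = e / 2 := by rw [he, pow_succ]; field_simp
  have hρ : 2 * r + 2 * r / 2 ^ j = 2 * r + 2 * r * e := by rw [he]; ring
  have hρ' : 2 * r + 2 * r / 2 ^ (j + 1) = 2 * r + r * e := by
    rw [div_eq_mul_one_div, he2]; ring
  have hΛj : Λ ^ j ≤ e := by
    rw [he, ← one_div_pow]; exact pow_le_pow_left₀ hΛ.le hΛ2 j
  rw [hρ] at hsmall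
  rw [hρ', he2]
  set kj : ℝ := k / 2 * (1 + e) with hkj
  set A : Set (Eucl N) := {x ∈ ball x₀ (2 * r + 2 * r * e) | u x + d < kj} with hA
  set A' : Set (Eucl N) := {x ∈ ball x₀ (2 * r + r * e) | u x + d < k / 2 * (1 + e / 2)} with hA'
  set g : ℝ := r * e / 2 with hg
  set σ : ℝ := θ * r * Λ ^ j with hσ
  have hg0 : 0 < g := by positivity
  have hσ0 : 0 < σ := by positivity
  have hre : r * e ≤ r := by nlinarith
  have hσg : 2 * σ ≤ g := by
    have : θ * r * Λ ^ j ≤ 1 / 4 * r * e := by gcongr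
    rw [hσ, hg]; linarith
  have hkj0 : 0 ≤ kj := by positivity
  have hkjk : kj ≤ k := by rw [hkj]; nlinarith
  -- The gap between consecutive radii is `r * e = 2 * g`. One `g` is spent on the cutoff, the other
  -- on the loss `2 * σ ≤ g` in the averaged Poincaré inequality.
  have hcacc := S.energy_trunc_le hkj0 hkjk hdk (s := 2 * r + 2 * r * e - g) hg0
    (by linarith) (by linarith)
  rw [sub_add_cancel] at hcacc
  have hT := isTestProfile_truncProfile hkj0 hd.le
  have hfk := S.lintegral_sq_le_energy (H := truncProfile kj d) hT.continuous.measurable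
    (fun t => by rw [abs_of_nonneg (hT.nonneg t)]; exact hT.le t) hT.lipschitz
    (ρ := 2 * r + 2 * r * e - g) hσ0 (by linarith) (le_trans (by
      gcongr 4 * volume ?_
      rintro x ⟨hx, hx2⟩
      have hxR : x ∈ ball x₀ R := ball_subset_ball (by linarith) hx
      refine ⟨ball_subset_ball (by linarith) hx, ?_⟩
      by_contra hcon
      apply hx2
      rw [truncProfile_of_nonneg hkj0 hd.le (S.nonneg x hxR), max_eq_right (by linarith)]) hsmall)
  -- On `A'` the truncation at the previous level is at least the difference `k * e / 4` of the two
  -- levels.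
  have hlow : ENNReal.ofReal ((k * e / 4) ^ 2) * volume A' ≤
      ∫⁻ x in ball x₀ (2 * r + 2 * r * e - g - 2 * σ),
        ENNReal.ofReal (truncProfile kj d (u x) ^ 2) := by
    have hA'm : MeasurableSet A' :=
      measurableSet_ball.inter (measurableSet_lt (S.measurable.add_const d) measurable_const)
    rw [← setLIntegral_const]
    refine le_trans (setLIntegral_mono' hA'm fun x hx => ?_) (lintegral_mono_set ?_)
    · apply ENNReal.ofReal_le_ofReal
      have hxR : x ∈ ball x₀ R := ball_subset_ball (by linarith) hx.1
      rw [truncProfile_of_nonneg hkj0 hd.le (S.nonneg x hxR)]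
      refine pow_le_pow_left₀ (by positivity) (le_max_of_le_left ?_) 2
      have := hx.2
      rw [hkj]; linarith
    · exact (sep_subset _ _).trans (ball_subset_ball (by linarith))
  have hmain : ENNReal.ofReal ((k * e / 4) ^ 2) * volume A' ≤
      ENNReal.ofReal ((k * e / 4) ^ 2) * (ENNReal.ofReal (Λ ^ N) * volume A) := by
    refine (hlow.trans hfk).trans ((mul_le_mul_right hcacc _).trans ?_)
    rw [← mul_assoc, ← mul_assoc (ENNReal.ofReal _), ← ENNReal.ofReal_mul (by positivity),
      ← ENNReal.ofReal_mul (by positivity)]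
    refine mul_le_mul_left (ENNReal.ofReal_le_ofReal ?_) _
    -- The choice `Λ ^ α = 1 / 16` makes `σ ^ α` carry `e ^ 4`, which exactly offsets a factor `e ^
    -- (-2)` from the cutoff and another `e ^ (-2)` from the level gap. What remains is independent
    -- of `j` and small by the choice of `θ`.
    have h1 : σ ^ α = θ ^ α * r ^ α * e ^ 4 := by
      rw [hσ, Real.mul_rpow (by positivity) (by positivity), Real.mul_rpow hθ.le hr.le,
        ← Real.rpow_natCast, ← Real.rpow_mul hΛ.le, mul_comm (j : ℝ), Real.rpow_mul hΛ.le, hΛα,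
        Real.rpow_natCast, he, ← one_div_pow, ← pow_mul, mul_comm j, pow_mul]
      norm_num
    have h2 : r ^ α * (e / 2) ^ 2 ≤ g ^ α := by
      rw [hg, mul_div_assoc, Real.mul_rpow hr.le (by positivity)]
      gcongr
      rw [← Real.rpow_natCast]
      exact Real.rpow_le_rpow_of_exponent_ge (by positivity) (by linarith)
        (by exact_mod_cast S.alpha_lt.le)
    have h3 : 0 < r ^ α := by positivity
    rw [h1]
    calc 2 * C₁ * (θ ^ α * r ^ α * e ^ 4) * (2 * (k ^ 2 * ((jumpConst α C₂ + 1) / g ^ α)))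
        ≤ 2 * C₁ * (θ ^ α * r ^ α * e ^ 4) *
          (2 * (k ^ 2 * ((jumpConst α C₂ + 1) / (r ^ α * (e / 2) ^ 2)))) := by gcongr
      _ = (k * e / 4) ^ 2 * (256 * C₁ * (jumpConst α C₂ + 1) * θ ^ α) := by
          field_simp; ring
      _ ≤ (k * e / 4) ^ 2 * Λ ^ N := by gcongr
  have hpos : ENNReal.ofReal ((k * e / 4) ^ 2) ≠ 0 := by
    simp only [ne_eq, ENNReal.ofReal_eq_zero, not_le]; positivity
  rw [ENNReal.mul_le_mul_iff_right hpos ENNReal.ofReal_ne_top] at hmain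
  calc 4 * volume A' ≤ 4 * (ENNReal.ofReal (Λ ^ N) * volume A) := by gcongr
    _ = ENNReal.ofReal (Λ ^ N) * (4 * volume A) := by ring
    _ ≤ ENNReal.ofReal (Λ ^ N) * volume (ball x₀ σ) := by gcongr
    _ = _ := by
      rw [← volume_ball_mul x₀ x₀ hΛ, hσ, pow_succ]; congr 2; ring

/-- The sublevel sets stay below a quarter of the volume of balls whose radii `θ * r * Λ ^ j` shrink
to zero; since `N ≠ 0` these volumes tend to zero, while the levels decrease to `k / 2` and the
radii to `2 * r`. -/
theorem ae_le_of_volume_sublevel_le (hN : N ≠ 0) (S : JumpSetting α C₁ C₂ κ u x₀ R r d) {k : ℝ}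
    (hdk : d ≤ k) {θ Λ : ℝ} (hθ : 0 < θ) (hθ4 : θ ≤ 1 / 4) (hΛ : 0 < Λ) (hΛ2 : Λ ≤ 1 / 2)
    (hΛα : Λ ^ α = 1 / 16) (hθC : 256 * C₁ * (jumpConst α C₂ + 1) * θ ^ α ≤ Λ ^ N)
    (hsmall : 4 * volume {x ∈ ball x₀ (4 * r) | u x + d < k} ≤ volume (ball x₀ (θ * r))) :
    ∀ᵐ x, x ∈ ball x₀ (2 * r) → k / 2 ≤ u x + d := by
  have hr := S.r_pos
  have hk : 0 < k := S.d_pos.trans_le hdk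
  have hall : ∀ j : ℕ, 4 * volume {x ∈ ball x₀ (2 * r + 2 * r / 2 ^ j) |
      u x + d < k / 2 * (1 + 1 / 2 ^ j)} ≤ volume (ball x₀ (θ * r * Λ ^ j)) := by
    intro j
    induction j with
    | zero =>
      simp only [pow_zero, div_one, mul_one]
      rw [show 2 * r + 2 * r = 4 * r by ring, show k / 2 * (1 + 1) = k by ring]
      exact hsmall
    | succ j ih => exact S.volume_sublevel_step hdk hθ hθ4 hΛ hΛ2 hΛα hθC j ih
  have hle : ∀ j : ℕ, volume {x ∈ ball x₀ (2 * r) | u x + d < k / 2} ≤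
      ENNReal.ofReal (Λ ^ N) ^ j * volume (ball x₀ (θ * r)) := by
    intro j
    calc volume {x ∈ ball x₀ (2 * r) | u x + d < k / 2}
        ≤ volume {x ∈ ball x₀ (2 * r + 2 * r / 2 ^ j) | u x + d < k / 2 * (1 + 1 / 2 ^ j)} := by
          refine measure_mono fun x hx => ⟨ball_subset_ball ?_ hx.1, hx.2.trans_le ?_⟩
          · have : 0 ≤ 2 * r / 2 ^ j := by positivity
            linarith
          · have : 0 ≤ k / 2 * (1 / 2 ^ j) := by positivity
            linarith
      _ ≤ 4 * volume {x ∈ ball x₀ (2 * r + 2 * r / 2 ^ j) |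
            u x + d < k / 2 * (1 + 1 / 2 ^ j)} := by
          refine le_mul_of_one_le_left zero_le ?_
          norm_num
      _ ≤ volume (ball x₀ (Λ ^ j * (θ * r))) := by rw [mul_comm (Λ ^ j)]; exact hall j
      _ = _ := by
          rw [volume_ball_mul x₀ x₀ (by positivity), ← pow_mul, mul_comm j, pow_mul,
            ENNReal.ofReal_pow (by positivity)]
  have hlim : Filter.Tendsto
      (fun j : ℕ => ENNReal.ofReal (Λ ^ N) ^ j * volume (ball x₀ (θ * r))) Filter.atTop
      (nhds 0) := by
    have h1 : ENNReal.ofReal (Λ ^ N) < 1 := by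
      rw [ENNReal.ofReal_lt_one]
      exact pow_lt_one₀ hΛ.le (by linarith) hN
    have := ENNReal.Tendsto.mul_const (ENNReal.tendsto_pow_atTop_nhds_zero_of_lt_one h1)
      (Or.inr (measure_ball_lt_top (μ := (volume : Measure (Eucl N))) (x := x₀)
        (r := θ * r)).ne)
    simpa using this
  have hzero : volume {x ∈ ball x₀ (2 * r) | u x + d < k / 2} = 0 :=
    le_antisymm (ge_of_tendsto' hlim hle) zero_le
  filter_upwards [measure_eq_zero_iff_ae_notMem.1 hzero] with x hx hxb
  by_contra hcon
  exact hx ⟨hxb, not_le.1 hcon⟩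

end JumpSetting

/-- Critical density: if the sublevel set of `u + d` is a small portion of the ball, then `u + d`
is bounded below on the half ball. -/
theorem exists_critical_density {N : ℕ} (hN : N ≠ 0) {α C₁ C₂ : ℝ} (hα : 0 < α) (hα2 : α < 2)
    (hC₁ : 1 ≤ C₁) (hC₂ : 1 ≤ C₂) :
    ∃ θ : ℝ, 0 < θ ∧ θ ≤ 1 / 4 ∧ ∀ (κ : Kernel (Eucl N) (Eucl N)) (u : Eucl N → ℝ) (x₀ : Eucl N)
      (R r d : ℝ), JumpSetting α C₁ C₂ κ u x₀ R r d → ∀ k, d ≤ k →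
      4 * volume {x ∈ ball x₀ (4 * r) | u x + d < k} ≤ volume (ball x₀ (θ * r)) →
      ∀ᵐ x, x ∈ ball x₀ (2 * r) → k / 2 ≤ u x + d := by
  have hJ := jumpConst_pos hα2 hC₂
  -- Because `α < 2`, this ratio is at most `1 / 4`, so the averaging radii shrink at least as fast
  -- as the gaps between the De Giorgi balls.
  set Λ : ℝ := (1 / 16) ^ (1 / α) with hΛ
  have hΛ0 : 0 < Λ := by positivity
  have hΛα : Λ ^ α = 1 / 16 := by
    rw [hΛ, ← Real.rpow_mul (by norm_num), one_div_mul_cancel hα.ne', Real.rpow_one]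
  have hΛ2 : Λ ≤ 1 / 2 := by
    have h1 : Λ ≤ (1 / 16 : ℝ) ^ (1 / 2 : ℝ) := by
      apply Real.rpow_le_rpow_of_exponent_ge (by norm_num) (by norm_num)
      exact one_div_le_one_div_of_le hα hα2.le
    have h2 : (1 / 16 : ℝ) ^ (1 / 2 : ℝ) = 1 / 4 := by
      rw [show (1 / 16 : ℝ) = (1 / 4) ^ (2 : ℝ) by norm_num, ← Real.rpow_mul (by norm_num)]
      norm_num
    rw [h2] at h1; linarith
  set M : ℝ := 256 * C₁ * (jumpConst α C₂ + 1) with hM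
  have hM0 : 0 < M := by positivity
  refine ⟨min (1 / 4) ((Λ ^ N / M) ^ (1 / α)), by positivity, min_le_left _ _, ?_⟩
  intro κ u x₀ R r d S k hdk hsmall
  refine S.ae_le_of_volume_sublevel_le hN hdk (by positivity) (min_le_left _ _) hΛ0 hΛ2 hΛα ?_
    hsmall
  rw [← hM]
  calc M * min (1 / 4) ((Λ ^ N / M) ^ (1 / α)) ^ α ≤ M * ((Λ ^ N / M) ^ (1 / α)) ^ α := by
        gcongr; exact min_le_right _ _
    _ = Λ ^ N := by
        rw [← Real.rpow_mul (by positivity), one_div_mul_cancel hα.ne', Real.rpow_one]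
        field_simp

/-! ### The John-Nirenberg inequality on balls. -/

/-- Bounded mean oscillation, with constant `K`, on the balls inside `ball x₀ ρ`. -/
def HasBMO {N : ℕ} (f : Eucl N → ℝ) (x₀ : Eucl N) (ρ K : ℝ) : Prop :=
  ∀ y s, 0 < s → dist y x₀ + s ≤ ρ →
    ∫⁻ x in ball y s, ENNReal.ofReal |f x - ⨍ z in ball y s, f z| ≤
      ENNReal.ofReal K * volume (ball y s)

theorem integrableOn_of_bounded {N : ℕ} {f : Eucl N → ℝ} {M : ℝ} (hf : Measurable f)
    (hM : ∀ x, |f x| ≤ M) (y : Eucl N) (s : ℝ) : IntegrableOn f (ball y s) volume :=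
  Measure.integrableOn_of_bounded measure_ball_lt_top.ne hf.aestronglyMeasurable
    (Filter.Eventually.of_forall hM)

theorem volume_ball_lt_top {N : ℕ} (y : Eucl N) (s : ℝ) : volume (ball y s) < ∞ :=
  measure_ball_lt_top

theorem volume_ball_pos {N : ℕ} (y : Eucl N) {s : ℝ} (hs : 0 < s) : 0 < volume (ball y s) :=
  measure_ball_pos _ _ hs

theorem volume_closedBall_eq {N : ℕ} (y : Eucl N) {s : ℝ} (hs : 0 < s) :
    volume (closedBall y s) = volume (ball y s) := by
  rw [Measure.addHaar_closedBall volume y hs.le, Measure.addHaar_ball_of_pos volume y hs]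

/-- The mean over a ball deviates from a constant at most by the mean deviation. -/
theorem abs_average_sub_le {N : ℕ} {f : Eucl N → ℝ} {M : ℝ} (hf : Measurable f)
    (hM : ∀ x, |f x| ≤ M) {y : Eucl N} {s : ℝ} (hs : 0 < s) (a : ℝ) {L : ℝ} (hL : 0 ≤ L)
    (h : ∫⁻ x in ball y s, ENNReal.ofReal |f x - a| ≤ ENNReal.ofReal L * volume (ball y s)) :
    |(⨍ z in ball y s, f z) - a| ≤ L := by
  have hfi := integrableOn_of_bounded hf hM y s
  have hV : 0 < volume.real (ball y s) :=
    ENNReal.toReal_pos (volume_ball_pos y hs).ne' (volume_ball_lt_top y s).ne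
  have h1 : volume.real (ball y s) * ((⨍ z in ball y s, f z) - a) =
      ∫ x in ball y s, (f x - a) := by
    rw [integral_sub hfi (integrableOn_const (volume_ball_lt_top y s).ne), mul_sub,
      ← smul_eq_mul, measure_smul_setAverage f (volume_ball_lt_top y s).ne, setIntegral_const,
      smul_eq_mul]
  have h2 : |∫ x in ball y s, (f x - a)| ≤ L * volume.real (ball y s) := by
    have h3 := enorm_integral_le_lintegral_enorm (μ := volume.restrict (ball y s))
      (fun x => f x - a)
    simp_rw [Real.enorm_eq_ofReal_abs] at h3
    have h4 := h3.trans h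
    rw [← ENNReal.ofReal_toReal (volume_ball_lt_top y s).ne, ← ENNReal.ofReal_mul hL] at h4
    exact (ENNReal.ofReal_le_ofReal_iff (by positivity)).1 h4
  rw [← h1, abs_mul, abs_of_pos hV, mul_comm] at h2
  exact le_of_mul_le_mul_right h2 hV

/-- Mean deviation on a doubled ball from the mean over the original ball. -/
theorem HasBMO.lintegral_double_le {N : ℕ} {f : Eucl N → ℝ} {x₀ : Eucl N} {ρ K M : ℝ}
    (h : HasBMO f x₀ ρ K) (hK : 0 ≤ K) (hf : Measurable f) (hM : ∀ x, |f x| ≤ M) {y : Eucl N}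
    {s : ℝ} (hs : 0 < s) (hy : dist y x₀ + 2 * s ≤ ρ) :
    ∫⁻ x in ball y (2 * s), ENNReal.ofReal |f x - ⨍ z in ball y s, f z| ≤
      ENNReal.ofReal (K * (1 + 2 ^ N) * 2 ^ N) * volume (ball y s) := by
  have h2 := h y (2 * s) (by positivity) hy
  set b := ⨍ z in ball y (2 * s), f z with hb
  have hvol := volume_ball_mul y y (two_pos (α := ℝ)) s
  have h3 : |(⨍ z in ball y s, f z) - b| ≤ K * 2 ^ N := by
    refine abs_average_sub_le hf hM hs b (by positivity) ?_
    refine (lintegral_mono_set (ball_subset_ball (by linarith))).trans (h2.trans (le_of_eq ?_))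
    rw [hvol, ENNReal.ofReal_mul hK, mul_assoc]
  have hm : Measurable fun x => ENNReal.ofReal |f x - b| :=
    (continuous_abs.measurable.comp (hf.sub_const b)).ennreal_ofReal
  calc ∫⁻ x in ball y (2 * s), ENNReal.ofReal |f x - ⨍ z in ball y s, f z|
      ≤ ∫⁻ x in ball y (2 * s), (ENNReal.ofReal |f x - b| + ENNReal.ofReal (K * 2 ^ N)) := by
        refine lintegral_mono fun x => ?_
        rw [← ENNReal.ofReal_add (abs_nonneg _) (by positivity)]
        apply ENNReal.ofReal_le_ofReal
        have := abs_sub_le (f x) b (⨍ z in ball y s, f z)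
        rw [abs_sub_comm b] at this
        linarith
    _ ≤ ENNReal.ofReal K * volume (ball y (2 * s)) +
        ENNReal.ofReal (K * 2 ^ N) * volume (ball y (2 * s)) := by
        rw [lintegral_add_left hm, setLIntegral_const]
        gcongr
    _ = _ := by
        rw [hvol, ← add_mul, ← ENNReal.ofReal_add hK (by positivity), ← mul_assoc,
          ← ENNReal.ofReal_mul (by positivity)]
        congr 2; ring

/-- Stopping time argument: almost every point with a large value of `h` is the centre of a ball
on which `h` has a large mean, while its mean over the six times larger ball is controlled. -/
theorem ae_exists_stopping_ball {N : ℕ} {h : Eucl N → ℝ} {M : ℝ} (hm : Measurable h)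
    (h0 : ∀ x, 0 ≤ h x) (hM : ∀ x, h x ≤ M) {B : Set (Eucl N)} {s L : ℝ} (hs : 0 < s) (hL : 0 ≤ L)
    (hB : ∀ x ∈ B, ∫⁻ z in closedBall x s, ENNReal.ofReal (h z) ≤
      ENNReal.ofReal L * volume (closedBall x s)) :
    ∀ᵐ x, x ∈ B → L < h x → ∃ t, 0 < t ∧ 6 * t ≤ s ∧
      ENNReal.ofReal L * volume (closedBall x t) ≤
        ∫⁻ z in closedBall x t, ENNReal.ofReal (h z) ∧
      ∫⁻ z in ball x (6 * t), ENNReal.ofReal (h z) ≤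
        ENNReal.ofReal L * volume (ball x (6 * t)) := by
  have habs : ∀ x, ‖h x‖ ≤ M := fun x => by rw [Real.norm_of_nonneg (h0 x)]; exact hM x
  have hi : ∀ x t, IntegrableOn h (closedBall x t) volume := fun x t =>
    Measure.integrableOn_of_bounded measure_closedBall_lt_top.ne hm.aestronglyMeasurable
      (Filter.Eventually.of_forall habs)
  have hloc : LocallyIntegrable h volume := fun x =>
    ⟨closedBall x 1, closedBall_mem_nhds x one_pos, hi x 1⟩
  filter_upwards [IsUnifLocDoublingMeasure.ae_tendsto_average volume hloc 1] with x hx hxB hxL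
  -- Radii shrink by the factor 6. By Lebesgue differentiation some mean exceeds `L`; the first such
  -- index is not zero by `hB`, so the ball with the previous radius, six times larger, still has
  -- mean at most `L`.
  set σ : ℕ → ℝ := fun j => s * (1 / 6) ^ j with hσ
  have hσ0 : ∀ j, 0 < σ j := fun j => by positivity
  have hlim : Filter.Tendsto σ Filter.atTop (nhdsWithin 0 (Ioi 0)) := by
    refine tendsto_nhdsWithin_iff.2 ⟨?_, Filter.Eventually.of_forall hσ0⟩
    have := (tendsto_pow_atTop_nhds_zero_of_lt_one (r := (1 / 6 : ℝ)) (by norm_num)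
      (by norm_num)).const_mul s
    simpa [hσ] using this
  have hx' := hx (fun _ => x) σ hlim
    (Filter.Eventually.of_forall fun j => mem_closedBall_self (by have := hσ0 j; positivity))
  let p : ℕ → Prop := fun j => ENNReal.ofReal L * volume (closedBall x (σ j)) <
    ∫⁻ z in closedBall x (σ j), ENNReal.ofReal (h z)
  have hex : ∃ j, p j := by
    obtain ⟨j, hj⟩ := (hx'.eventually (lt_mem_nhds hxL)).exists
    refine ⟨j, ?_⟩
    have hV : 0 < volume.real (closedBall x (σ j)) :=
      ENNReal.toReal_pos (measure_closedBall_pos _ _ (hσ0 j)).ne' measure_closedBall_lt_top.ne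
    rw [setAverage_eq, smul_eq_mul, inv_mul_eq_div, lt_div_iff₀ hV] at hj
    change ENNReal.ofReal L * volume (closedBall x (σ j)) < _
    rw [← ofReal_integral_eq_lintegral_ofReal (hi x (σ j)) (Filter.Eventually.of_forall h0),
      ← ENNReal.ofReal_toReal (measure_closedBall_lt_top (x := x) (r := σ j)).ne,
      ← ENNReal.ofReal_mul hL]
    exact (ENNReal.ofReal_lt_ofReal_iff_of_nonneg (by positivity)).2 hj
  classical
  have hp0 : ¬ p 0 := by
    simp only [p, hσ, pow_zero, mul_one, not_lt]
    exact hB x hxB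
  obtain ⟨j, hj⟩ : ∃ j, Nat.find hex = j + 1 := by
    refine Nat.exists_eq_succ_of_ne_zero fun h => hp0 ?_
    rw [← h]; exact Nat.find_spec hex
  have h1 : p (j + 1) := hj ▸ Nat.find_spec hex
  have h2 : ¬ p j := Nat.find_min hex (by omega)
  have h6 : 6 * σ (j + 1) = σ j := by simp only [hσ, pow_succ]; ring
  refine ⟨σ (j + 1), hσ0 _, ?_, h1.le, ?_⟩
  · rw [h6]
    calc σ j ≤ s * 1 := by
          simp only [hσ]; gcongr
          exact pow_le_one₀ (by norm_num) (by norm_num)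
      _ = s := mul_one s
  · rw [h6, ← volume_closedBall_eq x (hσ0 j)]
    exact (lintegral_mono_set ball_subset_closedBall).trans (not_lt.1 h2)

/-- The level in the Calderón-Zygmund type decomposition. -/
noncomputable def jnLevel (N : ℕ) (K : ℝ) : ℝ := 4 * 6 ^ N * (K * (1 + 2 ^ N) * 2 ^ N)

theorem jnLevel_pos (N : ℕ) {K : ℝ} (hK : 0 < K) : 0 < jnLevel N K := by
  unfold jnLevel; positivity

/-- The exponent in the John-Nirenberg inequality. -/
noncomputable def jnExponent (N : ℕ) (K : ℝ) : ℝ := Real.log 2 / jnLevel N K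

theorem jnExponent_pos (N : ℕ) {K : ℝ} (hK : 0 < K) : 0 < jnExponent N K :=
  div_pos (Real.log_pos one_lt_two) (jnLevel_pos N hK)

theorem exp_jnExponent_mul_le {N : ℕ} {K : ℝ} (hK : 0 < K) {t : ℝ} (ht : t ≤ jnLevel N K) :
    Real.exp (jnExponent N K * t) ≤ 2 := by
  have hL := jnLevel_pos N hK
  rw [← Real.exp_log two_pos]
  apply Real.exp_le_exp.2
  unfold jnExponent
  rw [div_mul_eq_mul_div, div_le_iff₀ hL]
  exact mul_le_mul_of_nonneg_left ht (Real.log_pos one_lt_two).le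

/-- A uniform bound `X` for the exponential means improves itself. Where `|f - a| ≤ L` the integrand
is at most 2. The rest is covered by stopping balls on which the mean of `f` differs from `a` by at
most `L`; on each the bound `X` holds at the cost of another factor 2. The level `L` is so large
that these balls occupy too little volume to contribute more than `X / 2`. -/
theorem HasBMO.lintegral_exp_step {N : ℕ} {f : Eucl N → ℝ} {x₀ : Eucl N} {ρ K M : ℝ}
    (h : HasBMO f x₀ ρ K) (hK : 0 < K) (hf : Measurable f) (hM : ∀ x, |f x| ≤ M) {X : ℝ≥0∞}
    (hX : ∀ y s, 0 < s → dist y x₀ + 2 * s ≤ ρ → ∫⁻ x in ball y s,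
      ENNReal.ofReal (Real.exp (jnExponent N K * |f x - ⨍ z in ball y s, f z|)) ≤
        X * volume (ball y s))
    {y : Eucl N} {s : ℝ} (hs : 0 < s) (hy : dist y x₀ + 2 * s ≤ ρ) :
    ∫⁻ x in ball y s,
      ENNReal.ofReal (Real.exp (jnExponent N K * |f x - ⨍ z in ball y s, f z|)) ≤
        (2 + X / 2) * volume (ball y s) := by
  set a := ⨍ z in ball y s, f z with ha
  set L := jnLevel N K with hL
  set ε := jnExponent N K with hε
  have hL0 : 0 < L := jnLevel_pos N hK
  have hε0 : 0 < ε := jnExponent_pos N hK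
  have hdouble : ∫⁻ x in ball y (2 * s), ENNReal.ofReal |f x - a| ≤
      ENNReal.ofReal (L / (4 * 6 ^ N)) * volume (ball y s) := by
    refine (h.lintegral_double_le hK.le hf hM hs hy).trans (le_of_eq ?_)
    congr 2
    rw [hL, jnLevel]; field_simp
  have hhm : Measurable fun x => |f x - a| := continuous_abs.measurable.comp (hf.sub_const a)
  have hem : Measurable fun x => ENNReal.ofReal (Real.exp (ε * |f x - a|)) :=
    (hhm.const_mul ε).exp.ennreal_ofReal
  have hvols : ∀ x : Eucl N, volume (ball y s) = ENNReal.ofReal (2 ^ N) * volume (ball x (s / 2)) :=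
    fun x => by rw [← volume_ball_mul y x two_pos, mul_div_cancel₀ _ two_ne_zero]
  have hcover := ae_exists_stopping_ball (h := fun x => |f x - a|) (M := M + |a|)
    (B := ball y s) (s := s / 2) (L := L) hhm (fun x => abs_nonneg _)
    (fun x => (abs_sub _ _).trans (by linarith [hM x])) (by positivity) hL0.le (fun x hx => by
      rw [volume_closedBall_eq x (by positivity)]
      refine (lintegral_mono_set (closedBall_subset_ball' ?_)).trans (hdouble.trans ?_)
      · rw [mem_ball] at hx; linarith
      · rw [hvols x, ← mul_assoc, ← ENNReal.ofReal_mul (by positivity)]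
        gcongr
        rw [div_mul_eq_mul_div, div_le_iff₀ (by positivity)]
        gcongr
        calc (2 : ℝ) ^ N ≤ 6 ^ N := pow_le_pow_left₀ zero_le_two (by norm_num) N
          _ ≤ 4 * 6 ^ N := by linarith [show (0 : ℝ) < 6 ^ N by positivity])
  set T : Set (Eucl N) := {x ∈ ball y s | ∃ t, 0 < t ∧ 6 * t ≤ s / 2 ∧
      ENNReal.ofReal L * volume (closedBall x t) ≤
        ∫⁻ z in closedBall x t, ENNReal.ofReal |f z - a| ∧
      ∫⁻ z in ball x (6 * t), ENNReal.ofReal |f z - a| ≤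
        ENNReal.ofReal L * volume (ball x (6 * t))} with hT
  have hTex : ∀ x ∈ T, ∃ t, 0 < t ∧ 6 * t ≤ s / 2 ∧
      ENNReal.ofReal L * volume (closedBall x t) ≤
        ∫⁻ z in closedBall x t, ENNReal.ofReal |f z - a| ∧
      ∫⁻ z in ball x (6 * t), ENNReal.ofReal |f z - a| ≤
        ENNReal.ofReal L * volume (ball x (6 * t)) := fun x hx => hx.2
  choose! t ht0 ht6 htlow htup using hTex
  -- Vitali's covering lemma gives disjoint balls whose closed fivefold enlargements cover; the open
  -- sixfold ones contain these, and on them the mean is controlled.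
  obtain ⟨v, hvT, hdisj, hcov⟩ := Vitali.exists_disjoint_subfamily_covering_enlargement_closedBall
    T (fun x => x) t s (fun x hx => by linarith [ht0 x hx, ht6 x hx]) 5 (by norm_num)
  have hvc : v.Countable := hdisj.countable_of_nonempty_interior fun x hx =>
    (nonempty_ball.2 (ht0 x (hvT hx))).mono ball_subset_interior_closedBall
  have : Countable v := hvc.to_subtype
  have hsub : ∀ᵐ x, x ∈ ball y s →
      x ∈ {x ∈ ball y s | |f x - a| ≤ L} ∪ ⋃ b : v, ball (b : Eucl N) (6 * t b) := by
    filter_upwards [hcover] with x hx hxB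
    by_cases hxL : L < |f x - a|
    · right
      have hxT : x ∈ T := ⟨hxB, hx hxB hxL⟩
      obtain ⟨b, hb, hxb⟩ := hcov x hxT
      refine mem_iUnion.2 ⟨⟨b, hb⟩, ?_⟩
      have hb0 := ht0 b (hvT hb)
      exact closedBall_subset_ball (by linarith) (hxb (mem_closedBall_self (ht0 x hxT).le))
    · exact Or.inl ⟨hxB, not_lt.1 hxL⟩
  have hgood : ∫⁻ x in {x ∈ ball y s | |f x - a| ≤ L},
      ENNReal.ofReal (Real.exp (ε * |f x - a|)) ≤ 2 * volume (ball y s) := by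
    have hms : MeasurableSet {x ∈ ball y s | |f x - a| ≤ L} :=
      measurableSet_ball.inter (measurableSet_le hhm measurable_const)
    calc _ ≤ ∫⁻ x in {x ∈ ball y s | |f x - a| ≤ L}, 2 := by
          refine setLIntegral_mono' hms fun x hx => ?_
          rw [← ENNReal.ofReal_ofNat 2]
          exact ENNReal.ofReal_le_ofReal (exp_jnExponent_mul_le hK hx.2)
      _ ≤ _ := by
          rw [setLIntegral_const]
          gcongr
          exact sep_subset _ _
  have hbad : ∀ b : v, ∫⁻ x in ball (b : Eucl N) (6 * t b),
      ENNReal.ofReal (Real.exp (ε * |f x - a|)) ≤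
        2 * X * ENNReal.ofReal (6 ^ N) * volume (closedBall (b : Eucl N) (t b)) := by
    rintro ⟨b, hb⟩
    have hbT := hvT hb
    have hb0 := ht0 b hbT
    have hb6 := ht6 b hbT
    have h60 : 0 < 6 * t b := by positivity
    simp only
    set c := ⨍ z in ball b (6 * t b), f z with hc
    have hca : |c - a| ≤ L := abs_average_sub_le hf hM h60 a hL0.le (htup b hbT)
    -- The stopping radius satisfies `2 * (6 * t b) ≤ s`, and the centre is within `s` of `y`, so
    -- doubling this ball does not leave the region where the oscillation is controlled.
    have hbX := hX b (6 * t b) h60 (by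
      have h1 : dist b y < s := mem_ball.1 hbT.1
      linarith [dist_triangle b y x₀])
    have hm2 : Measurable fun x => ENNReal.ofReal (Real.exp (ε * |f x - c|)) :=
      ((continuous_abs.measurable.comp (hf.sub_const c)).const_mul ε).exp.ennreal_ofReal
    calc ∫⁻ x in ball b (6 * t b), ENNReal.ofReal (Real.exp (ε * |f x - a|))
        ≤ ∫⁻ x in ball b (6 * t b), 2 * ENNReal.ofReal (Real.exp (ε * |f x - c|)) := by
          refine lintegral_mono fun x => ?_
          rw [← ENNReal.ofReal_ofNat 2, ← ENNReal.ofReal_mul zero_le_two]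
          apply ENNReal.ofReal_le_ofReal
          have h1 := exp_jnExponent_mul_le hK hca
          calc Real.exp (ε * |f x - a|) ≤ Real.exp (ε * |c - a| + ε * |f x - c|) := by
                apply Real.exp_le_exp.2
                rw [← mul_add]
                have := abs_sub_le (f x) c a
                gcongr
                linarith
            _ = Real.exp (ε * |c - a|) * Real.exp (ε * |f x - c|) := Real.exp_add _ _
            _ ≤ _ := by gcongr
      _ = 2 * ∫⁻ x in ball b (6 * t b), ENNReal.ofReal (Real.exp (ε * |f x - c|)) :=
          lintegral_const_mul _ hm2
      _ ≤ 2 * (X * volume (ball b (6 * t b))) := by gcongr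
      _ = _ := by
          rw [volume_ball_mul b b (by norm_num), volume_closedBall_eq b hb0]; ring
  -- Chebyshev's inequality over disjoint balls inside the doubled ball. The factor `4 * 6 ^ N` in
  -- the level beats the `6 ^ N` of the enlargement and leaves the `1 / 4` needed above.
  have hsum : ∑' b : v, volume (closedBall (b : Eucl N) (t b)) ≤
      ENNReal.ofReal (1 / (4 * 6 ^ N)) * volume (ball y s) := by
    have h1 : ENNReal.ofReal L * ∑' b : v, volume (closedBall (b : Eucl N) (t b)) ≤
        ENNReal.ofReal L * (ENNReal.ofReal (1 / (4 * 6 ^ N)) * volume (ball y s)) := by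
      rw [← ENNReal.tsum_mul_left]
      calc _ ≤ ∑' b : v, ∫⁻ z in closedBall (b : Eucl N) (t b), ENNReal.ofReal |f z - a| :=
            ENNReal.tsum_le_tsum fun b => htlow b (hvT b.2)
        _ = ∫⁻ z in ⋃ b ∈ v, closedBall b (t b), ENNReal.ofReal |f z - a| :=
            (lintegral_biUnion hvc (fun b _ => measurableSet_closedBall) hdisj _).symm
        _ ≤ ∫⁻ z in ball y (2 * s), ENNReal.ofReal |f z - a| := by
            refine lintegral_mono_set (iUnion₂_subset fun b hb => closedBall_subset_ball' ?_)
            have h1 : dist b y < s := mem_ball.1 (hvT hb).1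
            linarith [ht0 b (hvT hb), ht6 b (hvT hb)]
        _ ≤ _ := hdouble
        _ = _ := by
            rw [← mul_assoc, ← ENNReal.ofReal_mul hL0.le]; congr 2; ring
    rwa [ENNReal.mul_le_mul_iff_right (by simpa using hL0) ENNReal.ofReal_ne_top] at h1
  calc ∫⁻ x in ball y s, ENNReal.ofReal (Real.exp (ε * |f x - a|))
      ≤ ∫⁻ x in {x ∈ ball y s | |f x - a| ≤ L} ∪ ⋃ b : v, ball (b : Eucl N) (6 * t b),
        ENNReal.ofReal (Real.exp (ε * |f x - a|)) := lintegral_mono_set' hsub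
    _ ≤ (∫⁻ x in {x ∈ ball y s | |f x - a| ≤ L}, ENNReal.ofReal (Real.exp (ε * |f x - a|))) +
        ∫⁻ x in ⋃ b : v, ball (b : Eucl N) (6 * t b),
          ENNReal.ofReal (Real.exp (ε * |f x - a|)) := lintegral_union_le _ _ _
    _ ≤ 2 * volume (ball y s) + ∑' b : v,
        2 * X * ENNReal.ofReal (6 ^ N) * volume (closedBall (b : Eucl N) (t b)) := by
        refine add_le_add hgood ((lintegral_iUnion_le _ _).trans (ENNReal.tsum_le_tsum hbad))
    _ ≤ 2 * volume (ball y s) + 2 * X * ENNReal.ofReal (6 ^ N) *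
        (ENNReal.ofReal (1 / (4 * 6 ^ N)) * volume (ball y s)) := by
        rw [ENNReal.tsum_mul_left]; gcongr
    _ = _ := by
        have h1 : 2 * ENNReal.ofReal (6 ^ N) * ENNReal.ofReal (1 / (4 * 6 ^ N)) = 2⁻¹ := by
          rw [← ENNReal.ofReal_ofNat 2, ← ENNReal.ofReal_mul zero_le_two,
            ← ENNReal.ofReal_mul (by positivity), ← ENNReal.ofReal_inv_of_pos two_pos]
          congr 1; field_simp; norm_num
        calc _ = 2 * volume (ball y s) + X * (2 * ENNReal.ofReal (6 ^ N) *
              ENNReal.ofReal (1 / (4 * 6 ^ N))) * volume (ball y s) := by ring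
          _ = _ := by rw [h1, ← ENNReal.div_eq_inv_mul.trans (mul_comm _ _), add_mul]

/-- John-Nirenberg inequality for bounded functions. -/
theorem HasBMO.lintegral_exp_le {N : ℕ} {f : Eucl N → ℝ} {x₀ : Eucl N} {ρ K M : ℝ}
    (h : HasBMO f x₀ ρ K) (hK : 0 < K) (hf : Measurable f) (hM : ∀ x, |f x| ≤ M)
    {y : Eucl N} {s : ℝ} (hs : 0 < s) (hy : dist y x₀ + 2 * s ≤ ρ) :
    ∫⁻ x in ball y s,
      ENNReal.ofReal (Real.exp (jnExponent N K * |f x - ⨍ z in ball y s, f z|)) ≤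
        4 * volume (ball y s) := by
  have hM0 : 0 ≤ M := (abs_nonneg _).trans (hM 0)
  have hε0 := jnExponent_pos N hK
  set S : Set ℝ≥0∞ := {X | ∀ y s, 0 < s → dist y x₀ + 2 * s ≤ ρ → ∫⁻ x in ball y s,
      ENNReal.ofReal (Real.exp (jnExponent N K * |f x - ⨍ z in ball y s, f z|)) ≤
        X * volume (ball y s)} with hS
  -- Boundedness of `f` enters only here: it provides some finite bound, without which `X ≤ 2 + X /
  -- 2` could not be solved.
  have hbase : ENNReal.ofReal (Real.exp (jnExponent N K * (2 * M))) ∈ S := by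
    intro y s hs hy
    rw [← setLIntegral_const]
    refine lintegral_mono fun x => ENNReal.ofReal_le_ofReal (Real.exp_le_exp.2 ?_)
    gcongr
    have h1 : |⨍ z in ball y s, f z| ≤ M := by
      have := abs_average_sub_le (y := y) hf hM hs 0 hM0 (L := M) (by
        rw [← setLIntegral_const]
        refine lintegral_mono fun x => ENNReal.ofReal_le_ofReal ?_
        rw [sub_zero]; exact hM x)
      rwa [sub_zero] at this
    calc |f x - ⨍ z in ball y s, f z| ≤ |f x| + |⨍ z in ball y s, f z| := abs_sub _ _
      _ ≤ 2 * M := by linarith [hM x]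
  set X := sInf S with hXdef
  -- The defining inequalities are closed, so the optimal bound is itself a bound and the
  -- improvement step applies to it.
  have hXS : X ∈ S := by
    intro y s hs hy
    have hV0 := (volume_ball_pos y hs).ne'
    have hVt := (volume_ball_lt_top y s).ne
    rw [← ENNReal.div_le_iff hV0 hVt]
    exact le_sInf fun X' hX' => (ENNReal.div_le_iff hV0 hVt).2 (hX' y s hs hy)
  have hstep : 2 + X / 2 ∈ S := fun y s hs hy => h.lintegral_exp_step hK hf hM hXS hs hy
  have hXtop : X ≠ ∞ := ((sInf_le hbase).trans_lt ENNReal.ofReal_lt_top).ne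
  have hX4 : X ≤ 4 := by
    have h1 : X ≤ 2 + X / 2 := sInf_le hstep
    have h2 := ENNReal.toReal_mono (by simp [hXtop, ENNReal.div_eq_top]) h1
    rw [ENNReal.toReal_add (by simp) (by simp [hXtop, ENNReal.div_eq_top]),
      ENNReal.toReal_div] at h2
    simp only [ENNReal.toReal_ofNat] at h2
    rw [← ENNReal.ofReal_toReal hXtop, ← ENNReal.ofReal_ofNat 4]
    exact ENNReal.ofReal_le_ofReal (by linarith)
  exact (hXS y s hs hy).trans (by gcongr)

/-! ### The weak Harnack estimate in the reduced setting. -/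

/-- Bound for the mean oscillation of the logarithm. -/
noncomputable def bmoConst (N : ℕ) (α C₁ C₂ : ℝ) : ℝ :=
  1 + 2 * C₁ * (jumpConst α C₂ + 64) * 2 ^ N

theorem one_le_bmoConst (N : ℕ) {α C₁ C₂ : ℝ} (hα : α < 2) (hC₁ : 1 ≤ C₁) (hC₂ : 1 ≤ C₂) :
    1 ≤ bmoConst N α C₁ C₂ := by
  have := jumpConst_pos hα hC₂
  have : 0 ≤ 2 * C₁ * (jumpConst α C₂ + 64) * 2 ^ N := by positivity
  unfold bmoConst
  linarith

theorem jnExponent_lt_one (N : ℕ) {K : ℝ} (hK : 1 ≤ K) : jnExponent N K < 1 := by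
  have hL := jnLevel_pos N (one_pos.trans_le hK)
  rw [jnExponent, div_lt_one hL]
  have h1 : Real.log 2 < 1 := by linarith [Real.log_two_lt_d9]
  refine h1.trans_le ?_
  have h6 : (1 : ℝ) ≤ 6 ^ N := one_le_pow₀ (by norm_num)
  have h2 : (1 : ℝ) ≤ 2 ^ N := one_le_pow₀ (by norm_num)
  calc (1 : ℝ) ≤ 4 * 1 * (1 * (1 + 0) * 1) := by norm_num
    _ ≤ jnLevel N K := by unfold jnLevel; gcongr; positivity

namespace JumpSetting

variable {N : ℕ} {α C₁ C₂ : ℝ} {κ : Kernel (Eucl N) (Eucl N)} {u : Eucl N → ℝ}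
  {x₀ : Eucl N} {R r d : ℝ}

theorem measurable_truncLog (S : JumpSetting α C₁ C₂ κ u x₀ R r d) (n : ℕ) :
    Measurable fun x => min (Real.log (max (u x + d) d)) n :=
  ((S.measurable.add_const d).max measurable_const).log.min measurable_const

theorem abs_truncLog_le (S : JumpSetting α C₁ C₂ κ u x₀ R r d) (n : ℕ) (x : Eucl N) :
    |min (Real.log (max (u x + d) d)) n| ≤ |Real.log d| + n := by
  have h1 : Real.log d ≤ Real.log (max (u x + d) d) :=
    Real.log_le_log S.d_pos (le_max_right _ _)
  have h2 := neg_abs_le (Real.log d)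
  have h3 := abs_nonneg (Real.log d)
  have h4 : (0 : ℝ) ≤ n := Nat.cast_nonneg n
  rw [abs_le]
  exact ⟨by rw [neg_add]; exact le_min (by linarith) (by linarith),
    (min_le_right _ _).trans (by linarith)⟩

theorem hasBMO_truncLog (S : JumpSetting α C₁ C₂ κ u x₀ R r d) (n : ℕ) :
    HasBMO (fun x => min (Real.log (max (u x + d) d)) n) x₀ (8 * r) (bmoConst N α C₁ C₂) := by
  intro y s hs hy
  have hJ := jumpConst_pos S.alpha_lt S.one_le_C₂
  have hC := S.one_le_C₁
  have hsr : s ≤ 8 * r := by linarith [dist_nonneg (x := y) (y := x₀)]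
  have hB : ball y (2 * s) ⊆ ball x₀ (R / 2) :=
    ball_subset_ball' (by linarith [S.r_lt, dist_nonneg (x := y) (y := x₀)])
  have hosc := S.oscillation_log_le n hs hsr hB
  set f : Eucl N → ℝ := fun x => min (Real.log (max (u x + d) d)) n
  set a := ⨍ z in ball y s, f z
  calc ∫⁻ x in ball y s, ENNReal.ofReal |f x - a|
      ≤ ∫⁻ x in ball y s, (1 + ENNReal.ofReal ((f x - a) ^ 2)) := by
        refine lintegral_mono fun x => ?_
        rw [← ENNReal.ofReal_one, ← ENNReal.ofReal_add zero_le_one (sq_nonneg _)]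
        apply ENNReal.ofReal_le_ofReal
        rw [← sq_abs (f x - a)]
        nlinarith [sq_nonneg (|f x - a| - 1), abs_nonneg (f x - a)]
    _ = volume (ball y s) + ∫⁻ x in ball y s, ENNReal.ofReal ((f x - a) ^ 2) := by
        rw [lintegral_add_left measurable_const, setLIntegral_const, one_mul]
    _ ≤ volume (ball y s) + ENNReal.ofReal (2 * C₁ * (jumpConst α C₂ + 64)) *
        volume (ball y (2 * s)) := by gcongr
    _ = _ := by
        rw [volume_ball_mul y y two_pos, ← mul_assoc, ← ENNReal.ofReal_mul (by positivity),
          bmoConst, ENNReal.ofReal_add zero_le_one (by positivity), ENNReal.ofReal_one, add_mul,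
          one_mul]

/-- The weak Harnack estimate for the truncated function. -/
theorem exists_lower_bound (S : JumpSetting α C₁ C₂ κ u x₀ R r d) {θ : ℝ} (hθ : 0 < θ)
    (hcrit : ∀ k, d ≤ k →
      4 * volume {x ∈ ball x₀ (4 * r) | u x + d < k} ≤ volume (ball x₀ (θ * r)) →
      ∀ᵐ x, x ∈ ball x₀ (2 * r) → k / 2 ≤ u x + d)
    {ε t η : ℝ} (hε : ε = jnExponent N (bmoConst N α C₁ C₂))
    (ht : t = Real.log (16 * (4 / θ) ^ N) / ε)
    (hη : η = Real.exp (-t) / 2 * (4 ^ (N + 1)) ^ (-(1 / ε))) (n : ℕ) :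
    ∃ m : ℝ, 0 < m ∧ (∀ᵐ x, x ∈ ball x₀ (2 * r) → m ≤ u x + d) ∧
      ∫⁻ x in ball x₀ r, ENNReal.ofReal
        (Real.exp (ε * min (Real.log (max (u x + d) d)) n)) ≤
        ENNReal.ofReal ((m / η) ^ ε) * volume (ball x₀ r) := by
  have hr := S.r_pos
  have hd := S.d_pos
  have hK := one_le_bmoConst N S.alpha_lt S.one_le_C₁ S.one_le_C₂
  have hε0 : 0 < ε := hε ▸ jnExponent_pos N (one_pos.trans_le hK)
  have hη0 : 0 < η := by rw [hη]; positivity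
  have hfm := S.measurable_truncLog n
  have hJN := (S.hasBMO_truncLog n).lintegral_exp_le (one_pos.trans_le hK) hfm
    (S.abs_truncLog_le n) (y := x₀) (s := 4 * r) (by positivity) (by rw [dist_self]; linarith)
  rw [← hε] at hJN
  set f : Eucl N → ℝ := fun x => min (Real.log (max (u x + d) d)) n with hf
  set a := ⨍ z in ball x₀ (4 * r), f z with ha
  set k : ℝ := Real.exp (a - t) with hk
  have hk0 : 0 < k := Real.exp_pos _
  -- The number `t` is chosen so that Chebyshev's inequality gives the critical density: the
  -- John-Nirenberg constant 4 and the 4 in front of the sublevel volume make 16, and `(4 / θ) ^ N`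
  -- compares the balls of radii `4 * r` and `θ * r`.
  have hexpt : Real.exp (ε * t) = 16 * (4 / θ) ^ N := by
    rw [ht, mul_div_cancel₀ _ hε0.ne', Real.exp_log (by positivity)]
  have hnonneg : ∀ x ∈ ball x₀ (4 * r), 0 ≤ u x := fun x hx =>
    S.nonneg x (ball_subset_ball (by linarith [S.r_lt]) hx)
  have hem : Measurable fun x => ENNReal.ofReal (Real.exp (ε * |f x - a|)) :=
    ((continuous_abs.measurable.comp (hfm.sub_const a)).const_mul ε).exp.ennreal_ofReal
  have hdens : 4 * volume {x ∈ ball x₀ (4 * r) | u x + d < k} ≤ volume (ball x₀ (θ * r)) := by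
    set A := {x ∈ ball x₀ (4 * r) | u x + d < k} with hA
    have hAm : MeasurableSet A :=
      measurableSet_ball.inter (measurableSet_lt (S.measurable.add_const d) measurable_const)
    have h1 : ENNReal.ofReal (Real.exp (ε * t)) * volume A ≤ 4 * volume (ball x₀ (4 * r)) := by
      refine le_trans ?_ hJN
      rw [← setLIntegral_const]
      refine le_trans (setLIntegral_mono' (g := fun x =>
        ENNReal.ofReal (Real.exp (ε * |f x - a|))) hAm fun x hx => ?_)
        (lintegral_mono_set (sep_subset _ _))
      apply ENNReal.ofReal_le_ofReal
      apply Real.exp_le_exp.2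
      gcongr
      have hx0 := hnonneg x hx.1
      have h2 : f x ≤ a - t := by
        refine (min_le_left _ _).trans ?_
        rw [max_eq_left (by linarith), Real.log_le_iff_le_exp (by linarith)]
        exact hx.2.le
      have h3 := neg_abs_le (f x - a)
      linarith
    have h4 : volume (ball x₀ (4 * r)) =
        ENNReal.ofReal ((4 / θ) ^ N) * volume (ball x₀ (θ * r)) := by
      rw [← volume_ball_mul x₀ x₀ (by positivity)]
      congr 2; field_simp
    rw [hexpt, h4, ENNReal.ofReal_mul (by norm_num), ENNReal.ofReal_ofNat] at h1
    have hpos : ENNReal.ofReal ((4 / θ) ^ N) ≠ 0 := by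
      simp only [ne_eq, ENNReal.ofReal_eq_zero, not_le]; positivity
    have h5 : ENNReal.ofReal ((4 / θ) ^ N) * (4 * (4 * volume A)) ≤
        ENNReal.ofReal ((4 / θ) ^ N) * (4 * volume (ball x₀ (θ * r))) := by
      calc _ = 16 * ENNReal.ofReal ((4 / θ) ^ N) * volume A := by ring
        _ ≤ _ := h1
        _ = _ := by ring
    rw [ENNReal.mul_le_mul_iff_right hpos ENNReal.ofReal_ne_top,
      ENNReal.mul_le_mul_iff_right (by norm_num) (by norm_num)] at h5
    exact h5
  refine ⟨k / 2, by positivity, ?_, ?_⟩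
  -- Levels below `d` are outside the scope of the critical density statement, but then the bound is
  -- trivial since `u ≥ 0`.
  · rcases le_or_gt d k with h | h
    · exact hcrit k h hdens
    · refine Filter.Eventually.of_forall fun x hx => ?_
      have := hnonneg x (ball_subset_ball (by linarith) hx)
      linarith
  -- With this `η` the loss `e ^ (-t) / 2` cancels; the factor `4 ^ (N + 1)` is the John-Nirenberg
  -- constant 4 times the volume ratio `4 ^ N` of the balls of radii `4 * r` and `r`.
  · have hconst : (k / 2 / η) ^ ε = Real.exp (ε * a) * 4 ^ (N + 1) := by
      have h1 : k / 2 / η = Real.exp a * (4 ^ (N + 1)) ^ (1 / ε) := by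
        rw [hη, hk, sub_eq_add_neg, Real.exp_add, Real.rpow_neg (by positivity)]
        field_simp
      rw [h1, Real.mul_rpow (by positivity) (by positivity), ← Real.exp_mul, mul_comm a,
        ← Real.rpow_mul (by positivity), one_div_mul_cancel hε0.ne', Real.rpow_one]
    calc ∫⁻ x in ball x₀ r, ENNReal.ofReal (Real.exp (ε * f x))
        ≤ ∫⁻ x in ball x₀ (4 * r), ENNReal.ofReal (Real.exp (ε * f x)) :=
          lintegral_mono_set (ball_subset_ball (by linarith))
      _ ≤ ∫⁻ x in ball x₀ (4 * r), ENNReal.ofReal (Real.exp (ε * a)) *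
          ENNReal.ofReal (Real.exp (ε * |f x - a|)) := by
          refine lintegral_mono fun x => ?_
          rw [← ENNReal.ofReal_mul (by positivity), ← Real.exp_add, ← mul_add]
          apply ENNReal.ofReal_le_ofReal
          apply Real.exp_le_exp.2
          gcongr
          linarith [le_abs_self (f x - a)]
      _ = ENNReal.ofReal (Real.exp (ε * a)) *
          ∫⁻ x in ball x₀ (4 * r), ENNReal.ofReal (Real.exp (ε * |f x - a|)) :=
          lintegral_const_mul _ hem
      _ ≤ ENNReal.ofReal (Real.exp (ε * a)) * (4 * volume (ball x₀ (4 * r))) := by gcongr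
      _ = _ := by
          rw [hconst, volume_ball_mul x₀ x₀ (by norm_num), ENNReal.ofReal_mul (by positivity),
            pow_succ, ENNReal.ofReal_mul (by positivity), ENNReal.ofReal_ofNat]
          ring

end JumpSetting

/-- It remains to remove the truncation of the logarithm. The lower bounds `m n` depend on `n`
through the mean of the truncated logarithm, but all lie below `u + d` at a single point, so their
supremum is finite and serves for all `n`; monotone convergence gives the integral bound. -/
theorem exists_weak_harnack {N : ℕ} (hN : N ≠ 0) {α C₁ C₂ : ℝ} (hα : 0 < α) (hα2 : α < 2)
    (hC₁ : 1 ≤ C₁) (hC₂ : 1 ≤ C₂) :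
    ∃ ε ∈ Ioo (0 : ℝ) 1, ∃ η ∈ Ioo (0 : ℝ) 1, ∀ (κ : Kernel (Eucl N) (Eucl N)) (u : Eucl N → ℝ)
      (x₀ : Eucl N) (R r d : ℝ), JumpSetting α C₁ C₂ κ u x₀ R r d →
      ∃ m : ℝ, 0 < m ∧ (∀ᵐ x, x ∈ ball x₀ (2 * r) → m ≤ u x + d) ∧
        ∫⁻ x in ball x₀ r, ENNReal.ofReal (u x ^ ε) ≤
          ENNReal.ofReal ((m / η) ^ ε) * volume (ball x₀ r) := by
  obtain ⟨θ, hθ, hθ4, hcrit⟩ := exists_critical_density hN hα hα2 hC₁ hC₂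
  have hK := one_le_bmoConst N hα2 hC₁ hC₂
  set ε : ℝ := jnExponent N (bmoConst N α C₁ C₂) with hε
  have hε0 : 0 < ε := jnExponent_pos N (one_pos.trans_le hK)
  set t : ℝ := Real.log (16 * (4 / θ) ^ N) / ε with ht
  set η : ℝ := Real.exp (-t) / 2 * (4 ^ (N + 1)) ^ (-(1 / ε)) with hη
  have hη0 : 0 < η := by positivity
  have ht0 : 0 ≤ t := by
    have h1 : 1 ≤ 4 / θ := by rw [le_div_iff₀ hθ]; linarith
    have h2 : 1 ≤ (4 / θ) ^ N := one_le_pow₀ h1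
    exact div_nonneg (Real.log_nonneg (by linarith)) hε0.le
  have hη1 : η < 1 := by
    have h1 : Real.exp (-t) ≤ 1 := Real.exp_le_one_iff.2 (by linarith)
    have h2 : ((4 : ℝ) ^ (N + 1)) ^ (-(1 / ε)) ≤ 1 :=
      Real.rpow_le_one_of_one_le_of_nonpos (one_le_pow₀ (by norm_num)) (by
        have : 0 < 1 / ε := by positivity
        linarith)
    calc η ≤ 1 / 2 * 1 := by rw [hη]; gcongr
      _ < 1 := by norm_num
  refine ⟨ε, ⟨hε0, jnExponent_lt_one N hK⟩, η, ⟨hη0, hη1⟩, ?_⟩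
  intro κ u x₀ R r d S
  have hr := S.r_pos
  have hd := S.d_pos
  choose m hm0 hmle hmint using
    S.exists_lower_bound hθ (hcrit κ u x₀ R r d S) hε ht hη
  have hall : ∀ᵐ x, x ∈ ball x₀ (2 * r) → ∀ n, m n ≤ u x + d := by
    filter_upwards [ae_all_iff.2 hmle] with x hx hxB n using hx n hxB
  obtain ⟨x₁, hx₁B, hx₁⟩ : ∃ x ∈ ball x₀ (2 * r), ∀ n, m n ≤ u x + d := by
    by_contra hcon
    push Not at hcon
    have h0 : volume (ball x₀ (2 * r)) = 0 := by
      rw [measure_eq_zero_iff_ae_notMem]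
      filter_upwards [hall] with x hx hxB
      obtain ⟨n, hn⟩ := hcon x hxB
      exact absurd (hx hxB n) (not_le.2 hn)
    exact (volume_ball_pos x₀ (by positivity)).ne' h0
  have hbdd : BddAbove (range m) := ⟨u x₁ + d, by rintro _ ⟨n, rfl⟩; exact hx₁ n⟩
  refine ⟨⨆ n, m n, (hm0 0).trans_le (le_ciSup hbdd 0), ?_, ?_⟩
  · filter_upwards [hall] with x hx hxB using ciSup_le (hx hxB)
  · have hmeas : ∀ n : ℕ, Measurable fun x =>
        ENNReal.ofReal (Real.exp (ε * min (Real.log (max (u x + d) d)) n)) := fun n =>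
      ((S.measurable_truncLog n).const_mul ε).exp.ennreal_ofReal
    have hmono : Monotone fun (n : ℕ) (x : Eucl N) =>
        ENNReal.ofReal (Real.exp (ε * min (Real.log (max (u x + d) d)) n)) := by
      intro i j hij x
      apply ENNReal.ofReal_le_ofReal
      apply Real.exp_le_exp.2
      gcongr
    calc ∫⁻ x in ball x₀ r, ENNReal.ofReal (u x ^ ε)
        ≤ ∫⁻ x in ball x₀ r, ⨆ n : ℕ,
          ENNReal.ofReal (Real.exp (ε * min (Real.log (max (u x + d) d)) n)) := by
          refine setLIntegral_mono' measurableSet_ball fun x hx => ?_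
          have hx0 : 0 ≤ u x := S.nonneg x (ball_subset_ball (by linarith [S.r_lt]) hx)
          have hw : 0 < u x + d := by linarith
          obtain ⟨n, hn⟩ := exists_nat_ge (Real.log (u x + d))
          refine le_trans ?_ (le_iSup _ n)
          apply ENNReal.ofReal_le_ofReal
          rw [max_eq_left (by linarith), min_eq_left hn, mul_comm, ← Real.rpow_def_of_pos hw]
          exact Real.rpow_le_rpow hx0 (by linarith) hε0.le
      _ = ⨆ n : ℕ, ∫⁻ x in ball x₀ r,
          ENNReal.ofReal (Real.exp (ε * min (Real.log (max (u x + d) d)) n)) :=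
          lintegral_iSup hmeas hmono
      _ ≤ _ := by
          refine iSup_le fun n => (hmint n).trans ?_
          have := hm0 n
          have := le_ciSup hbdd n
          gcongr

/-! ### From the original hypotheses to the reduced setting. -/

section Bridge

variable {N : ℕ} {μ : Eucl N → Measure (Eucl N)} {κ : Kernel (Eucl N) (Eucl N)}

/-- Functions that agree Lebesgue almost everywhere agree almost everywhere for almost every
measure of the kernel. -/
theorem ae_ae_eq_of_ae_eq [IsSFiniteKernel κ]
    (hsymm : (pairMeasure κ).map Prod.swap = pairMeasure κ) {u v : Eucl N → ℝ} (h : u =ᵐ[volume] v) :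
    ∀ᵐ x, u =ᵐ[κ x] v := by
  obtain ⟨Z, hZsub, hZm, hZ0⟩ := exists_measurable_superset_of_null (ae_iff.1 h)
  -- The set `Z ×ˢ univ` is null because the first marginal is governed by Lebesgue measure;
  -- invariance under exchange transfers this to the second variable.
  have h1 : pairMeasure κ (univ ×ˢ Z) = 0 := by
    rw [← hsymm, Measure.map_apply measurable_swap (MeasurableSet.univ.prod hZm),
      preimage_swap_prod, Measure.compProd_apply_prod hZm MeasurableSet.univ,
      Measure.restrict_eq_zero.2 hZ0, lintegral_zero_measure]
  rw [Measure.compProd_apply_prod MeasurableSet.univ hZm, Measure.restrict_univ,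
    lintegral_eq_zero_iff (Kernel.measurable_coe κ hZm)] at h1
  filter_upwards [h1] with x hx
  exact measure_mono_null hZsub hx

/-- Squared differences vanish at the base point, so removing a possible atom of `μ x` at `x` leaves
the energy unchanged. -/
theorem setLIntegral_compl_singleton {f : Eucl N → ℝ≥0∞} {x : Eucl N} (hf : f x = 0)
    (ν : Measure (Eucl N)) {D : Set (Eucl N)} (hD : MeasurableSet D) :
    ∫⁻ y in D, f y ∂(ν.restrict {x}ᶜ) = ∫⁻ y in D, f y ∂ν := by
  have hx : MeasurableSet ({x} : Set (Eucl N)) := measurableSet_singleton x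
  rw [Measure.restrict_restrict hD, ← lintegral_inter_add_sdiff f D hx.compl]
  have : ∫⁻ y in D \ {x}ᶜ, f y ∂ν = 0 := by
    refine setLIntegral_eq_zero (hD.diff hx.compl) fun y hy => ?_
    have : y = x := by simpa using hy.2
    simp [this, hf]
  rw [this, add_zero]

theorem energy_eq [IsSFiniteKernel κ]
    (hκ : ∀ᵐ x, κ x = (μ x).restrict {x}ᶜ)
    (hsymm : (pairMeasure κ).map Prod.swap = pairMeasure κ) {u v : Eucl N → ℝ}
    (huv : u =ᵐ[volume] v) (hv : Measurable v) {D : Set (Eucl N)} (hD : MeasurableSet D) :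
    energy μ D u = ∫⁻ p in D ×ˢ D, ENNReal.ofReal ((v p.2 - v p.1) ^ 2) ∂(pairMeasure κ) := by
  have hm : Measurable fun p : Eucl N × Eucl N => ENNReal.ofReal ((v p.2 - v p.1) ^ 2) :=
    (((hv.comp measurable_snd).sub (hv.comp measurable_fst)).pow_const 2).ennreal_ofReal
  rw [pairMeasure, Measure.setLIntegral_compProd hm hD hD, energy]
  refine lintegral_congr_ae (ae_restrict_of_ae ?_)
  filter_upwards [hκ, huv, ae_ae_eq_of_ae_eq hsymm huv] with x hx hxu hxv
  rw [← setLIntegral_compl_singleton (x := x) (f := fun y => ENNReal.ofReal ((u y - u x) ^ 2)) (by simp)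
    (μ x) hD, ← hx]
  refine lintegral_congr_ae (ae_restrict_of_ae ?_)
  filter_upwards [hxv] with y hy
  rw [hy, hxu]

/-- Integrability is essential: only then does Fubini identify the iterated Bochner integral with
the pair integral. -/
theorem form_eq [IsSFiniteKernel κ]
    (hκ : ∀ᵐ x, κ x = (μ x).restrict {x}ᶜ)
    (hsymm : (pairMeasure κ).map Prod.swap = pairMeasure κ) {u v : Eucl N → ℝ}
    (huv : u =ᵐ[volume] v) (φ : Eucl N → ℝ)
    (hi : Integrable (fun p : Eucl N × Eucl N => (v p.2 - v p.1) * (φ p.2 - φ p.1))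
      (pairMeasure κ)) :
    form μ u φ = ∫ p, (v p.2 - v p.1) * (φ p.2 - φ p.1) ∂(pairMeasure κ) := by
  rw [pairMeasure, Measure.integral_compProd hi, form]
  refine integral_congr_ae ?_
  filter_upwards [hκ, huv, ae_ae_eq_of_ae_eq hsymm huv] with x hx hxu hxv
  rw [← setIntegral_eq_integral_of_forall_compl_eq_zero (s := {x}ᶜ) (fun y hy => ?_), ← hx]
  · refine integral_congr_ae ?_
    filter_upwards [hxv] with y hy
    rw [hy, hxu]
  · have : y = x := by simpa using hy
    simp [this]

theorem tail_le {f g : Eucl N → ℝ≥0∞} {x : Eucl N} (hx : κ x = (μ x).restrict {x}ᶜ)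
    (hfg : f =ᵐ[κ x] g) {D : Set (Eucl N)} : ∫⁻ y in D, f y ∂(κ x) ≤ ∫⁻ y in D, g y ∂(μ x) := by
  rw [lintegral_congr_ae (ae_restrict_of_ae hfg), hx]
  exact lintegral_mono' (Measure.restrict_mono_measure Measure.restrict_le_self D) le_rfl

/-- The Poincaré inequality is assumed only for functions of the local space; this allows it to be
applied to Lipschitz functions of the super-solution. -/
theorem MemHLoc.comp_lipschitz {E : Set (Eucl N)} {u : Eucl N → ℝ} (hu : MemHLoc μ E u)
    {H : ℝ → ℝ} {L : ℝ} (hH : ∀ t t', |H t - H t'| ≤ L * |t - t'|) :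
    MemHLoc μ E fun x => H (u x) := by
  have hL : 0 ≤ L := by simpa using (abs_nonneg _).trans (hH 0 1)
  have hHc : Continuous H := by
    refine (LipschitzWith.of_dist_le_mul (K := L.toNNReal) fun x y => ?_).continuous
    rw [Real.coe_toNNReal L hL, Real.dist_eq, Real.dist_eq]
    exact hH x y
  refine ⟨hHc.measurable.comp_aemeasurable hu.1, fun D hD hDE => ?_⟩
  have hle : energy μ D (fun x => H (u x)) ≤ ENNReal.ofReal (L ^ 2) * energy μ D u := by
    unfold energy
    rw [← lintegral_const_mul' _ _ ENNReal.ofReal_ne_top]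
    refine lintegral_mono fun x => ?_
    rw [← lintegral_const_mul' _ _ ENNReal.ofReal_ne_top]
    refine lintegral_mono fun y => ?_
    rw [← ENNReal.ofReal_mul (sq_nonneg L), ← mul_pow, ← sq_abs, ← sq_abs (L * _), abs_mul,
      abs_of_nonneg hL]
    exact ENNReal.ofReal_le_ofReal (pow_le_pow_left₀ (abs_nonneg _) (hH _ _) 2)
  exact hle.trans_lt (ENNReal.mul_lt_top ENNReal.ofReal_lt_top (hu.2 D hD hDE))

/-- The hypotheses of the weak Harnack estimate produce a `JumpSetting`. -/
theorem exists_jumpSetting {α C₁ C₂ : ℝ} (hα : 0 < α) (hα2 : α < 2) (hC₁ : 1 ≤ C₁) (hC₂ : 1 ≤ C₂)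
    {E : Set (Eucl N)} (hμ : SymmetricFamily μ) (hP : PoincareInequality μ E α C₁)
    (hdec : DecayBound μ α C₂) {u : Eucl N → ℝ} (hu : IsLocalWeakSupersolution μ E u)
    {x₀ : Eucl N} {R : ℝ} (hRE : ball x₀ R ⊆ E)
    (hu0 : ∀ᵐ x ∂(volume.restrict (ball x₀ R)), 0 ≤ u x) {r : ℝ} (hr : 0 < r) (hrR : r < R / 32) :
    ∃ (κ : Kernel (Eucl N) (Eucl N)) (v : Eucl N → ℝ), u =ᵐ[volume] v ∧
      ∀ d, 0 < d → (r / R) ^ α * (nonlocalTail μ α (negPart u) x₀ (7 / 8 * R) R).toReal < d →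
        JumpSetting α C₁ C₂ κ v x₀ R r d := by
  classical
  have hR : 0 < R := by linarith
  have hfin : ∀ r : ℝ, 0 < r → ∃ K : ℝ≥0∞, K < ∞ ∧ ∀ x, μ x (ball x r)ᶜ ≤ K := fun r hr =>
    ⟨_, ENNReal.ofReal_lt_top, fun x => hdec x r hr⟩
  obtain ⟨κ, hsf, hκ⟩ := exists_kernel μ hμ.1 hfin
  have hsymm : (pairMeasure κ).map Prod.swap = pairMeasure κ := map_swap_compProd hμ hfin hκ
  set v₀ := hu.memHLoc.1.mk u with hv₀
  have hv₀m : Measurable v₀ := hu.memHLoc.1.measurable_mk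
  -- A Borel representative, corrected on a null set so as to be non-negative everywhere in the
  -- ball.
  set v : Eucl N → ℝ := (ball x₀ R).piecewise (fun x => max (v₀ x) 0) v₀ with hv
  have hvm : Measurable v :=
    (hv₀m.max measurable_const).piecewise measurableSet_ball hv₀m
  have huv : u =ᵐ[volume] v := by
    filter_upwards [hu.memHLoc.1.ae_eq_mk, (ae_restrict_iff' measurableSet_ball).1 hu0]
      with x hx' hx0
    have hx : u x = v₀ x := hx'
    by_cases hxB : x ∈ ball x₀ R
    · rw [hv, piecewise_eq_of_mem _ _ _ hxB, ← hx, max_eq_left (hx0 hxB)]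
    · rw [hv, piecewise_eq_of_notMem _ _ _ hxB, ← hx]
  refine ⟨κ, v, huv, fun d hd hdτ => ?_⟩
  have hκv := ae_ae_eq_of_ae_eq hsymm huv
  have hsub34 : closure (ball x₀ (3 / 4 * R)) ⊆ E :=
    (closure_ball_subset_closedBall.trans (closedBall_subset_ball (by linarith))).trans hRE
  refine ⟨hα, hα2, hC₁, hC₂, hr, by linarith, hd, hsf, hsymm, ?_, hvm, ?_, ?_, ?_, ?_, ?_, ?_⟩
  · filter_upwards [hκ] with x hx ρ hρ
    rw [hx]
    exact (Measure.restrict_le_self _).trans (hdec x ρ hρ)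
  · intro x hx
    rw [hv, piecewise_eq_of_mem _ _ _ hx]; exact le_max_right _ _
  · rw [← energy_eq hκ hsymm huv hvm measurableSet_ball]
    exact hu.memHLoc.2 _ isOpen_ball hsub34
  · refine ⟨_, hu.tail_lt_top x₀ (3 / 4 * R) (by positivity)
      ((ball_subset_ball (by linarith)).trans hRE), ?_⟩
    filter_upwards [hκ, hκv] with x hx hxv hxB
    -- The tail assumption is used on the ball of radius `3 / 4 * R`, and `7 / 8 * 3 / 4 = 21 / 32`
    -- exceeds `1 / 2`.
    have hxB' : x ∈ ball x₀ (7 / 8 * (3 / 4 * R)) := ball_subset_ball (by linarith) hxB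
    refine le_trans (tail_le (g := fun y => ENNReal.ofReal |u y|) hx ?_)
      (le_iSup₂ (f := fun x _ => ∫⁻ y in (ball x₀ (3 / 4 * R))ᶜ, ENNReal.ofReal |u y| ∂(μ x)) x hxB')
    filter_upwards [hxv] with y hy
    rw [hy]
  · set T := ⨆ x ∈ ball x₀ (7 / 8 * R), ∫⁻ y in (ball x₀ R)ᶜ, negPart u y ∂(μ x) with hT
    -- Finiteness matters: the real value of an infinite tail would be zero and the hypothesis on
    -- `d` would carry no information.
    have hTtop : T < ∞ := by
      refine lt_of_le_of_lt (iSup₂_mono fun x _ => ?_) (hu.tail_lt_top x₀ R hR hRE)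
      refine lintegral_mono fun y => ENNReal.ofReal_le_ofReal ?_
      exact max_le (neg_le_abs _) (abs_nonneg _)
    have hTd : T ≤ ENNReal.ofReal (d / r ^ α) := by
      rw [nonlocalTail, ← hT, ENNReal.toReal_mul, ENNReal.toReal_ofReal (by positivity),
        Real.div_rpow hr.le hR.le, ← mul_assoc, div_mul_cancel₀ _ (by positivity)] at hdτ
      rw [← ENNReal.ofReal_toReal hTtop.ne]
      apply ENNReal.ofReal_le_ofReal
      rw [le_div_iff₀ (by positivity), mul_comm]
      exact hdτ.le
    filter_upwards [hκ, hκv] with x hx hxv hxB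
    have hxB' : x ∈ ball x₀ (7 / 8 * R) := ball_subset_ball (by linarith) hxB
    refine le_trans (tail_le (g := negPart u) hx ?_) ((le_iSup₂ (f := fun x _ =>
      ∫⁻ y in (ball x₀ R)ᶜ, negPart u y ∂(μ x)) x hxB').trans hTd)
    filter_upwards [hxv] with y hy
    rw [negPart, hy]
    rcases le_total (-v y) 0 with h | h
    · rw [max_eq_right h, ENNReal.ofReal_of_nonpos h, ENNReal.ofReal_zero]
    · rw [max_eq_left h]
  · intro φ hφm hφ0 hφ2 hφe hφs hi
    rw [← form_eq hκ hsymm huv φ hi]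
    refine hu.form_nonneg φ ⟨hφ2, ?_⟩ hφ0 ?_
    · rw [energy_eq hκ hsymm (Filter.EventuallyEq.refl _ φ) hφm MeasurableSet.univ, univ_prod_univ,
        Measure.restrict_univ]
      exact hφe
    · have hsupp : tsupport φ ⊆ closedBall x₀ (R / 2) := by
        refine closure_minimal (fun x hx => ?_) isClosed_closedBall
        by_contra hcon
        exact hx (hφs x fun h => hcon (ball_subset_closedBall h))
      exact (hsupp.trans (closedBall_subset_ball (by linarith))).trans hRE
  · intro H K L hHK hHL y s hs hys
    have hHloc := hu.memHLoc.comp_lipschitz hHL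
    have hHm : Measurable fun x => H (v x) := by
      have hL : 0 ≤ L := by simpa using (abs_nonneg _).trans (hHL 0 1)
      have hHc : Continuous H := by
        refine (LipschitzWith.of_dist_le_mul (K := L.toNNReal) fun x y => ?_).continuous
        rw [Real.coe_toNNReal L hL, Real.dist_eq, Real.dist_eq]
        exact hHL x y
      exact hHc.measurable.comp hvm
    have hHuv : (fun x => H (u x)) =ᵐ[volume] fun x => H (v x) := by
      filter_upwards [huv] with x hx
      rw [hx]
    have hint : IntegrableOn (fun x => H (u x)) (ball y s) volume :=
      Measure.integrableOn_of_bounded measure_ball_lt_top.ne hHloc.1.aestronglyMeasurable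
        (Filter.Eventually.of_forall fun x => hHK _)
    have hav : ⨍ z in ball y s, H (u z) = ⨍ z in ball y s, H (v z) := by
      rw [setAverage_eq, setAverage_eq, integral_congr_ae (ae_restrict_of_ae hHuv)]
    have h := hP y s hs (hys.trans hRE) (fun x => H (u x)) hHloc hint
    rw [energy_eq hκ hsymm hHuv hHm measurableSet_ball, hav] at h
    refine le_trans (le_of_eq (lintegral_congr_ae (ae_restrict_of_ae ?_))) h
    filter_upwards [huv] with x hx
    rw [hx]

end Bridge

/-! ### Conclusion. -/

/-- In the conditionally complete order of `ℝ` an a.e. lower bound passes to the essential infimum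
only if the set of such bounds is bounded above. A finite-valued function on a non-null space
satisfies `f ≤ n` on a non-null set for some `n`, which supplies this. -/
theorem le_essInf_of_ae_le_real {X : Type*} [MeasurableSpace X] {m : Measure X} (hm : m ≠ 0)
    {f : X → ℝ} {c : ℝ} (h : ∀ᵐ x ∂m, c ≤ f x) : c ≤ essInf f m := by
  have : (ae m).NeBot := ae_neBot.2 hm
  obtain ⟨n, hn⟩ : ∃ n : ℕ, ∃ᶠ x in ae m, f x ≤ n := by
    by_contra hcon
    push Not at hcon
    have h1 : ∀ᵐ x ∂m, ∀ n : ℕ, (n : ℝ) < f x := ae_all_iff.2 hcon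
    obtain ⟨x, hx⟩ := h1.exists
    obtain ⟨n, hn⟩ := exists_nat_ge (f x)
    exact absurd (hx n) (not_lt.2 hn)
  exact Filter.le_liminf_of_le (Filter.IsCoboundedUnder.of_frequently_le hn) h

end NonlocalHarnack

open NonlocalHarnack

theorem theorem1p2 (N : ℕ) (hN : 2 ≤ N) (α C₁ C₂ : ℝ) (hα₀ : 0 < α) (hα₂ : α < 2)
    (hC₁ : 1 ≤ C₁) (hC₂ : 1 ≤ C₂) :
    ∃ ε ∈ Set.Ioo (0 : ℝ) 1, ∃ η ∈ Set.Ioo (0 : ℝ) 1,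
      ∀ E : Set (NonlocalHarnack.Eucl N), IsOpen E → IsConnected E → Bornology.IsBounded E →
      ∀ μ : NonlocalHarnack.Eucl N → MeasureTheory.Measure (NonlocalHarnack.Eucl N),
        NonlocalHarnack.SymmetricFamily μ →
        NonlocalHarnack.PoincareInequality μ E α C₁ →
        NonlocalHarnack.DecayBound μ α C₂ →
      ∀ u : NonlocalHarnack.Eucl N → ℝ, NonlocalHarnack.IsLocalWeakSupersolution μ E u →
      ∀ (x₀ : NonlocalHarnack.Eucl N) (R : ℝ), Metric.ball x₀ R ⊆ E →
        (∀ᵐ x ∂(volume.restrict (Metric.ball x₀ R)), 0 ≤ u x) →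
      ∀ r : ℝ, 0 < r → r < R / 32 →
        IntegrableOn (fun x => u x ^ ε) (Metric.ball x₀ r) volume ∧
        η * (⨍ x in Metric.ball x₀ r, u x ^ ε) ^ (1 / ε)
            - (r / R) ^ α *
              (NonlocalHarnack.nonlocalTail μ α (NonlocalHarnack.negPart u) x₀
                (7 / 8 * R) R).toReal
          ≤ essInf u (volume.restrict (Metric.ball x₀ (2 * r))) := by
  obtain ⟨ε, hε, η, hη, hmain⟩ := exists_weak_harnack (N := N) (by omega) hα₀ hα₂ hC₁ hC₂
  refine ⟨ε, hε, η, hη, ?_⟩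
  intro E _ _ _ μ hμ hP hdec u hu x₀ R hRE hu0 r hr hrR
  obtain ⟨κ, v, huv, hS⟩ := exists_jumpSetting hα₀ hα₂ hC₁ hC₂ hμ hP hdec hu hRE hu0 hr hrR
  set τ := (r / R) ^ α * (nonlocalTail μ α (negPart u) x₀ (7 / 8 * R) R).toReal with hτ
  have hR : 0 < R := by linarith
  have hτ0 : 0 ≤ τ := by positivity
  -- Any admissible `d` would do here: this instance serves for the measurability and sign of `v`
  -- and the integrability of `v ^ ε`.
  have hS1 := hS (τ + 1) (by linarith) (by linarith)
  have hvm : Measurable v := hS1.measurable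
  have hv0 : ∀ x ∈ Metric.ball x₀ r, 0 ≤ v x := fun x hx =>
    hS1.nonneg x (Metric.ball_subset_ball (by linarith) hx)
  have huvε : (fun x => u x ^ ε) =ᵐ[volume.restrict (Metric.ball x₀ r)] fun x => v x ^ ε := by
    filter_upwards [ae_restrict_of_ae huv] with x hx
    rw [hx]
  have hvε0 : ∀ᵐ x ∂(volume.restrict (Metric.ball x₀ r)), 0 ≤ v x ^ ε :=
    (ae_restrict_iff' measurableSet_ball).2
      (Filter.Eventually.of_forall fun x hx => Real.rpow_nonneg (hv0 x hx) ε)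
  have hvint : IntegrableOn (fun x => v x ^ ε) (Metric.ball x₀ r) volume := by
    obtain ⟨m, -, -, hm⟩ := hmain κ v x₀ R r _ hS1
    refine (lintegral_ofReal_ne_top_iff_integrable
      (hvm.pow_const ε).aestronglyMeasurable hvε0).1 ?_
    exact (hm.trans_lt (ENNReal.mul_lt_top ENNReal.ofReal_lt_top measure_ball_lt_top)).ne
  refine ⟨hvint.congr huvε.symm, ?_⟩
  have hav : ⨍ x in Metric.ball x₀ r, u x ^ ε = ⨍ x in Metric.ball x₀ r, v x ^ ε := by
    rw [setAverage_eq, setAverage_eq, integral_congr_ae huvε]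
  rw [hav]
  -- The tail may vanish, and `d` must be positive and strictly above `τ`, so the estimate is
  -- applied with `d = τ + δ` and `δ` is sent to zero.
  refine le_of_forall_pos_le_add fun δ hδ => ?_
  obtain ⟨m, hm0, hmle, hmint⟩ := hmain κ v x₀ R r _ (hS (τ + δ) (by linarith) (by linarith))
  have hV : 0 < volume.real (Metric.ball x₀ r) :=
    ENNReal.toReal_pos (volume_ball_pos x₀ hr).ne' (volume_ball_lt_top x₀ r).ne
  have hη0 := hη.1
  have hI : ⨍ x in Metric.ball x₀ r, v x ^ ε ≤ (m / η) ^ ε := by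
    rw [setAverage_eq, smul_eq_mul, inv_mul_eq_div, div_le_iff₀ hV]
    rw [← ofReal_integral_eq_lintegral_ofReal hvint hvε0,
      ← ENNReal.ofReal_toReal (volume_ball_lt_top x₀ r).ne,
      ← ENNReal.ofReal_mul (by positivity)] at hmint
    exact (ENNReal.ofReal_le_ofReal_iff (by positivity)).1 hmint
  have hI0 : 0 ≤ ⨍ x in Metric.ball x₀ r, v x ^ ε := by
    rw [setAverage_eq, smul_eq_mul]
    exact mul_nonneg (inv_nonneg.2 hV.le) (integral_nonneg_of_ae hvε0)
  have hle : η * (⨍ x in Metric.ball x₀ r, v x ^ ε) ^ (1 / ε) ≤ m := by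
    have h1 : (⨍ x in Metric.ball x₀ r, v x ^ ε) ^ (1 / ε) ≤ m / η := by
      calc _ ≤ ((m / η) ^ ε) ^ (1 / ε) :=
            Real.rpow_le_rpow hI0 hI (one_div_nonneg.2 hε.1.le)
        _ = m / η := by
            rw [← Real.rpow_mul (by positivity), mul_one_div_cancel hε.1.ne', Real.rpow_one]
    rwa [le_div_iff₀ hη0, mul_comm] at h1
  have hne : volume.restrict (Metric.ball x₀ (2 * r)) ≠ 0 := by
    rw [Ne, Measure.restrict_eq_zero]
    exact (volume_ball_pos x₀ (by positivity)).ne'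
  have hess : m - (τ + δ) ≤ essInf u (volume.restrict (Metric.ball x₀ (2 * r))) := by
    refine le_essInf_of_ae_le_real hne ((ae_restrict_iff' measurableSet_ball).2 ?_)
    filter_upwards [hmle, huv] with x hx hxv hxB
    rw [hxv]; linarith [hx hxB]
  linarith
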